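/- **Conventions.** A virtual diagram is an oriented 4-valent plane diagram whose crossings are classical (positive or negative) or virtual; a virtual link is a class of virtual diagrams modulo the generalized Reidemeister moves. A long arc runs from an underpass of a classical crossing to the next one; virtual crossings cut it into arcs $\gamma_0,\gamma_1,\dots$ (overpasses do not cut). Let $\gamma^v$ be the long arc emanating from the classical crossing $v$. The degree of $\gamma^v_0$ is $0$, and the degree rises (falls) by $1$ at each virtual crossing where the long arc crosses the other strand from left to right (from right to left); let $p_v$ be the number of degree-raising (increasing) virtual passages on $\gamma^v$. The diagram is proper if every component goes through an underpass, and special if it is proper and for each $v$ the arc $\gamma^v_{p_v}$ exists and has degree $p_v$; this arc is the critical arc of $\gamma^v$, and the arcs before (after) it are pre-critical (post-critical). The $T$-matrix $T(D)$ of a special diagram has the entries $T_{vw}=[v:\gamma^w_{p_w}]$, where $[v:\gamma]$ is the sum of $1$ if $\gamma$ emanates from $v$, $t^{\operatorname{sgn}v}-1$ if $\gamma$ passes over $v$, and $-t^{\operatorname{sgn}v}$ if $\gamma$ comes into $v$. An $M$-diagram is a special diagram in which no arc emanates from, passes over and comes into one and the same crossing, and in which there is exactly one bijection between classical crossings and critical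 arcs that pairs each crossing with an incident critical arc. An $M$-link ($M$-knot) is a virtual link (knot) with an $M$-diagram. A special sum cuts two edges of a special plane diagram (possibly a disconnected sum $D_1\sqcup D_2$) that lie on two pre-critical arcs, or on two post-critical arcs, of different long arcs, and reconnects them by two oppositely oriented parallel lines, without creating crossings. **Statement.** 1. For an $M$-diagram $D$ there are unique $\varepsilon\in\{1,-1\}$, $\alpha\in\mathbb Z$, $\beta\in\mathbb Z_{\ge0}$ with $\det T(D)=\varepsilon\,t^{\alpha}(t-1)^{\beta}$. Every $M$-diagram has the least possible number of virtual crossings among all diagrams of its virtual link. The numbers $\varepsilon$ and $\beta$ depend only on the virtual link of $D$. 2. A special connected sum of $M$-diagrams $D_1,D_2$ is an $M$-diagram, with $\beta(D_1+D_2)=\beta(D_1)+\beta(D_2)$ and $\varepsilon(D_1+D_2)=\mp\,\varepsilon(D_1)\varepsilon(D_2)$, with $-$ for a pre-critical and $+$ for a post-critical sum. Likewise, a special sum performed inside one $M$-diagram gives an $M$-diagram with the same $\beta$, and with $\varepsilon$ multiplied by $-1$ (pre-critical) or $+1$ (post-critical). 3. Let $\Omega_n$ be the closed 2-strand braid with $2n+1$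 crossings, alternately negative classical and virtual ($n+1$ negative, $n$ virtual). Let $W_n$ be the knot diagram made of an antiparallel twist region of $2n$ crossings, alternately negative classical and virtual, closed by a clasp of two positive crossings (so that, read along the knot, one goes through crossings $0,\dots,2n-1$ of the twist region, the even ones being negative, then over $2n$, under $2n+1$, back through $2n-1,\dots,0$, over $2n+1$ and under $2n$; on the first run the strand crosses the even crossings from right to left and the odd ones from left to right). Let $T$ and $\widetilde T$ be the positive and the negative virtual trefoil (the closed 2-braids with three crossings, two of them positive, respectively negative, and the middle one virtual), and let $T_n$, $\widetilde T_n$ be any diagrams that are special connected sums of $n$ copies of $T$, respectively $\widetilde T$, along the path schemes $T\sim T-T\sim T-\cdots$ and $\widetilde T-\widetilde T\sim\widetilde T-\widetilde T\sim\cdots$, where $\sim$ is a pre-critical and $-$ a post-critical sum; such diagrams exist for all $n\ge1$. For all $n\ge1$ these are $M$-diagrams of knots with $n$ virtual crossings, $n$ is the minimal virtual crossing number of the knot, and they have respectively $n+1$, $n+2$, $2n$, $2n$ classical crossings, $\beta=1,\,1,\,n,\,n$, and $\varepsilon(\Omega_n)=-1$, $\varepsilon(W_n)=1$, $\varepsilon(T_n)=1\Leftrightarrow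 n\equiv0,1\pmod 4$, $\varepsilon(\widetilde T_n)=1\Leftrightarrow n\equiv 2,3\pmod 4$. 4. Let $Q$ be the closed 2-braid with five crossings, alternately positive classical and virtual (three positive, two virtual). A $Q$-knot is a knot diagram obtained from $r\ge1$ copies of $Q$ by special sums, along any scheme (not necessarily a tree). It is an $M$-diagram with $2r$ virtual and $3r$ classical crossings, its knot has minimal virtual crossing number $2r$, $\beta=r$, and $\varepsilon=(-1)^w$, where $w$ is the number of pre-critical sums. For each $r\ge2$ there are two $Q$-knots with $r$ copies of $Q$ that represent different virtual knots. 5. The virtual knots $\Omega_n,W_n,T_n,\widetilde T_n$, $n\ge2$, are pairwise distinct (for equal and for different $n$), and they are distinct from all $Q$-knots with $r\ge2$ copies of $Q$; in particular, for even $n\ge4$ the knots $\Omega_n,W_n,T_n,\widetilde T_n,Q'_n,Q''_n$ are pairwise distinct, where $Q'_n,Q''_n$ are any two different $Q$-knots with minimal virtual crossing number $n$. -/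

import Mathlib

open scoped LaurentPolynomial

/-- The type of a crossing of a virtual diagram. -/
inductive CrossingKind
  | positive
  | negative
  | virtual
  deriving DecidableEq

namespace CrossingKind

/-- The local writhe number of a classical crossing (`0` for a virtual crossing). -/
def sign : CrossingKind → ℤ
  | positive => 1
  | negative => -1
  | virtual => 0

/-- Exchange positive and negative crossings. -/
def opposite : CrossingKind → CrossingKind
  | positive => negative
  | negative => positive
  | virtual => virtual

/-- The kind of a classical crossing whose overpass is the strand `s`
(see `Diagram` for the naming of the two strands). -/
def withOver (s : Bool) : CrossingKind := if s then positive else negative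

end CrossingKind

/-- The combinatorial data of an oriented 4-valent diagram with classical and virtual crossings on a
closed oriented surface.

Draw a neighbourhood of a crossing so that both strands go upwards. The strand `true` is the one
that runs from the bottom left to the top right, that is, it crosses the other strand *from the
left to the right*; the strand `false` runs from the bottom right to the top left. A crossing is
positive if the overpass is the strand `true` and negative if it is the strand `false`.

A *passage* `(c, s)` is the passage of the diagram through the crossing `c` along the strand `s`.
Each passage is followed, along the orientation, by another passage, `succ`. The edges of the
4-valent graph are named by the passage at which they start: the edge `p` leads from the
passage `p` to the passage `succ p`. Components without crossings are only counted, by `circles`.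
-/
structure Diagram where
  C : Type
  [fintypeC : Fintype C]
  [decEqC : DecidableEq C]
  kind : C → CrossingKind
  succ : Equiv.Perm (C × Bool)
  circles : ℕ

namespace Diagram

attribute [instance] Diagram.fintypeC Diagram.decEqC

variable (D : Diagram)

/-- Passages of the diagram through its crossings; also the names of the edges (an edge is named by
the passage at which it starts). -/
abbrev Passage : Type := D.C × Bool

/-- The diagram is drawn on the 2-sphere (equivalently, in the plane), or on a disjoint union
of spheres, one for each component of the underlying graph: the closed oriented surface which is
obtained from the graph by gluing a disc along each face has trivial first homology. In detail:
every integral 1-cycle `f` of the graph is the boundary of an integral 2-chain. A 2-chain is an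
assignment of an integer to each face; it is given by the values `l e`, `r e` on the faces to the
left and to the right of each edge `e`, which have to agree at the four corners (west, north, east,
south) of every crossing. -/
def IsPlanar : Prop :=
  ∀ f : D.Passage → ℤ,
    (∀ c, f (D.succ.symm (c, true)) + f (D.succ.symm (c, false)) = f (c, true) + f (c, false)) →
    ∃ l r : D.Passage → ℤ,
      (∀ e, f e = l e - r e) ∧
      ∀ c, l (D.succ.symm (c, true)) = l (c, false) ∧
        l (c, true) = r (c, false) ∧
        r (c, true) = r (D.succ.symm (c, false)) ∧
        r (D.succ.symm (c, true)) = l (D.succ.symm (c, false))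

/-- The number of link components of the diagram. -/
noncomputable def numComponents : ℕ :=
  D.circles + Nat.card (Quotient (Equiv.Perm.SameCycle.setoid D.succ))

/-- A knot diagram has exactly one component. -/
def IsKnot : Prop := D.numComponents = 1

/-- The number of virtual crossings. -/
def numVirtual : ℕ := Fintype.card {c : D.C // D.kind c = CrossingKind.virtual}

/-- The classical crossings. -/
abbrev Classical : Type := {c : D.C // D.kind c ≠ CrossingKind.virtual}

/-- The number of classical crossings. -/
def numClassical : ℕ := Fintype.card D.Classical

/-! ### Equivalence of diagrams -/

/-- Isomorphism of diagrams (orientation preserving homeomorphism of the underlying surfaces). -/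
def Iso (D D' : Diagram) : Prop :=
  ∃ e : D.C ≃ D'.C, (∀ c, D'.kind (e c) = D.kind c) ∧
    (∀ p : D.Passage, D'.succ (e p.1, p.2) = (e (D.succ p).1, (D.succ p).2)) ∧
    D'.circles = D.circles

/-- `D'` arises from `D` by removing the crossings in `S`: the strands of `D` through these crossings
become uninterrupted pieces of edges, and the components of `D` which only meet crossings
in `S` become circles without crossings. -/
def IsRemoval (D : Diagram) (S : Set D.C) (D' : Diagram) : Prop :=
  ∃ e : D'.C ≃ {c : D.C // c ∉ S},
    (∀ c, D'.kind c = D.kind (e c)) ∧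
    (∀ p : D'.Passage, ∃ k : ℕ,
      (∀ j, 1 ≤ j → j ≤ k → ((D.succ ^ j) ((e p.1 : D.C), p.2)).1 ∈ S) ∧
      (D.succ ^ (k + 1)) ((e p.1 : D.C), p.2) = ((e (D'.succ p).1 : D.C), (D'.succ p).2)) ∧
    D'.circles = D.circles +
      Nat.card {q : Quotient (Equiv.Perm.SameCycle.setoid D.succ) //
        ∀ p : D.Passage, Quotient.mk _ p = q → p.1 ∈ S}

/-- The crossing `c` is a curl: a strand of `D` leaves `c` and returns to it at once. -/
def IsCurl (c : D.C) : Prop := ∃ s : Bool, D.succ (c, s) = (c, !s)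

/-- The crossings `c` and `d` are the vertices of a bigon which can be removed by the second
(classical or virtual) Reidemeister move: a strand goes directly from `c` to `d`, the other strand
goes directly from `c` to `d` or from `d` to `c`, the strands bound a face, and either both
crossings are virtual, or both are classical and the same strand is over at both of them. -/
def IsBigon (c d : D.C) : Prop :=
  c ≠ d ∧ D.kind d = (D.kind c).opposite ∧
    ∃ s : Bool, D.succ (c, s) = (d, !s) ∧
      (D.succ (c, !s) = (d, s) ∨ D.succ (d, s) = (c, !s))

/-- Three pieces `X`, `Y`, `Z` of strands of `D` which bound a triangular face, as in the third
Reidemeister move.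
* `xy`, `xz`, `yz` are the crossings of the respective pieces, the piece `X` is
  the strand `sxy` at `xy` and `sxz` at `xz`, the piece `Y` is the strand `syz` at `yz`.
* `ox`: `X` meets `Y` before `Z`; `oy`: `Y` meets `X` before `Z`; `oz`: `Z` meets `X` before `Y`.
* `face_X`: the corner of the triangle at `xy` and the one at `xz` are on the same side of `X`
  (to the left of `X` if and only if `oy = sxy`, respectively `oz = sxz`); similarly for `Y`, `Z`.
* `kinds`: either `X` only has virtual crossings with `Y` and `Z` (and the crossing of `Y` and `Z` is
  arbitrary), or `X` is over `Y` and `Z`, and `Y` is over `Z`. -/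
structure Triangle where
  xy : D.C
  xz : D.C
  yz : D.C
  xy_ne_xz : xy ≠ xz
  xy_ne_yz : xy ≠ yz
  xz_ne_yz : xz ≠ yz
  sxy : Bool
  sxz : Bool
  syz : Bool
  ox : Bool
  oy : Bool
  oz : Bool
  succ_X : if ox then D.succ (xy, sxy) = (xz, sxz) else D.succ (xz, sxz) = (xy, sxy)
  succ_Y : if oy then D.succ (xy, !sxy) = (yz, syz) else D.succ (yz, syz) = (xy, !sxy)
  succ_Z : if oz then D.succ (xz, !sxz) = (yz, !syz) else D.succ (yz, !syz) = (xz, !sxz)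
  face_X : oy = sxy ↔ oz = sxz
  face_Y : ox ≠ sxy ↔ oz ≠ syz
  face_Z : ox = sxz ↔ oy = syz
  kinds : (D.kind xy = CrossingKind.virtual ∧ D.kind xz = CrossingKind.virtual) ∨
    (D.kind xy = CrossingKind.withOver sxy ∧ D.kind xz = CrossingKind.withOver sxz ∧
      D.kind yz = CrossingKind.withOver syz)

/-- The third move: on each of the three pieces of strands the order of the two passages is
reversed. -/
def Triangle.slide {D : Diagram} (t : D.Triangle) : Diagram :=
  let τ : Equiv.Perm D.Passage :=
    Equiv.swap (t.xy, t.sxy) (t.xz, t.sxz) * Equiv.swap (t.xy, !t.sxy) (t.yz, t.syz) *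
      Equiv.swap (t.xz, !t.sxz) (t.yz, !t.syz)
  { D with succ := τ * D.succ * τ⁻¹ }

end Diagram

/-- A virtual diagram: a 4-valent diagram in the plane with classical and virtual crossings. -/
abbrev VirtualDiagram : Type 1 := {D : Diagram // D.IsPlanar}

/-- The generalized Reidemeister moves: the classical moves, and the detour move in the form of the
local moves that generate it (the three purely virtual Reidemeister moves, and the
semivirtual third move, in which a strand with virtual crossings slides over a classical one). -/
inductive ReidemeisterMove : VirtualDiagram → VirtualDiagram → Prop
  | iso (D D' : VirtualDiagram) (h : Diagram.Iso D.1 D'.1) : ReidemeisterMove D D'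
  | first (D D' : VirtualDiagram) (c : D.1.C) (hc : D.1.IsCurl c)
      (h : Diagram.IsRemoval D.1 {c} D'.1) : ReidemeisterMove D D'
  | second (D D' : VirtualDiagram) (c d : D.1.C) (hcd : D.1.IsBigon c d)
      (h : Diagram.IsRemoval D.1 {c, d} D'.1) : ReidemeisterMove D D'
  | third (D D' : VirtualDiagram) (t : D.1.Triangle) (h : D'.1 = t.slide) : ReidemeisterMove D D'

/-- A virtual link is an equivalence class of virtual diagrams modulo the equivalence relation
generated by the generalized Reidemeister moves. -/
def VirtualLink : Type 1 := Quot ReidemeisterMove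

/-- The virtual link of a virtual diagram. -/
def VirtualLink.of (D : Diagram) (h : D.IsPlanar) : VirtualLink := Quot.mk _ ⟨D, h⟩

/-- The minimal number of virtual crossings of a diagram of the virtual link. -/
noncomputable def VirtualLink.virtualCrossingNumber (L : VirtualLink) : ℕ :=
  sInf {k | ∃ (D : Diagram) (h : D.IsPlanar), VirtualLink.of D h = L ∧ D.numVirtual = k}

namespace Diagram

variable (D : Diagram)

/-! ### Long arcs, arcs, `T`-matrix -/

/-- The passage is the underpass of a classical crossing. -/
def IsUnder (p : D.Passage) : Prop :=
  (D.kind p.1 = CrossingKind.positive ∧ p.2 = false) ∨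
    (D.kind p.1 = CrossingKind.negative ∧ p.2 = true)

instance (p : D.Passage) : Decidable (D.IsUnder p) := by
  unfold IsUnder; infer_instance

/-- The underpass of a classical crossing. -/
def underpass (v : D.Classical) : D.Passage := (v.1, decide (D.kind v.1 = CrossingKind.negative))

/-- The overpass of a classical crossing. -/
def overpass (v : D.Classical) : D.Passage := (v.1, decide (D.kind v.1 = CrossingKind.positive))

/-- A diagram is proper if it has no cyclic long arcs: every component goes through the
underpass of some classical crossing. -/
def IsProper : Prop :=
  D.circles = 0 ∧ ∀ p : D.Passage, ∃ v : D.Classical, D.succ.SameCycle (D.underpass v) p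

theorem isUnder_underpass (v : D.Classical) : D.IsUnder (D.underpass v) := by
  obtain ⟨c, hc⟩ := v
  unfold IsUnder underpass
  cases h : D.kind c <;> simp_all

/-- The `k`-th passage of the long arc which emanates from the classical crossing `v`; the `0`-th one
is the underpass of `v`. -/
def passage (v : D.Classical) (k : ℕ) : D.Passage := (D.succ ^ k) (D.underpass v)

theorem exists_isUnder_passage (v : D.Classical) : ∃ k, 0 < k ∧ D.IsUnder (D.passage v k) :=
  ⟨orderOf D.succ, orderOf_pos _, by
    simpa [passage, pow_orderOf_eq_one] using D.isUnder_underpass v⟩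

/-- The number of edges of the long arc which emanates from `v`. These edges are `passage v k` with
`k < length v`, and the long arc ends at the underpass `passage v (length v)`. -/
def length (v : D.Classical) : ℕ := Nat.find (D.exists_isUnder_passage v)

/-- The change of the exponent of `s` at a passage: `1` on passing through a virtual crossing from the
left to the right, `-1` on passing from the right to the left, `0` at a classical crossing. -/
def shift (p : D.Passage) : ℤ :=
  if D.kind p.1 = CrossingKind.virtual then (if p.2 then 1 else -1) else 0

/-- The exponent of `s` on the `k`-th edge of the long arc emanating from `v`. -/
def degree (v : D.Classical) (k : ℕ) : ℤ := ∑ i ∈ Finset.Icc 1 k, D.shift (D.passage v i)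

/-- The number `μ` of the arc `γ_μ` which contains the `k`-th edge of the long arc emanating
from `v`: the number of virtual crossings passed before that edge. -/
def arcIndex (v : D.Classical) (k : ℕ) : ℕ :=
  ((Finset.Icc 1 k).filter fun i => D.kind (D.passage v i).1 = CrossingKind.virtual).card

/-- The number `p_v` of increasing virtual crossings on the long arc emanating from `v`. -/
def numIncreasing (v : D.Classical) : ℕ :=
  ((Finset.Ico 1 (D.length v)).filter fun i => D.shift (D.passage v i) = 1).card

/-- The diagram is special: every long arc contains a critical arc, that is, an arc `γ_μ`
with `μ = p_v` whose degree is the largest possible one, `p_v`. -/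
def IsSpecial : Prop :=
  ∀ v : D.Classical, ∃ k < D.length v,
    D.arcIndex v k = D.numIncreasing v ∧ D.degree v k = D.numIncreasing v

/-- The arc number `μ` of the long arc emanating from `w` emanates from the crossing `v`. -/
def Emanates (v w : D.Classical) (μ : ℕ) : Prop := v = w ∧ μ = 0

/-- The arc number `μ` of the long arc emanating from `w` passes (over) through the crossing `v`. -/
def PassesThrough (v w : D.Classical) (μ : ℕ) : Prop :=
  ∃ k ∈ Finset.Ico 1 (D.length w), D.passage w k = D.overpass v ∧ D.arcIndex w k = μ

/-- The arc number `μ` of the long arc emanating from `w` comes into the crossing `v`. -/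
def ComesInto (v w : D.Classical) (μ : ℕ) : Prop :=
  D.passage w (D.length w) = D.underpass v ∧ D.arcIndex w (D.length w - 1) = μ

instance (v w : D.Classical) (μ : ℕ) : Decidable (D.Emanates v w μ) := by
  unfold Emanates; infer_instance

instance (v w : D.Classical) (μ : ℕ) : Decidable (D.PassesThrough v w μ) := by
  unfold PassesThrough; infer_instance

instance (v w : D.Classical) (μ : ℕ) : Decidable (D.ComesInto v w μ) := by
  unfold ComesInto; infer_instance

/-- The incidence coefficient of the crossing `v` and the arc number `μ` of the long arc
emanating from `w`. -/
noncomputable def incidenceCoeff (v w : D.Classical) (μ : ℕ) : ℤ[T;T⁻¹] :=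
  (if D.Emanates v w μ then 1 else 0) +
  (if D.PassesThrough v w μ then LaurentPolynomial.T (D.kind v.1).sign - 1 else 0) +
  (if D.ComesInto v w μ then -LaurentPolynomial.T (D.kind v.1).sign else 0)

/-- The `T`-matrix of a special diagram: the incidence coefficients of the classical crossings
and the critical arcs. -/
noncomputable def tMatrix : Matrix D.Classical D.Classical ℤ[T;T⁻¹] :=
  Matrix.of fun v w => D.incidenceCoeff v w (D.numIncreasing w)

/-- The crossing `v` is incident with the critical arc of the long arc emanating from `w`, that is,
the incidence matrix `M` of the special diagram has a `1` at the place `(v, w)`. -/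
def IncidentCritical (v w : D.Classical) : Prop :=
  D.Emanates v w (D.numIncreasing w) ∨ D.PassesThrough v w (D.numIncreasing w) ∨
    D.ComesInto v w (D.numIncreasing w)

/-- A classical crossing is cyclic if some arc emanates from it, passes through it and comes
into it. -/
def IsCyclicCrossing (v : D.Classical) : Prop :=
  ∃ (w : D.Classical) (μ : ℕ), D.Emanates v w μ ∧ D.PassesThrough v w μ ∧ D.ComesInto v w μ

/-- `M`-diagrams: special (proper, planar) diagrams without cyclic crossings, with a unique pairing
of classical crossings and critical arcs. -/
structure IsMDiagram : Prop where
  planar : D.IsPlanar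
  proper : D.IsProper
  special : D.IsSpecial
  noCyclic : ∀ v, ¬ D.IsCyclicCrossing v
  pairing : ∃! σ : Equiv.Perm D.Classical, ∀ v, D.IncidentCritical v (σ v)

/-! ### Special connected sums -/

/-- Cut the edges `e` and `f` and join their ends the other way round, by two oppositely
oriented lines: the edge which starts like `e` now ends like `f`, and vice versa. -/
def surgery (e f : D.Passage) : Diagram := { D with succ := D.succ * Equiv.swap e f }

/-- The disconnected sum of two diagrams. -/
def disjointUnion (D D' : Diagram) : Diagram where
  C := D.C ⊕ D'.C
  kind := Sum.elim D.kind D'.kind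
  succ := (Equiv.sumProdDistrib D.C D'.C Bool).symm.permCongr (Equiv.sumCongr D.succ D'.succ)
  circles := D.circles + D'.circles

/-- The connected sum of `D` and `D'` along the edge `e` of `D` and the edge `f` of `D'`. -/
def connectedSum (D D' : Diagram) (e : D.Passage) (f : D'.Passage) : Diagram :=
  (D.disjointUnion D').surgery (Sum.inl e.1, e.2) (Sum.inr f.1, f.2)

end Diagram

/-- The two types of special sums. -/
inductive SumType
  | preCritical
  | postCritical

/-- The sign with which a special sum acts on the invariant `ε`. -/
def SumType.sign : SumType → ℤˣ
  | preCritical => -1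
  | postCritical => 1

/-- The number of wave lines (pre-critical sums) contributed to a scheme by a sum. -/
def SumType.waves : SumType → ℕ
  | preCritical => 1
  | postCritical => 0

/-- The other type of special sum. -/
def SumType.other : SumType → SumType
  | preCritical => postCritical
  | postCritical => preCritical

namespace Diagram

variable (D : Diagram)

/-- In a special diagram, the edge `e` belongs to a pre-critical (respectively, post-critical) arc of
the long arc which emanates from `v`, that is, to an arc preceding (following) the critical
arc on this long arc. -/
def EdgeOfType (κ : SumType) (v : D.Classical) (e : D.Passage) : Prop :=
  ∃ k < D.length v, D.passage v k = e ∧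
    match κ with
    | SumType.preCritical => D.arcIndex v k < D.numIncreasing v
    | SumType.postCritical => D.numIncreasing v < D.arcIndex v k

/-- The edges `e` and `f` of one special diagram can be used for a special sum of type `κ`: they belong
to two pre-critical, or to two post-critical, arcs of different long arcs. -/
def IsSpecialPair (κ : SumType) (e f : D.Passage) : Prop :=
  ∃ v w : D.Classical, v ≠ w ∧ D.EdgeOfType κ v e ∧ D.EdgeOfType κ w f

/-! ### The series -/

/-- The closure of the 2-strand virtual braid with `m` crossings of the given kinds. -/
def braidClosure (m : ℕ) (kind : Fin m → CrossingKind) : Diagram where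
  C := Fin m
  kind := kind
  succ := Equiv.prodCongr (finRotate m) Equiv.boolNot
  circles := 0

/-- The diagram `Ω_n`: the closed 2-braid with `2 n + 1` crossings, which are alternately negative
classical and virtual (`n + 1` classical and `n` virtual crossings). -/
def omega (n : ℕ) : Diagram :=
  braidClosure (2 * n + 1) fun i => if i.1 % 2 = 0 then .negative else .virtual

/-- The diagram `T`: the positive virtual trefoil, with two positive crossings and a virtual one. -/
def trefoilT : Diagram :=
  braidClosure 3 fun i => if i.1 % 2 = 0 then .positive else .virtual

/-- The diagram `T̃`: the negative virtual trefoil, with two negative crossings and a virtual one. -/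
def trefoilT' : Diagram :=
  braidClosure 3 fun i => if i.1 % 2 = 0 then .negative else .virtual

/-- The diagram `Q`: the closed 2-braid with 5 crossings, which are alternately positive classical and
virtual. -/
def knotQ : Diagram :=
  braidClosure 5 fun i => if i.1 % 2 = 0 then .positive else .virtual

/-- The cyclic sequence of passages of the diagram `W_n`. The knot first goes through the crossings
`0, …, 2 n - 1` of a twist region, then through the two crossings `2 n` (over) and `2 n + 1` (under)
of a clasp, then back through the twist region, and through `2 n + 1` (over) and `2 n` (under). -/
def wWord (n : ℕ) : Fin (4 * n + 4) ≃ Fin (2 * n + 2) × Bool where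
  toFun j :=
    if h : j.1 < 2 * n then (⟨j.1, by omega⟩, decide (j.1 % 2 = 1))
    else if j.1 = 2 * n then (⟨2 * n, by omega⟩, true)
    else if j.1 = 2 * n + 1 then (⟨2 * n + 1, by omega⟩, false)
    else if h' : j.1 < 4 * n + 2 then (⟨4 * n + 1 - j.1, by omega⟩, decide (j.1 % 2 = 1))
    else if j.1 = 4 * n + 2 then (⟨2 * n + 1, by omega⟩, true)
    else (⟨2 * n, by omega⟩, false)
  invFun p :=
    if h : p.1.1 < 2 * n then
      (if p.2 = decide (p.1.1 % 2 = 1) then ⟨p.1.1, by omega⟩ else ⟨4 * n + 1 - p.1.1, by omega⟩)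
    else if p.1.1 = 2 * n then
      (if p.2 then ⟨2 * n, by omega⟩ else ⟨4 * n + 3, by omega⟩)
    else (if p.2 then ⟨4 * n + 2, by omega⟩ else ⟨2 * n + 1, by omega⟩)
  left_inv j := by
    obtain ⟨j, hj⟩ := j
    ext
    dsimp only
    split_ifs <;> grind
  right_inv p := by
    obtain ⟨⟨i, hi⟩, s⟩ := p
    ext <;> dsimp only <;> cases s <;> grind

/-- The diagram `W_n`: an antiparallel twist region of `2 n` crossings, which are alternately
negative classical and virtual, closed by a clasp of two positive crossings (`n + 2` classical and
`n` virtual crossings). -/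
def wKnot (n : ℕ) : Diagram where
  C := Fin (2 * n + 2)
  kind i := if i.1 < 2 * n then (if i.1 % 2 = 0 then .negative else .virtual) else .positive
  succ := (wWord n).permCongr (finRotate (4 * n + 4))
  circles := 0

/-- `IsChain A κ n D L`: the diagram `D` is a special connected sum of `n` copies of `A` whose scheme
is a path, in which the types of the sums alternate, the first one being `κ`. Here `L` is the
set of crossings of the last copy, to which the next copy is attached. -/
inductive IsChain (A : Diagram) (κ : SumType) : ℕ → (D : Diagram) → Set D.C → Prop
  | one : IsChain A κ 1 A Set.univ
  | succ (n : ℕ) (D : Diagram) (L : Set D.C) (h : IsChain A κ n D L)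
      (v : D.Classical) (e : D.Passage) (w : A.Classical) (f : A.Passage) (he : e.1 ∈ L)
      (hv : D.EdgeOfType (if n % 2 = 1 then κ else κ.other) v e)
      (hw : A.EdgeOfType (if n % 2 = 1 then κ else κ.other) w f) :
      IsChain A κ (n + 1) (D.connectedSum A e f) (Set.range Sum.inr)

/-- `IsQSum r w D`: the diagram `D` is obtained from `r` copies of `Q` by special sums (along
any scheme, not necessarily a tree), with `w` pre-critical sums (wave lines in the scheme). -/
inductive IsQSum : ℕ → ℕ → Diagram → Prop
  | single : IsQSum 1 0 knotQ
  | union (r w r' w' : ℕ) (D D' : Diagram) (h : IsQSum r w D) (h' : IsQSum r' w' D') :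
      IsQSum (r + r') (w + w') (D.disjointUnion D')
  | sum (r w : ℕ) (D : Diagram) (h : IsQSum r w D) (κ : SumType) (e f : D.Passage)
      (hef : D.IsSpecialPair κ e f) (hp : (D.surgery e f).IsPlanar) :
      IsQSum r (w + κ.waves) (D.surgery e f)

/-- A `Q`-knot with `r` copies of `Q` and `w` wave lines. -/
def IsQKnot (r w : ℕ) (D : Diagram) : Prop := IsQSum r w D ∧ D.IsKnot

end Diagram

/-- The names of the series of knots `Ω`, `W`, `T`, `T̃`. -/
inductive Series
  | Ω
  | W
  | T
  | T'
  deriving DecidableEq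

namespace Series

/-- The diagrams which belong to the `n`-th place of the series. -/
def Mem (n : ℕ) (D : Diagram) : Series → Prop
  | Ω => D = Diagram.omega n
  | W => D = Diagram.wKnot n
  | T => ∃ L, Diagram.IsChain Diagram.trefoilT .preCritical n D L
  | T' => ∃ L, Diagram.IsChain Diagram.trefoilT' .postCritical n D L

/-- The value of `ε` on the series. -/
def epsValue (n : ℕ) : Series → ℤˣ
  | Ω => -1
  | W => 1
  | T => if n % 4 = 0 ∨ n % 4 = 1 then 1 else -1
  | T' => if n % 4 = 2 ∨ n % 4 = 3 then 1 else -1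

/-- The value of `β` on the series. -/
def betaValue (n : ℕ) : Series → ℕ
  | Ω => 1
  | W => 1
  | T => n
  | T' => n

/-- The number of classical crossings of the diagrams of the series. -/
def classicalValue (n : ℕ) : Series → ℕ
  | Ω => n + 1
  | W => n + 2
  | T => 2 * n
  | T' => 2 * n

end Series

/-!
The proof attaches to each diagram `D` a determinant `Diagram.zeta` over a ring with two units `s`
and `t`. There is one generator and one relation for each passage (that is, for each edge): on the
way through a virtual crossing the generator is multiplied by `s` or `s⁻¹`, it does not change at an
overpass, and it satisfies the Alexander relation at an underpass. Each generalized Reidemeister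
move changes this square system of relations only by row operations, by the elimination of
generators and by a factor `t ^ k`. Hence `zeta` is an invariant of virtual links up to powers
of `t` (`VirtualLink.zeta_eq`).

Only the increasing virtual passages contribute a positive power of `s`, each virtual crossing
contributes one of them, so that the degree of `zeta` in `s` is at most the number of virtual
crossings (`Diagram.coeff_zeta_eq_zero`). For a special diagram all generators can be expressed
through the first edges of the long arcs. This leaves a matrix whose columns belong to the long arcs;
in the column of the long arc emanating from `w` the largest possible power of `s` is the number
of its increasing passages, and it occurs exactly on the critical arc. Therefore the coefficient
of `s` to the number of virtual crossings is the determinant of the `T`-matrix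
(`Diagram.Labelling.hasTop_zeta`).

For an `M`-diagram the Leibniz formula for this determinant has a single term, a product of factors
`± t ^ a` and `± t ^ a * (t - 1)` (`Diagram.det_tMatrix`, `Diagram.IsMDiagram.exists_isSignedForm`).
In particular it does not vanish, so an `M`-diagram has the least possible number of virtual
crossings, and its determinant is determined by the virtual link up to a power of `t`, which gives
the invariants `ε` and `β` (`VirtualLink.invariants`).

A special sum exchanges the tails of two long arcs behind two edges. If both edges are pre-critical,
then the critical arcs lie in the tails and two columns of the `T`-matrix are interchanged; if both
are post-critical, then the `T`-matrix does not change (`Diagram.exists_surgery`). Since the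
`T`-matrix of a disconnected sum is block diagonal, this gives the behaviour of `ε` and `β`
under special sums (`Diagram.IsMDiagram.surgery`, `Diagram.IsMDiagram.connectedSum`). The long arcs of
alternating closed 2-braids and of the diagrams `W_n` are written down explicitly
(`Diagram.positiveLabelling`, `Diagram.negativeLabelling`, `Diagram.wLabelling`), the other series
are sums of such diagrams. Finally the knots are distinguished by their virtual crossing numbers
together with `ε` and `β`.
-/

/-! ### Row operations and elimination of generators -/

section Determinants

variable {K : Type*} [CommRing K] {P : Type*} [Fintype P] [DecidableEq P]

/-- A row may be multiplied by `a` and changed by a combination of the other rows. -/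
theorem det_of_sub_mem_span (f g : P → P → K) (i : P) (a : K) (hne : ∀ p, p ≠ i → f p = g p)
    (hi : f i - a • g i ∈ Submodule.span K (g '' {i}ᶜ)) :
    (Matrix.of f).det = a * (Matrix.of g).det := by
  have h0 : ∀ v ∈ Submodule.span K (g '' {i}ᶜ),
      ((Matrix.of g).updateRow i v).det = 0 := by
    intro v hv
    induction hv using Submodule.span_induction with
    | mem x hx =>
      obtain ⟨j, hj, rfl⟩ := hx
      exact Matrix.det_updateRow_eq_zero (M := Matrix.of g) (i := j) (j := i) hj
    | zero => exact Matrix.det_eq_zero_of_row_eq_zero i (by simp)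
    | add x y _ _ hx hy => rw [Matrix.det_updateRow_add, hx, hy, add_zero]
    | smul c x _ hx => rw [Matrix.det_updateRow_smul, hx, mul_zero]
  have hf : Matrix.of f = (Matrix.of g).updateRow i (a • g i + (f i - a • g i)) := by
    ext p q
    by_cases hp : p = i
    · subst hp; simp
    · rw [Matrix.updateRow_ne hp, Matrix.of_apply, Matrix.of_apply, hne p hp]
  rw [hf, Matrix.det_updateRow_add, h0 _ hi, Matrix.det_updateRow_smul, add_zero]
  congr 2
  ext p q
  by_cases hp : p = i
  · subst hp; simp
  · rw [Matrix.updateRow_ne hp]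

/-- If the column `m` vanishes outside the row `i`, then only the entry of the row `i` in this column
matters. -/
theorem det_of_free_row (f g : P → P → K) (i m : P) (hne : ∀ p, p ≠ i → f p = g p)
    (hm : ∀ p, p ≠ i → f p m = 0) (hi : f i m = g i m) :
    (Matrix.of f).det = (Matrix.of g).det := by
  have hf : Matrix.of f = (Matrix.of g).updateRow i (g i + (f i - g i)) := by
    ext p q
    by_cases hp : p = i
    · subst hp; simp
    · rw [Matrix.updateRow_ne hp, Matrix.of_apply, Matrix.of_apply, hne p hp]
  have h0 : ((Matrix.of g).updateRow i (f i - g i)).det = 0 := by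
    apply Matrix.det_eq_zero_of_column_eq_zero m
    intro p
    by_cases hp : p = i
    · subst hp; simp [hi]
    · rw [Matrix.updateRow_ne hp, Matrix.of_apply, ← hne p hp, hm p hp]
  rw [hf, Matrix.det_updateRow_add, h0, add_zero]
  congr 1
  ext p q
  by_cases hp : p = i
  · subst hp; simp
  · rw [Matrix.updateRow_ne hp]

/-- A matrix which is unitriangular with respect to `depth`. -/
theorem det_eq_one_of_depth (M : Matrix P P K) (depth : P → ℕ) (h1 : ∀ p, M p p = 1)
    (h0 : ∀ p q, p ≠ q → depth p ≤ depth q → M p q = 0) : M.det = 1 := by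
  have hb : M.BlockTriangular (fun p => OrderDual.toDual (depth p)) := by
    intro i j hij
    have hij' : depth i < depth j := OrderDual.toDual_lt_toDual.mp hij
    exact h0 i j (fun h => by subst h; exact lt_irrefl _ hij') hij'.le
  rw [hb.det]
  apply Finset.prod_eq_one
  intro a _
  have : M.toSquareBlock (fun p => OrderDual.toDual (depth p)) a = 1 := by
    ext ⟨p, hp⟩ ⟨q, hq⟩
    by_cases hpq : p = q
    · subst hpq; simp [Matrix.toSquareBlock_def, h1]
    · rw [Matrix.one_apply_ne (by simpa using hpq)]
      simp only [Matrix.toSquareBlock_def, Matrix.of_apply]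
      exact h0 p q hpq (OrderDual.toDual.injective (hp.trans hq.symm)).le
  rw [this, Matrix.det_one]

/-- Elimination of generators. The rows outside the range of `ι` express the generator `p` through the
generator `pred p`; as `depth` decreases, this ends at the generators in the range of `ι`. The row `X p`
is the resulting expression of the generator `p`, and the determinant is that of the
remaining relations after substitution. -/
theorem det_eliminate {A : Type*} [Fintype A] [DecidableEq A] (ι : A → P)
    (hι : Function.Injective ι) (M : P → P → K) (pred : P → P) (w : P → K) (depth : P → ℕ)
    (X : P → A → K)
    (hM : ∀ p, p ∉ Set.range ι → M p = Pi.single p 1 - w p • Pi.single (pred p) 1)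
    (hd : ∀ p, p ∉ Set.range ι → depth (pred p) < depth p)
    (hX : ∀ p, p ∉ Set.range ι → X p = w p • X (pred p))
    (hXι : ∀ a, X (ι a) = Pi.single a 1) :
    (Matrix.of M).det = (Matrix.of fun a a' => ∑ q, M (ι a) q * X q a').det := by
  classical
  let e : A ⊕ {p // p ∉ Set.range ι} ≃ P :=
    ((Equiv.ofInjective ι hι).sumCongr (Equiv.refl _)).trans (Equiv.sumCompl (· ∈ Set.range ι))
  have el : ∀ a, e (Sum.inl a) = ι a := fun a => rfl
  have er : ∀ b, e (Sum.inr b) = b.1 := fun b => rfl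
  rw [← Matrix.det_submatrix_equiv_self e]
  set N := (Matrix.of M).submatrix e e with hN
  -- the substitution of `X`, in the form of a unitriangular matrix
  let Y : Matrix (A ⊕ {p // p ∉ Set.range ι}) (A ⊕ {p // p ∉ Set.range ι}) K :=
    Matrix.fromBlocks 1 0 (Matrix.of fun b a => X b.1 a) 1
  have hY : Y.det = 1 := by simp [Y]
  have hsum : ∀ p a, ∑ q, M p q * X q a = ∑ a', M p (ι a') * X (ι a') a +
      ∑ b : {p // p ∉ Set.range ι}, M p b.1 * X b.1 a := by
    intro p a
    rw [← e.sum_comp, Fintype.sum_sum_type]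
    simp only [el, er]
  have hNY : N * Y = Matrix.fromBlocks (Matrix.of fun a a' => ∑ q, M (ι a) q * X q a')
      N.toBlocks₁₂ 0 N.toBlocks₂₂ := by
    conv_lhs => rw [← Matrix.fromBlocks_toBlocks N]
    rw [Matrix.fromBlocks_multiply]
    congr 1
    · ext a a'
      simp only [Matrix.mul_one, Matrix.add_apply, Matrix.mul_apply, Matrix.toBlocks₁₁,
        Matrix.toBlocks₁₂, Matrix.of_apply, hsum, hN, Matrix.submatrix_apply, el, er, hXι]
      congr 1
      simp [Pi.single_apply]
    · simp
    · ext b a'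
      have h := hsum b.1 a'
      have hz : ∑ q, M b.1 q * X q a' = 0 := by
        rw [hM b.1 b.2]
        simp only [Pi.sub_apply, Pi.smul_apply, smul_eq_mul, sub_mul, Finset.sum_sub_distrib,
          Pi.single_apply, mul_ite, mul_one, mul_zero, ite_mul, one_mul, zero_mul,
          Finset.sum_ite_eq', Finset.mem_univ, if_true]
        rw [hX b.1 b.2]
        simp
      rw [hz] at h
      simp only [Matrix.mul_one, Matrix.add_apply, Matrix.mul_apply, Matrix.toBlocks₂₁,
        Matrix.toBlocks₂₂, Matrix.of_apply, hN, Matrix.submatrix_apply, el, er,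
        Matrix.zero_apply]
      rw [h]
      congr 1
      simp [hXι, Pi.single_apply]
    · simp
  have hB : N.toBlocks₂₂.det = 1 := by
    apply det_eq_one_of_depth _ (fun b => depth b.1)
    · rintro ⟨p, hp⟩
      have h : p ≠ pred p := fun h => (hd p hp).ne (by rw [← h])
      simp [Matrix.toBlocks₂₂, hN, er, hM p hp, h]
    · rintro ⟨p, hp⟩ ⟨q, hq⟩ hpq hle
      have h1 : q ≠ p := fun h => hpq (by simp [h])
      have h2 : q ≠ pred p := fun h => absurd (hd p hp) (by rw [← h]; exact not_lt.mpr hle)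
      simp [Matrix.toBlocks₂₂, hN, er, hM p hp, h1, h2]
  rw [← mul_one N.det, ← hY, ← Matrix.det_mul, hNY, Matrix.det_fromBlocks_zero₂₁, hB, mul_one]

end Determinants

/-! ### Top coefficients of Laurent polynomials -/

section TopCoefficient

variable {R : Type*} [CommRing R]

/-- The Laurent polynomial `f` has no terms of degree larger than `d`, and `r` is its (possibly
vanishing) coefficient in degree `d`. -/
def HasTop (f : R[T;T⁻¹]) (d : ℤ) (r : R) : Prop :=
  f.coeff d = r ∧ ∀ k, d < k → f.coeff k = 0

namespace HasTop

theorem zero (d : ℤ) : HasTop (0 : R[T;T⁻¹]) d 0 := ⟨by simp, by simp⟩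

theorem _root_.LaurentPolynomial.coeff_C_mul_T (r : R) (m k : ℤ) :
    (LaurentPolynomial.C r * LaurentPolynomial.T m).coeff k = if m = k then r else 0 := by
  rw [← LaurentPolynomial.single_eq_C_mul_T, AddMonoidAlgebra.coeff_single, Finsupp.single_apply]

theorem C_mul_T (r : R) {m d : ℤ} (h : m ≤ d) :
    HasTop (LaurentPolynomial.C r * LaurentPolynomial.T m) d (if m = d then r else 0) :=
  ⟨LaurentPolynomial.coeff_C_mul_T r m d, fun k hk => by
    rw [LaurentPolynomial.coeff_C_mul_T, if_neg (h.trans_lt hk).ne]⟩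

theorem add {f g : R[T;T⁻¹]} {d : ℤ} {a b : R} (hf : HasTop f d a) (hg : HasTop g d b) :
    HasTop (f + g) d (a + b) :=
  ⟨by simp [hf.1, hg.1], fun k hk => by simp [hf.2 k hk, hg.2 k hk]⟩

theorem neg {f : R[T;T⁻¹]} {d : ℤ} {a : R} (hf : HasTop f d a) : HasTop (-f) d (-a) :=
  ⟨by simp [hf.1], fun k hk => by simp [hf.2 k hk]⟩

theorem sub {f g : R[T;T⁻¹]} {d : ℤ} {a b : R} (hf : HasTop f d a) (hg : HasTop g d b) :
    HasTop (f - g) d (a - b) :=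
  ⟨by simp [hf.1, hg.1], fun k hk => by simp [hf.2 k hk, hg.2 k hk]⟩

theorem mul {f g : R[T;T⁻¹]} {d e : ℤ} {a b : R} (hf : HasTop f d a) (hg : HasTop g e b) :
    HasTop (f * g) (d + e) (a * b) := by
  classical
  constructor
  · rw [AddMonoidAlgebra.coeff_mul_apply_left, Finsupp.sum, Finset.sum_eq_single d]
    · rw [hf.1, neg_add_cancel_left, hg.1]
    · intro c _ hc
      rcases lt_or_gt_of_ne hc with h | h
      · rw [hg.2 _ (by omega), mul_zero]
      · rw [hf.2 _ h, zero_mul]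
    · intro h
      rw [Finsupp.notMem_support_iff.mp h, zero_mul]
  · intro k hk
    rw [AddMonoidAlgebra.coeff_mul_apply_left, Finsupp.sum]
    refine Finset.sum_eq_zero fun c _ => ?_
    rcases le_or_gt c d with h | h
    · rw [hg.2 _ (by omega), mul_zero]
    · rw [hf.2 _ h, zero_mul]

theorem sum {ι : Type*} (S : Finset ι) {f : ι → R[T;T⁻¹]} {d : ℤ} {a : ι → R}
    (h : ∀ i ∈ S, HasTop (f i) d (a i)) : HasTop (∑ i ∈ S, f i) d (∑ i ∈ S, a i) := by
  classical
  induction S using Finset.induction_on with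
  | empty => simpa using zero d
  | insert i S hi ih =>
    rw [Finset.sum_insert hi, Finset.sum_insert hi]
    exact (h i (by simp)).add (ih fun j hj => h j (by simp [hj]))

theorem prod {ι : Type*} (S : Finset ι) {f : ι → R[T;T⁻¹]} {d : ι → ℤ} {a : ι → R}
    (h : ∀ i ∈ S, HasTop (f i) (d i) (a i)) :
    HasTop (∏ i ∈ S, f i) (∑ i ∈ S, d i) (∏ i ∈ S, a i) := by
  classical
  induction S using Finset.induction_on with
  | empty => simpa using C_mul_T (1 : R) (le_refl 0)
  | insert i S hi ih =>
    rw [Finset.prod_insert hi, Finset.prod_insert hi, Finset.sum_insert hi]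
    exact (h i (by simp)).mul (ih fun j hj => h j (by simp [hj]))

theorem det {n : Type*} [Fintype n] [DecidableEq n] {M : Matrix n n R[T;T⁻¹]} {d : n → ℤ}
    {A : Matrix n n R} (h : ∀ i j, HasTop (M i j) (d j) (A i j)) :
    HasTop M.det (∑ j, d j) A.det := by
  rw [Matrix.det_apply, Matrix.det_apply]
  refine sum _ fun σ _ => ?_
  have := prod Finset.univ (fun i _ => h (σ i) i)
  rcases Int.units_eq_one_or (Equiv.Perm.sign σ) with h | h
  · simpa [h] using this
  · simpa [h] using this.neg

end HasTop

end TopCoefficient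

namespace Diagram

/-! ### The determinant of the edge relations -/

section Zeta

variable {K : Type*} [CommRing K] (s t : Kˣ)

/-- The other passage through the same crossing. -/
def opp {C : Type*} (p : C × Bool) : C × Bool := (p.1, !p.2)

/-- `t` to the sign of the crossing at an underpass, and `1` at all other passages. -/
def underUnit (D : Diagram) (p : D.Passage) : Kˣ :=
  if D.IsUnder p then t ^ (D.kind p.1).sign else 1

/-- The relation at the passage `p` between the generators attached to the edges: the edge which
starts at `p` is `s ^ shift p` times the previous one, corrected at an underpass of a classical
crossing by the Alexander relation (the generator of the overpass is read after the crossing). -/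
def relation (D : Diagram) (p : D.Passage) : D.Passage → K :=
  Pi.single p 1 - ((s ^ D.shift p * D.underUnit t p : Kˣ) : K) • Pi.single (D.succ.symm p) 1 +
    ((D.underUnit t p : K) - 1) • Pi.single (opp p) 1

/-- The determinant of the system of all relations; a circle without crossings is a free generator,
which makes it vanish. -/
def zeta (D : Diagram) : K :=
  if D.circles = 0 then (Matrix.of (D.relation s t)).det else 0

theorem IsUnder.congr {D D' : Diagram} {p : D.Passage} {p' : D'.Passage}
    (hk : D.kind p.1 = D'.kind p'.1) (h2 : p.2 = p'.2) : D.IsUnder p ↔ D'.IsUnder p' := by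
  unfold IsUnder; rw [hk, h2]

theorem shift_congr {D D' : Diagram} {p : D.Passage} {p' : D'.Passage}
    (hk : D.kind p.1 = D'.kind p'.1) (h2 : p.2 = p'.2) : D.shift p = D'.shift p' := by
  unfold shift; rw [hk, h2]

theorem underUnit_congr {D D' : Diagram} {p : D.Passage} {p' : D'.Passage}
    (hk : D.kind p.1 = D'.kind p'.1) (h2 : p.2 = p'.2) :
    D.underUnit t p = D'.underUnit t p' := by
  unfold underUnit; rw [hk, if_congr (IsUnder.congr hk h2) rfl rfl]

theorem zeta_iso {D D' : Diagram} (h : Iso D D') : D'.zeta s t = D.zeta s t := by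
  obtain ⟨e, hk, hs, hc⟩ := h
  unfold zeta
  rw [hc]
  congr 1
  let φ : D.Passage ≃ D'.Passage := e.prodCongr (Equiv.refl _)
  have hφ : ∀ p, φ p = (e p.1, p.2) := fun p => rfl
  rw [← Matrix.det_submatrix_equiv_self φ]
  congr 1
  ext p q
  have hpred : D'.succ.symm (φ p) = φ (D.succ.symm p) := by
    rw [Equiv.symm_apply_eq, hφ (D.succ.symm p), hs, Equiv.apply_symm_apply]; rfl
  have hk' : D'.kind (φ p).1 = D.kind p.1 := hk p.1
  have hopp : opp (φ p) = φ (opp p) := rfl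
  simp only [Matrix.submatrix_apply, Matrix.of_apply, relation, hpred, hopp,
    shift_congr hk' (rfl : (φ p).2 = p.2), underUnit_congr t hk' (rfl : (φ p).2 = p.2),
    Pi.add_apply, Pi.sub_apply, Pi.smul_apply, Pi.single_apply, φ.injective.eq_iff]

/-- If all passages through the crossings in `S` are replaced by relations which identify the two
adjacent edges, then these crossings can be removed. -/
theorem det_removal {D D' : Diagram} {S : Set D.C} (h : IsRemoval D S D')
    (M : D.Passage → D.Passage → K)
    (hS : ∀ p : D.Passage, p.1 ∈ S → M p = Pi.single p 1 - Pi.single (D.succ.symm p) 1)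
    (hN : ∀ p : D.Passage, p.1 ∉ S → M p = D.relation s t p) :
    (if D.circles = 0 then (Matrix.of M).det else 0) = D'.zeta s t := by
  classical
  obtain ⟨e, hk, hs, hc⟩ := h
  by_cases hD : D.circles = 0
  swap
  · rw [if_neg hD, zeta, if_neg (by omega)]
  rw [if_pos hD]
  by_cases hdeg : ∃ q : Quotient (Equiv.Perm.SameCycle.setoid D.succ),
      ∀ p : D.Passage, Quotient.mk _ p = q → p.1 ∈ S
  · have hpos : 0 < Nat.card {q : Quotient (Equiv.Perm.SameCycle.setoid D.succ) //
        ∀ p : D.Passage, Quotient.mk _ p = q → p.1 ∈ S} := by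
      have : Nonempty {q : Quotient (Equiv.Perm.SameCycle.setoid D.succ) //
        ∀ p : D.Passage, Quotient.mk _ p = q → p.1 ∈ S} := ⟨⟨_, hdeg.choose_spec⟩⟩
      exact Nat.card_pos
    rw [zeta, if_neg (by omega)]
    obtain ⟨q, hq⟩ := hdeg
    obtain ⟨p0, rfl⟩ := Quotient.exists_rep q
    -- the relations along a closed component which only meets `S` add up to zero
    set c : Finset D.Passage := Finset.univ.filter fun p => D.succ.SameCycle p p0 with hcdef
    have hsum : ∑ p ∈ c, M p = 0 := by
      have h1 : ∑ p ∈ c, M p = ∑ p ∈ c, ((Pi.single p 1 : D.Passage → K) -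
          Pi.single (D.succ.symm p) 1) := by
        refine Finset.sum_congr rfl fun p hp => hS p (hq p ?_)
        exact Quotient.sound (Finset.mem_filter.mp hp).2
      rw [h1, Finset.sum_sub_distrib, sub_eq_zero]
      symm
      refine Finset.sum_equiv D.succ.symm (fun p => ?_) (fun p _ => rfl)
      simp only [hcdef, Finset.mem_filter, Finset.mem_univ, true_and]
      exact Equiv.Perm.sameCycle_symm_apply_left.symm
    have hp0 : p0 ∈ c := by simp [hcdef, Equiv.Perm.SameCycle.refl]
    have := det_of_sub_mem_span M M p0 0 (fun _ _ => rfl) (by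
      rw [zero_smul, sub_zero]
      rw [← Finset.add_sum_erase _ _ hp0] at hsum
      rw [eq_neg_of_add_eq_zero_left hsum]
      refine Submodule.neg_mem _ (Submodule.sum_mem _ fun p hp => Submodule.subset_span ?_)
      exact ⟨p, by simpa using (Finset.ne_of_mem_erase hp), rfl⟩)
    rw [this, zero_mul]
  · have hcirc : D'.circles = 0 := by
      rw [hc, hD, zero_add]
      have : IsEmpty {q : Quotient (Equiv.Perm.SameCycle.setoid D.succ) //
        ∀ p : D.Passage, Quotient.mk _ p = q → p.1 ∈ S} := ⟨fun q => hdeg ⟨q.1, q.2⟩⟩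
      exact Nat.card_of_isEmpty
    rw [zeta, if_pos hcirc]
    have hex : ∀ p : D.Passage, ∃ k : ℕ, ((D.succ⁻¹ ^ k) p).1 ∉ S := by
      intro p
      by_contra! hall
      refine hdeg ⟨Quotient.mk _ p, fun p' hp' => ?_⟩
      have hsc : D.succ.SameCycle p' p := Quotient.exact hp'
      obtain ⟨i, hi⟩ := hsc.exists_nat_pow_eq
      have := hall i
      rwa [← hi, inv_pow, ← Equiv.Perm.mul_apply, inv_mul_cancel, Equiv.Perm.one_apply] at this
    -- the number of steps back from `p` to a passage outside `S`
    let depth : D.Passage → ℕ := fun p => Nat.find (hex p)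
    let ι : D'.Passage → D.Passage := fun p => ((e p.1 : D.C), p.2)
    have hιk : ∀ a, D.kind (ι a).1 = D'.kind a.1 := fun a => (hk a.1).symm
    have hι : Function.Injective ι := by
      rintro ⟨a, b⟩ ⟨a', b'⟩ hab
      have h1 : (e a : D.C) = e a' := congrArg Prod.fst hab
      have h2 : b = b' := congrArg Prod.snd hab
      rw [e.injective (Subtype.ext h1), h2]
    have hιS : ∀ a, (ι a).1 ∉ S := fun a => (e a.1).2
    have hrange : ∀ p, p ∉ Set.range ι ↔ p.1 ∈ S := by
      intro p
      rw [← not_iff_not, not_not]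
      constructor
      · rintro ⟨a, rfl⟩; exact hιS a
      · intro hp
        exact ⟨(e.symm ⟨p.1, hp⟩, p.2), by simp [ι]⟩
    have hsrc : ∀ p, ∃ a, ι a = (D.succ⁻¹ ^ depth p) p := by
      intro p
      have := Nat.find_spec (hex p)
      by_contra hcon
      exact this ((hrange _).mp hcon)
    choose src hsrc using hsrc
    -- a passage is traced back to the last passage outside `S`
    have hdet : ∀ p k a, (∀ j < k, ((D.succ⁻¹ ^ j) p).1 ∈ S) → (D.succ⁻¹ ^ k) p = ι a →
        depth p = k ∧ src p = a := by
      intro p k a h1 h2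
      have hd : depth p = k := by
        apply (Nat.find_eq_iff (hex p)).mpr
        exact ⟨by rw [h2]; exact hιS a, fun j hj => not_not.mpr (h1 j hj)⟩
      exact ⟨hd, hι (by rw [hsrc, hd, h2])⟩
    have hstep : ∀ p, p.1 ∈ S → depth p = depth (D.succ.symm p) + 1 ∧
        src p = src (D.succ.symm p) := by
      intro p hp
      refine hdet p _ _ ?_ ?_
      · intro j hj
        rcases j with _ | j
        · simpa using hp
        · rw [pow_succ, Equiv.Perm.mul_apply]
          exact not_not.mp (Nat.find_min (hex (D.succ.symm p)) (Nat.lt_of_succ_lt_succ hj))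
      · rw [pow_succ, Equiv.Perm.mul_apply]
        exact (hsrc (D.succ.symm p)).symm
    have hpred : ∀ a, src (D.succ.symm (ι a)) = D'.succ.symm a := by
      intro a
      obtain ⟨k, hk1, hk2⟩ := hs (D'.succ.symm a)
      rw [Equiv.apply_symm_apply] at hk2
      have hback : ∀ j ≤ k, (D.succ⁻¹ ^ j) (D.succ.symm (ι a)) =
          (D.succ ^ (k - j)) (ι (D'.succ.symm a)) := by
        intro j hj
        have : D.succ.symm (ι a) = (D.succ ^ k) (ι (D'.succ.symm a)) := by
          rw [Equiv.symm_apply_eq, ← Equiv.Perm.mul_apply, ← pow_succ']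
          exact hk2.symm
        rw [this, ← Equiv.Perm.mul_apply]
        congr 1
        rw [inv_pow, inv_mul_eq_iff_eq_mul, ← pow_add]
        congr 1
        omega
      refine (hdet _ k _ ?_ ?_).2
      · intro j hj
        rw [hback j hj.le]
        exact hk1 _ (by omega) (by omega)
      · rw [hback k le_rfl]; simp
    have hsrcι : ∀ a, src (ι a) = a := fun a => (hdet (ι a) 0 a (by simp) (by simp)).2
    -- the generator of an edge of `D` is the one of the edge of `D'` on which it lies
    rw [det_eliminate ι hι M (fun p => D.succ.symm p) (fun _ => 1) depth
      (fun p => Pi.single (src p) 1)]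
    · congr 1
      ext a a'
      simp only [Matrix.of_apply]
      rw [hN _ (hιS a)]
      have hopp : opp (ι a) = ι (opp a) := rfl
      simp only [relation, Pi.add_apply, Pi.sub_apply, Pi.smul_apply, smul_eq_mul, add_mul, sub_mul,
        Finset.sum_add_distrib, Finset.sum_sub_distrib, mul_assoc, ← Finset.mul_sum,
        shift_congr (hιk a) (rfl : (ι a).2 = a.2), underUnit_congr t (hιk a) (rfl : (ι a).2 = a.2)]
      have hsg : ∀ p : D.Passage, ∑ q, (Pi.single p (1 : K) : D.Passage → K) q *
          (Pi.single (src q) (1 : K) : D'.Passage → K) a' =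
          (Pi.single (src p) (1 : K) : D'.Passage → K) a' := by
        intro p
        simp [Pi.single_apply p]
      rw [hsg, hsg, hsg, hopp, hsrcι, hsrcι, hpred]
    · intro p hp; rw [one_smul]; exact hS p ((hrange p).mp hp)
    · intro p hp; rw [(hstep p ((hrange p).mp hp)).1]; exact Nat.lt_succ_self _
    · intro p hp; rw [one_smul, (hstep p ((hrange p).mp hp)).2]
    · intro a; rw [hsrcι]

end Zeta

end Diagram

/-! ### Invariance under the first and the second move -/

/-- Two consecutive passages `p₁`, `p₂` of a strand, such that the edge `p₁` between them occurs in no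
other relation, and such that the two relations amount to the equality of the edge `p₂` behind and
the edge `x` before the passages, modulo the other relations. Then they can be replaced by relations
which identify these three edges. -/
theorem det_strand {K : Type*} [CommRing K] {P : Type*} [Fintype P] [DecidableEq P]
    (f g : P → P → K) {p₁ p₂ : P} (hne : p₁ ≠ p₂) (x : P → K) (hx : x p₁ = 0) (h1 : f p₁ p₁ = 1)
    (hcol : ∀ p, p ≠ p₁ → p ≠ p₂ → f p p₁ = 0) (a : K)
    (hv : Pi.single p₂ 1 - x - f p₂ - a • f p₁ ∈ Submodule.span K (f '' {p₁, p₂}ᶜ))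
    (hg : ∀ p, p ≠ p₁ → p ≠ p₂ → g p = f p) (hg1 : g p₁ = Pi.single p₁ 1 - x)
    (hg2 : g p₂ = Pi.single p₂ 1 - Pi.single p₁ 1) :
    (Matrix.of f).det = (Matrix.of g).det := by
  set f₁ : P → P → K := Function.update f p₂ (Pi.single p₂ 1 - x) with hf₁
  set f₂ : P → P → K := Function.update f₁ p₁ (Pi.single p₁ 1 - x) with hf₂
  have e1 : (Matrix.of f₁).det = 1 * (Matrix.of f).det := by
    refine det_of_sub_mem_span f₁ f p₂ 1 (fun p hp => Function.update_of_ne hp _ _) ?_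
    rw [hf₁, Function.update_self, one_smul]
    rw [← sub_add_cancel (Pi.single p₂ 1 - x - f p₂) (a • f p₁)]
    refine Submodule.add_mem _ (Submodule.span_mono (Set.image_mono ?_) hv)
      (Submodule.smul_mem _ _ (Submodule.subset_span ⟨p₁, hne, rfl⟩))
    intro p hp; simp only [Set.mem_compl_iff, Set.mem_insert_iff, not_or] at hp; exact hp.2
  have e2 : (Matrix.of f₁).det = (Matrix.of f₂).det := by
    refine det_of_free_row f₁ f₂ p₁ p₁ (fun p hp => (Function.update_of_ne hp _ _).symm) ?_ ?_
    · intro p hp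
      by_cases h : p = p₂
      · subst h; simp [hf₁, hx, hne]
      · rw [hf₁, Function.update_of_ne h, hcol p hp h]
    · rw [hf₁, Function.update_of_ne hne, h1, hf₂, Function.update_self]; simp [hx]
  have e3 : (Matrix.of g).det = 1 * (Matrix.of f₂).det := by
    refine det_of_sub_mem_span g f₂ p₂ 1 ?_ ?_
    · intro p hp
      by_cases h : p = p₁
      · subst h; rw [hg1, hf₂, Function.update_self]
      · rw [hg p h hp, hf₂, Function.update_of_ne h, hf₁, Function.update_of_ne hp]
    · have : g p₂ - (1 : K) • f₂ p₂ = - f₂ p₁ := by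
        rw [hg2, hf₂, Function.update_self, Function.update_of_ne hne.symm, hf₁,
          Function.update_self, one_smul]
        abel
      rw [this]
      exact Submodule.neg_mem _ (Submodule.subset_span ⟨p₁, hne, rfl⟩)
  rw [e3, ← e2, e1, one_mul, one_mul]

namespace Diagram

section FirstAndSecondMove

variable {K : Type*} [CommRing K] (s t : Kˣ) (D : Diagram)

@[simp] theorem opp_opp {C : Type*} (p : C × Bool) : opp (opp p) = p := by simp [opp]

theorem opp_ne {C : Type*} (p : C × Bool) : opp p ≠ p := by
  intro h; have := congrArg Prod.snd h; simp [opp] at this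

theorem opp_eq_iff {C : Type*} {p q : C × Bool} : opp p = q ↔ p = opp q :=
  ⟨fun h => by rw [← h, opp_opp], fun h => by rw [h, opp_opp]⟩

variable {D}

theorem kind_ne_virtual_of_isUnder {p : D.Passage} (h : D.IsUnder p) :
    D.kind p.1 ≠ CrossingKind.virtual := by
  rcases h with h | h <;> simp [h.1]

theorem isUnder_opp {p : D.Passage} (hp : D.kind p.1 ≠ CrossingKind.virtual) :
    D.IsUnder (opp p) ↔ ¬ D.IsUnder p := by
  obtain ⟨c, b⟩ := p
  simp only at hp
  unfold IsUnder opp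
  cases hk : D.kind c <;> cases b <;> simp_all

theorem relation_of_virtual {p : D.Passage} (hp : D.kind p.1 = CrossingKind.virtual) :
    D.relation s t p = Pi.single p 1 -
      ((s ^ D.shift p : Kˣ) : K) • Pi.single (D.succ.symm p) 1 := by
  have hu : ¬ D.IsUnder p := fun h => kind_ne_virtual_of_isUnder h hp
  simp [relation, underUnit, hu]

theorem relation_of_over {p : D.Passage} (hp : D.kind p.1 ≠ CrossingKind.virtual)
    (hu : ¬ D.IsUnder p) :
    D.relation s t p = Pi.single p 1 - Pi.single (D.succ.symm p) 1 := by
  simp [relation, underUnit, hu, shift, hp]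

theorem relation_of_under {p : D.Passage} (hu : D.IsUnder p) :
    D.relation s t p = Pi.single p 1 -
      ((t ^ (D.kind p.1).sign : Kˣ) : K) • Pi.single (D.succ.symm p) 1 +
      (((t ^ (D.kind p.1).sign : Kˣ) : K) - 1) • Pi.single (opp p) 1 := by
  simp [relation, underUnit, hu, shift, kind_ne_virtual_of_isUnder hu]

theorem relation_apply_eq_zero {p q : D.Passage} (h1 : q ≠ p) (h2 : D.succ.symm p ≠ q)
    (h3 : opp p ≠ q ∨ ¬ D.IsUnder p) : D.relation s t p q = 0 := by
  have h2' := h2.symm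
  rcases h3 with h3 | h3
  · simp [relation, h1, h2', h3.symm]
  · simp [relation, underUnit, h1, h2', h3]

theorem relation_apply_self {p : D.Passage} (h : D.succ.symm p ≠ p) : D.relation s t p p = 1 := by
  have h2' := h.symm
  simp [relation, h2', (opp_ne p).symm]

variable (D)

/-- The relations of `D`, in which the passages in `U` are replaced by relations which identify the
two adjacent edges. -/
def mixed (U : Set D.Passage) [DecidablePred (· ∈ U)] (p : D.Passage) : D.Passage → K :=
  if p ∈ U then Pi.single p 1 - Pi.single (D.succ.symm p) 1 else D.relation s t p

variable {D}

/-- The strand which runs through `p₁` and `p₂` may be replaced by an uninterrupted strand. -/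
theorem det_mixed_strand (U V : Set D.Passage) [DecidablePred (· ∈ U)] [DecidablePred (· ∈ V)]
    {p₁ p₂ : D.Passage} (hUV : ∀ p, p ∈ V ↔ p ∈ U ∨ p = p₁ ∨ p = p₂)
    (h1 : p₁ ∉ U) (h2 : p₂ ∉ U) (hne : p₁ ≠ p₂) (hs : D.succ p₁ = p₂)
    (ho : opp p₁ = p₂ ∨ ¬ D.IsUnder (opp p₁)) (a : K)
    (hv : Pi.single p₂ 1 - Pi.single (D.succ.symm p₁) 1 - D.relation s t p₂ -
      a • D.relation s t p₁ ∈ Submodule.span K (D.mixed s t U '' {p₁, p₂}ᶜ)) :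
    (Matrix.of (D.mixed s t U)).det = (Matrix.of (D.mixed s t V)).det := by
  have hpred : D.succ.symm p₁ ≠ p₁ := by
    rw [Ne, Equiv.symm_apply_eq, hs]; exact hne
  have hp2 : D.succ.symm p₂ = p₁ := by rw [Equiv.symm_apply_eq, hs]
  refine det_strand _ _ hne (Pi.single (D.succ.symm p₁) 1) ?_ ?_ ?_ a ?_ ?_ ?_ ?_
  · simp [hpred.symm]
  · rw [mixed, if_neg h1, relation_apply_self s t hpred]
  · intro p hp1 hp2'
    have hpp : D.succ.symm p ≠ p₁ := by
      rw [Ne, Equiv.symm_apply_eq, hs]; exact hp2'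
    unfold mixed
    split_ifs with h
    · simp [hp1.symm, hpp.symm]
    · refine relation_apply_eq_zero s t hp1.symm hpp ?_
      by_cases h' : opp p = p₁
      · right
        rw [opp_eq_iff] at h'
        rcases ho with ho | ho
        · exact absurd (h'.trans ho) hp2'
        · rw [h']; exact ho
      · exact Or.inl h'
  · simpa only [mixed, if_neg h1, if_neg h2] using hv
  · intro p hp1 hp2'
    unfold mixed
    rw [if_congr (show p ∈ V ↔ p ∈ U by simp [hUV, hp1, hp2']) rfl rfl]
  · rw [mixed, if_pos ((hUV _).mpr (by simp))]
  · rw [mixed, if_pos ((hUV _).mpr (by simp)), hp2]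

theorem shift_opp (p : D.Passage) : D.shift (opp p) = - D.shift p := by
  obtain ⟨c, b⟩ := p
  unfold shift opp
  cases b <;> by_cases h : D.kind c = .virtual <;> simp [h]

theorem mixed_empty : D.mixed s t ∅ = D.relation s t := by
  funext p; simp [mixed]

/-- A curl gives a factor `t ^ sign` if its first passage is the underpass, and no factor otherwise. -/
theorem zeta_curl {D D' : Diagram} {c : D.C} (hc : D.IsCurl c) (h : IsRemoval D {c} D') :
    ∃ k : ℤ, D.zeta s t = ((t ^ k : Kˣ) : K) * D'.zeta s t := by
  classical
  obtain ⟨b, hb⟩ := hc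
  set p₁ : D.Passage := (c, b) with hp₁
  have hopp : (c, !b) = opp p₁ := rfl
  rw [hopp] at hb
  have hpred2 : D.succ.symm (opp p₁) = p₁ := by rw [Equiv.symm_apply_eq, hb]
  have hmem : ∀ p : D.Passage, p.1 ∈ ({c} : Set D.C) ↔ p = p₁ ∨ p = opp p₁ := by
    rintro ⟨x, y⟩
    simp only [Set.mem_singleton_iff, hp₁, opp, Prod.mk.injEq]
    cases y <;> cases b <;> simp
  by_cases hv : D.kind c = .virtual
  · refine ⟨0, ?_⟩
    have key := det_mixed_strand s t (∅ : Set D.Passage) {p₁, opp p₁} (p₁ := p₁) (p₂ := opp p₁)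
      (by simp) (by simp) (by simp) (opp_ne p₁).symm hb (Or.inl rfl)
      ((s ^ (- D.shift p₁) : Kˣ) : K) (by
        convert Submodule.zero_mem _ using 1
        rw [relation_of_virtual s t (p := opp p₁) hv, relation_of_virtual s t (p := p₁) hv, hpred2,
          shift_opp, smul_sub, smul_smul, ← Units.val_mul, ← zpow_add]
        simp)
    rw [← det_removal s t h (D.mixed s t {p₁, opp p₁})
      (fun p hp => by rw [mixed, if_pos (by simpa using (hmem p).mp hp)])
      (fun p hp => by rw [mixed, if_neg (by simpa using (hmem p).not.mp hp)]),
      ← key, mixed_empty]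
    simp [zeta]
  by_cases hu : D.IsUnder p₁
  · refine ⟨(D.kind c).sign, ?_⟩
    have hu2 : ¬ D.IsUnder (opp p₁) := by rw [isUnder_opp hv]; simpa using hu
    have key : (Matrix.of (D.relation s t)).det = ((t ^ (D.kind c).sign : Kˣ) : K) *
        (Matrix.of (D.mixed s t {p₁})).det := by
      refine det_of_sub_mem_span _ _ p₁ _ (fun p hp => by simp [mixed, hp]) ?_
      have : D.relation s t p₁ - ((t ^ (D.kind c).sign : Kˣ) : K) • D.mixed s t {p₁} p₁ =
          (((t ^ (D.kind c).sign : Kˣ) : K) - 1) • D.mixed s t {p₁} (opp p₁) := by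
        rw [mixed, if_pos (by simp), mixed, if_neg (by simp [opp_ne]), relation_of_under s t hu,
          relation_of_over s t (p := opp p₁) hv hu2, hpred2]
        simp only [hp₁]
        module
      rw [this]
      exact Submodule.smul_mem _ _ (Submodule.subset_span ⟨_, by simp [opp_ne], rfl⟩)
    rw [← det_removal s t h (D.mixed s t {p₁}) ?_
      (fun p hp => by
        rw [mixed, if_neg]; intro h'; exact hp ((hmem p).mpr (Or.inl h'))), zeta, key]
    · simp
    · intro p hp
      rcases (hmem p).mp hp with rfl | rfl
      · rw [mixed, if_pos (by simp)]
      · rw [mixed, if_neg (by simp [opp_ne]), relation_of_over s t (p := opp p₁) hv hu2]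
  · refine ⟨0, ?_⟩
    have hu2 : D.IsUnder (opp p₁) := (isUnder_opp hv).mpr hu
    rw [← det_removal s t h (D.relation s t) ?_ (fun p hp => rfl)]
    · simp [zeta]
    · intro p hp
      rcases (hmem p).mp hp with rfl | rfl
      · rw [relation_of_over s t hv hu]
      · rw [relation_of_under s t hu2, hpred2, opp_opp]; module

/-- In a classical bigon with underpasses `u₁`, `u₂` and overpasses `o₁`, `o₂`, the two relations at
the underpasses combine to the equality of the adjacent edges up to a multiple of the difference of
the generators at the overpasses, which vanishes by the relation at `o₂`. -/
theorem zeta_bigon_classical {D D' : Diagram} {S : Set D.C} (h : IsRemoval D S D')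
    {u₁ u₂ o₁ o₂ : D.Passage} (hmem : ∀ p : D.Passage, p.1 ∈ S → p = u₁ ∨ p = u₂ ∨ p = o₁ ∨ p = o₂)
    (hu₁S : u₁.1 ∈ S) (hu₂S : u₂.1 ∈ S)
    (hne : u₁.1 ≠ u₂.1) (hk : D.kind u₂.1 = (D.kind u₁.1).opposite)
    (hu₁ : D.IsUnder u₁) (hu₂ : D.IsUnder u₂) (hsu : D.succ u₁ = u₂) (hso : D.succ o₁ = o₂)
    (ho : opp u₁ = o₁ ∧ opp u₂ = o₂ ∨ opp u₁ = o₂ ∧ opp u₂ = o₁) :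
    D.zeta s t = D'.zeta s t := by
  classical
  have hv₁ := kind_ne_virtual_of_isUnder hu₁
  have hv₂ := kind_ne_virtual_of_isUnder hu₂
  have ho₁ : ¬ D.IsUnder (opp u₁) := by rw [isUnder_opp hv₁]; simpa using hu₁
  have ho₂ : ¬ D.IsUnder (opp u₂) := by rw [isUnder_opp hv₂]; simpa using hu₂
  have hro₁ : D.relation s t (opp u₁) = Pi.single (opp u₁) 1 - Pi.single (D.succ.symm (opp u₁)) 1 :=
    relation_of_over s t (p := opp u₁) hv₁ ho₁
  have hro₂ : D.relation s t (opp u₂) = Pi.single (opp u₂) 1 - Pi.single (D.succ.symm (opp u₂)) 1 :=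
    relation_of_over s t (p := opp u₂) hv₂ ho₂
  have hne' : u₁ ≠ u₂ := fun h => hne (by rw [h])
  have hp2 : D.succ.symm u₂ = u₁ := by rw [Equiv.symm_apply_eq, hsu]
  have hpo : D.succ.symm o₂ = o₁ := by rw [Equiv.symm_apply_eq, hso]
  have hsg : (D.kind u₂.1).sign = - (D.kind u₁.1).sign := by
    rw [hk]; cases D.kind u₁.1 <;> rfl
  have hoo₁ : opp u₁ ∈ ({u₁, u₂}ᶜ : Set D.Passage) := by
    simp only [Set.mem_compl_iff, Set.mem_insert_iff, Set.mem_singleton_iff, not_or]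
    exact ⟨opp_ne _, fun h => hne (show (opp u₁).1 = u₂.1 by rw [h])⟩
  have hoo₂ : opp u₂ ∈ ({u₁, u₂}ᶜ : Set D.Passage) := by
    simp only [Set.mem_compl_iff, Set.mem_insert_iff, Set.mem_singleton_iff, not_or]
    exact ⟨fun h => hne (show u₁.1 = (opp u₂).1 by rw [h]), opp_ne _⟩
  have hcancel : ((t ^ (-(D.kind u₁.1).sign) : Kˣ) : K) * ((t ^ (D.kind u₁.1).sign : Kˣ) : K) = 1 := by
    rw [← Units.val_mul, ← zpow_add]; simp
  have key := det_mixed_strand s t (∅ : Set D.Passage) {u₁, u₂} (p₁ := u₁) (p₂ := u₂)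
      (by simp) (by simp) (by simp) hne' hsu (Or.inr ho₁)
      ((t ^ (- (D.kind u₁.1).sign) : Kˣ) : K) (by
        have e : Pi.single u₂ 1 - Pi.single (D.succ.symm u₁) 1 - D.relation s t u₂ -
            ((t ^ (- (D.kind u₁.1).sign) : Kˣ) : K) • D.relation s t u₁ =
            (1 - ((t ^ (- (D.kind u₁.1).sign) : Kˣ) : K)) •
              (Pi.single (opp u₂) 1 - Pi.single (opp u₁) 1) := by
          rw [relation_of_under s t hu₁, relation_of_under s t hu₂, hp2, hsg]
          rw [smul_add, smul_sub, smul_smul, smul_smul, mul_sub, hcancel]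
          module
        rw [e]
        refine Submodule.smul_mem _ _ ?_
        rw [mixed_empty]
        rcases ho with ⟨h1, h2⟩ | ⟨h1, h2⟩
        · refine Submodule.subset_span ⟨opp u₂, hoo₂, ?_⟩
          rw [hro₂, h2, h1, hpo]
        · rw [← neg_sub]
          refine Submodule.neg_mem _ (Submodule.subset_span ⟨opp u₁, hoo₁, ?_⟩)
          rw [hro₁, h2, h1, hpo])
  rw [← det_removal s t h (D.mixed s t {u₁, u₂}) ?_ ?_, ← key, mixed_empty]
  · rfl
  · intro p hp
    by_cases hpu : p = u₁ ∨ p = u₂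
    · rw [mixed, if_pos (by simpa using hpu)]
    · rw [mixed, if_neg (by simpa using hpu)]
      have : p = opp u₁ ∨ p = opp u₂ := by
        rcases hmem p hp with h | h | h | h
        · exact absurd (Or.inl h) hpu
        · exact absurd (Or.inr h) hpu
        · rcases ho with ⟨h1, h2⟩ | ⟨h1, h2⟩
          · left; rw [h, h1]
          · right; rw [h, h2]
        · rcases ho with ⟨h1, h2⟩ | ⟨h1, h2⟩
          · right; rw [h, h2]
          · left; rw [h, h1]
      rcases this with rfl | rfl
      · exact hro₁
      · exact hro₂
  · intro p hp
    rw [mixed, if_neg]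
    rintro (rfl | rfl)
    · exact hp hu₁S
    · exact hp hu₂S

/-- In a virtual bigon each strand changes the exponent of `s` by opposite amounts at the two
crossings. -/
theorem zeta_bigon_virtual {D D' : Diagram} {S : Set D.C} (h : IsRemoval D S D')
    {u₁ u₂ o₁ o₂ : D.Passage} (hmem : ∀ p : D.Passage, p.1 ∈ S ↔ p ∈ ({u₁, u₂, o₁, o₂} : Set D.Passage))
    (hu : u₁.1 ≠ u₂.1) (hou : ∀ p ∈ ({o₁, o₂} : Set D.Passage), p ∉ ({u₁, u₂} : Set D.Passage))
    (ho : o₁.1 ≠ o₂.1) (hk : ∀ p : D.Passage, p.1 ∈ S → D.kind p.1 = .virtual)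
    (hsu : D.succ u₁ = u₂) (hso : D.succ o₁ = o₂)
    (hbu : u₂.2 = !u₁.2) (hbo : o₂.2 = !o₁.2) :
    D.zeta s t = D'.zeta s t := by
  classical
  have hv : ∀ p ∈ ({u₁, u₂, o₁, o₂} : Set D.Passage), D.kind p.1 = .virtual :=
    fun p hp => hk p ((hmem p).mpr hp)
  have hunder : ∀ p ∈ ({u₁, u₂, o₁, o₂} : Set D.Passage), ¬ D.IsUnder (opp p) := fun p hp hh =>
    kind_ne_virtual_of_isUnder hh (hv p hp)
  have hrel : ∀ {a b : D.Passage}, a ∈ ({u₁, u₂, o₁, o₂} : Set D.Passage) →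
      b ∈ ({u₁, u₂, o₁, o₂} : Set D.Passage) → D.succ a = b → b.2 = (!a.2) →
      Pi.single b 1 - Pi.single (D.succ.symm a) 1 - D.relation s t b -
      ((s ^ (- D.shift a) : Kˣ) : K) • D.relation s t a = 0 := by
    intro a b ha hb hab h2
    have hp : D.succ.symm b = a := by rw [Equiv.symm_apply_eq, hab]
    have hsh : D.shift b = - D.shift a := by
      rw [← shift_opp]; exact shift_congr (by rw [hv b hb]; exact (hv a ha).symm) h2
    rw [relation_of_virtual s t (hv a ha), relation_of_virtual s t (hv b hb), hp,
          hsh, smul_sub, smul_smul, ← Units.val_mul, ← zpow_add]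
    simp
  have key₁ := det_mixed_strand s t (∅ : Set D.Passage) {u₁, u₂} (p₁ := u₁) (p₂ := u₂)
      (by simp) (by simp) (by simp) (fun h => hu (by rw [h])) hsu (Or.inr (hunder _ (by simp)))
      ((s ^ (- D.shift u₁) : Kˣ) : K) (by
        rw [hrel (by simp) (by simp) hsu hbu]; exact Submodule.zero_mem _)
  have key₂ := det_mixed_strand s t ({u₁, u₂} : Set D.Passage) {u₁, u₂, o₁, o₂} (p₁ := o₁) (p₂ := o₂)
      (by intro p; simp only [Set.mem_insert_iff, Set.mem_singleton_iff]; tauto)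
      (hou _ (by simp)) (hou _ (by simp)) (fun h => ho (by rw [h])) hso
      (Or.inr (hunder _ (by simp)))
      ((s ^ (- D.shift o₁) : Kˣ) : K) (by
        rw [hrel (by simp) (by simp) hso hbo]; exact Submodule.zero_mem _)
  rw [← det_removal s t h (D.mixed s t {u₁, u₂, o₁, o₂}) (fun p hp => by
      rw [mixed, if_pos ((hmem p).mp hp)]) (fun p hp => by
      rw [mixed, if_neg ((hmem p).not.mp hp)]), ← key₂, ← key₁, mixed_empty]
  rfl

theorem zeta_bigon {D D' : Diagram} {c d : D.C} (hcd : D.IsBigon c d)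
    (h : IsRemoval D {c, d} D') : D.zeta s t = D'.zeta s t := by
  classical
  obtain ⟨hne, hk, b, h1, h2⟩ := hcd
  have hne' := hne.symm
  by_cases hv : D.kind c = .virtual
  · have hvd : D.kind d = .virtual := by rw [hk, hv]; rfl
    have hkk : ∀ p : D.Passage, p.1 ∈ ({c, d} : Set D.C) → D.kind p.1 = .virtual := by
      rintro ⟨x, y⟩ (hx | hx)
      · rw [show x = c from hx, hv]
      · rw [show x = d from hx, hvd]
    rcases h2 with h2 | h2
    · refine zeta_bigon_virtual s t h (u₁ := (c, b)) (u₂ := (d, !b)) (o₁ := (c, !b)) (o₂ := (d, b))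
        ?_ hne ?_ hne hkk h1 h2 rfl (by simp)
      · rintro ⟨x, y⟩
        simp only [Set.mem_insert_iff, Set.mem_singleton_iff, Prod.mk.injEq]
        cases y <;> cases b <;> simp <;> tauto
      · rintro p (rfl | rfl) <;> simp [hne, hne']
    · refine zeta_bigon_virtual s t h (u₁ := (c, b)) (u₂ := (d, !b)) (o₁ := (d, b)) (o₂ := (c, !b))
        ?_ hne ?_ hne' hkk h1 h2 rfl (by simp)
      · rintro ⟨x, y⟩
        simp only [Set.mem_insert_iff, Set.mem_singleton_iff, Prod.mk.injEq]
        cases y <;> cases b <;> simp <;> tauto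
      · rintro p (rfl | rfl) <;> simp [hne, hne']
  · have hvd : D.kind d ≠ .virtual := by
      rw [hk]; revert hv; cases D.kind c <;> simp [CrossingKind.opposite]
    have hkk : D.kind c = (D.kind d).opposite := by rw [hk]; cases D.kind c <;> rfl
    have hdu : D.IsUnder (d, !b) ↔ D.IsUnder (c, b) := by
      unfold IsUnder; rw [hk]
      cases hkc : D.kind c <;> cases b <;> simp [CrossingKind.opposite]
    have hdu' : D.IsUnder (d, b) ↔ D.IsUnder (c, !b) := by
      unfold IsUnder; rw [hk]
      cases hkc : D.kind c <;> cases b <;> simp [CrossingKind.opposite]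
    by_cases hu : D.IsUnder (c, b)
    · rcases h2 with h2 | h2
      · refine zeta_bigon_classical s t h (u₁ := (c, b)) (u₂ := (d, !b)) (o₁ := (c, !b))
          (o₂ := (d, b)) ?_ (by simp) (by simp) hne hk hu (hdu.mpr hu) h1 h2 ?_
        · rintro ⟨x, y⟩
          simp only [Set.mem_insert_iff, Set.mem_singleton_iff, Prod.mk.injEq]
          cases y <;> cases b <;> simp <;> tauto
        · left; simp [opp]
      · refine zeta_bigon_classical s t h (u₁ := (c, b)) (u₂ := (d, !b)) (o₁ := (d, b))
          (o₂ := (c, !b)) ?_ (by simp) (by simp) hne hk hu (hdu.mpr hu) h1 h2 ?_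
        · rintro ⟨x, y⟩
          simp only [Set.mem_insert_iff, Set.mem_singleton_iff, Prod.mk.injEq]
          cases y <;> cases b <;> simp <;> tauto
        · right; simp [opp]
    · have hu' : D.IsUnder (c, !b) := (isUnder_opp (p := (c, b)) hv).mpr hu
      rcases h2 with h2 | h2
      · refine zeta_bigon_classical s t h (o₁ := (c, b)) (o₂ := (d, !b)) (u₁ := (c, !b))
          (u₂ := (d, b)) ?_ (by simp) (by simp) hne hk hu' (hdu'.mpr hu') h2 h1 ?_
        · rintro ⟨x, y⟩
          simp only [Set.mem_insert_iff, Set.mem_singleton_iff, Prod.mk.injEq]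
          cases y <;> cases b <;> simp <;> tauto
        · left; simp [opp]
      · refine zeta_bigon_classical s t h (o₁ := (c, b)) (o₂ := (d, !b)) (u₁ := (d, b))
          (u₂ := (c, !b)) ?_ (by simp) (by simp) hne' hkk (hdu'.mpr hu') hu' h2 h1 ?_
        · rintro ⟨x, y⟩
          simp only [Set.mem_insert_iff, Set.mem_singleton_iff, Prod.mk.injEq]
          cases y <;> cases b <;> simp <;> tauto
        · right; simp [opp]

end FirstAndSecondMove

end Diagram

/-! ### Determinants for the third move -/

section TriangleDeterminant

variable {K : Type*} [CommRing K] {P : Type*} [Fintype P] [DecidableEq P]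

/-- Normal form of six relations: `X₁`, `Y₁`, `Z₁` serve to eliminate the generators `a`, `b`, `d`, and
the others, `X₂`, `Y₂`, `Z₂`, are replaced by relations `c` without these generators. -/
theorem det_canonical (f c : P → P → K) {X₁ X₂ Y₁ Y₂ Z₁ Z₂ a b d : P}
    (hnd : [X₁, Y₁, Z₁, X₂, Y₂, Z₂].Nodup) (hab : a ≠ b) (had : a ≠ d) (hbd : b ≠ d)
    (hX : c X₂ - f X₂ ∈ Submodule.span K {f X₁, f Y₁, f Z₁})
    (hY : c Y₂ - f Y₂ ∈ Submodule.span K {f X₁, f Y₁, f Z₁})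
    (hZ : c Z₂ - f Z₂ ∈ Submodule.span K {f X₁, f Y₁, f Z₁})
    (hcX : c X₁ = Pi.single a 1) (hcY : c Y₁ = Pi.single b 1) (hcZ : c Z₁ = Pi.single d 1)
    (hfX : f X₁ a = 1 ∧ f X₁ b = 0 ∧ f X₁ d = 0) (hfY : f Y₁ b = 1 ∧ f Y₁ d = 0)
    (hfZ : f Z₁ d = 1)
    (hc0 : ∀ p, p ≠ X₁ → p ≠ Y₁ → p ≠ Z₁ → c p a = 0 ∧ c p b = 0 ∧ c p d = 0)
    (hfc : ∀ p, p ∉ [X₁, Y₁, Z₁, X₂, Y₂, Z₂] → f p = c p) :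
    (Matrix.of f).det = (Matrix.of c).det := by
  simp only [List.nodup_cons, List.mem_cons, List.not_mem_nil, or_false, not_or, not_false_eq_true,
    List.nodup_nil, and_true] at hnd
  obtain ⟨⟨xy, xz, xx2, xy2, xz2⟩, ⟨yz, yx2, yy2, yz2⟩, ⟨zx2, zy2, zz2⟩, ⟨x2y2, x2z2⟩, y2z2⟩ := hnd
  set f₁ := Function.update f X₂ (c X₂) with hf₁
  set f₂ := Function.update f₁ Y₂ (c Y₂) with hf₂
  set f₃ := Function.update f₂ Z₂ (c Z₂) with hf₃
  set f₄ := Function.update f₃ Z₁ (c Z₁) with hf₄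
  set f₅ := Function.update f₄ Y₁ (c Y₁) with hf₅
  have hup : ∀ (h : P → P → K) (i : P), h X₁ = f X₁ → h Y₁ = f Y₁ → h Z₁ = f Z₁ → h i = f i →
      X₁ ≠ i → Y₁ ≠ i → Z₁ ≠ i → c i - f i ∈ Submodule.span K {f X₁, f Y₁, f Z₁} →
      (Matrix.of (Function.update h i (c i))).det = (Matrix.of h).det := by
    intro h i h1 h2 h3 h4 n1 n2 n3 hi
    rw [det_of_sub_mem_span (Function.update h i (c i)) h i 1
      (fun p hp => Function.update_of_ne hp _ _), one_mul]
    rw [Function.update_self, one_smul, h4]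
    refine Submodule.span_mono ?_ hi
    rintro _ (rfl | rfl | rfl)
    · exact ⟨X₁, n1, h1⟩
    · exact ⟨Y₁, n2, h2⟩
    · exact ⟨Z₁, n3, h3⟩
  have e1 : (Matrix.of f₁).det = (Matrix.of f).det :=
    hup f X₂ rfl rfl rfl rfl xx2 yx2 zx2 hX
  have e2 : (Matrix.of f₂).det = (Matrix.of f₁).det := by
    apply hup f₁ Y₂ <;> first | assumption | (rw [hf₁, Function.update_of_ne]; first | assumption | exact Ne.symm ‹_›)
  have e3 : (Matrix.of f₃).det = (Matrix.of f₂).det := by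
    apply hup f₂ Z₂ <;> first | assumption | (rw [hf₂, hf₁, Function.update_of_ne, Function.update_of_ne] <;> first | assumption | exact Ne.symm ‹_›)
  have h3X : f₃ X₁ = f X₁ := by
    rw [hf₃, hf₂, hf₁, Function.update_of_ne, Function.update_of_ne, Function.update_of_ne] <;> assumption
  have h3Y : f₃ Y₁ = f Y₁ := by
    rw [hf₃, hf₂, hf₁, Function.update_of_ne, Function.update_of_ne, Function.update_of_ne] <;> assumption
  have h3Z : f₃ Z₁ = f Z₁ := by
    rw [hf₃, hf₂, hf₁, Function.update_of_ne, Function.update_of_ne, Function.update_of_ne] <;> assumption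
  have h3 : ∀ p, p ≠ X₁ → p ≠ Y₁ → p ≠ Z₁ → f₃ p = c p := by
    intro p p1 p2 p3
    rw [hf₃]
    by_cases q1 : p = Z₂
    · subst q1; rw [Function.update_self]
    rw [Function.update_of_ne q1, hf₂]
    by_cases q2 : p = Y₂
    · subst q2; rw [Function.update_self]
    rw [Function.update_of_ne q2, hf₁]
    by_cases q3 : p = X₂
    · subst q3; rw [Function.update_self]
    rw [Function.update_of_ne q3]
    exact hfc p (by simp [p1, p2, p3, q1, q2, q3])
  have e4 : (Matrix.of f₃).det = (Matrix.of f₄).det := by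
    refine det_of_free_row f₃ f₄ Z₁ d (fun p hp => (Function.update_of_ne hp _ _).symm) ?_ ?_
    · intro p hp
      by_cases p1 : p = X₁
      · rw [p1, h3X, hfX.2.2]
      by_cases p2 : p = Y₁
      · rw [p2, h3Y, hfY.2]
      rw [h3 p p1 p2 hp, (hc0 p p1 p2 hp).2.2]
    · rw [h3Z, hfZ, hf₄, Function.update_self, hcZ, Pi.single_eq_same]
  have e5 : (Matrix.of f₄).det = (Matrix.of f₅).det := by
    refine det_of_free_row f₄ f₅ Y₁ b (fun p hp => (Function.update_of_ne hp _ _).symm) ?_ ?_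
    · intro p hp
      by_cases p3 : p = Z₁
      · rw [p3, hf₄, Function.update_self, hcZ, Pi.single_eq_of_ne hbd]
      rw [hf₄, Function.update_of_ne p3]
      by_cases p1 : p = X₁
      · rw [p1, h3X, hfX.2.1]
      rw [h3 p p1 hp p3, (hc0 p p1 hp p3).2.1]
    · rw [hf₄, Function.update_of_ne yz, h3Y, hfY.1, hf₅, Function.update_self, hcY,
        Pi.single_eq_same]
  have e6 : (Matrix.of f₅).det = (Matrix.of c).det := by
    have h5 : ∀ p, p ≠ X₁ → f₅ p = c p := by
      intro p p1
      rw [hf₅]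
      by_cases p2 : p = Y₁
      · rw [p2, Function.update_self]
      rw [Function.update_of_ne p2, hf₄]
      by_cases p3 : p = Z₁
      · rw [p3, Function.update_self]
      rw [Function.update_of_ne p3, h3 p p1 p2 p3]
    refine det_of_free_row f₅ c X₁ a h5 ?_ ?_
    · intro p hp
      rw [h5 p hp]
      by_cases p2 : p = Y₁
      · rw [p2, hcY, Pi.single_eq_of_ne hab]
      by_cases p3 : p = Z₁
      · rw [p3, hcZ, Pi.single_eq_of_ne had]
      exact (hc0 p hp p2 p3).1
    · rw [hf₅, Function.update_of_ne xy, hf₄, Function.update_of_ne xz, h3X, hfX.1, hcX,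
        Pi.single_eq_same]
  rw [← e1, ← e2, ← e3, e4, e5, e6]

/-- The relations `f` at the six passages of a triangle before the third move, and `g` after it. The
generators `a`, `b`, `d` belong to the sides of the triangle, the generators `x₀`, …, `z₂` to the edges
around it. Elimination of the sides gives the same relations between the outer edges. -/
theorem det_triangle (f g : P → P → K) {X₁ X₂ Y₁ Y₂ Z₁ Z₂ a b d : P}
    (hnd : [X₁, Y₁, Z₁, X₂, Y₂, Z₂].Nodup) (hab : a ≠ b) (had : a ≠ d) (hbd : b ≠ d)
    {α β A k p q r u : K} {x₀ x₂ y₀ y₂ z₀ z₂ : P → K}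
    (hα : k * α = k) (hβ : k * β = k) (hpq : k * (p + q) = k) (hru : k * (r + u) = k)
    (h0 : ∀ v ∈ [x₀, x₂, y₀, y₂, z₀, z₂], v a = 0 ∧ v b = 0 ∧ v d = 0)
    (fX₁ : f X₁ = Pi.single a 1 - α • x₀) (fX₂ : f X₂ = x₂ - β • Pi.single a 1)
    (fY₁ : f Y₁ = Pi.single b 1 - A • y₀ - k • Pi.single a 1)
    (fZ₁ : f Z₁ = Pi.single d 1 - A • z₀ - k • Pi.single a 1)
    (fY₂ : f Y₂ = y₂ - p • Pi.single b 1 - q • Pi.single d 1)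
    (fZ₂ : f Z₂ = z₂ - r • Pi.single d 1 - u • Pi.single b 1)
    (gX₁ : g X₁ = Pi.single a 1 - β • x₀) (gX₂ : g X₂ = x₂ - α • Pi.single a 1)
    (gY₁ : g Y₁ = Pi.single b 1 - p • y₀ - q • z₀)
    (gZ₁ : g Z₁ = Pi.single d 1 - r • z₀ - u • y₀)
    (gY₂ : g Y₂ = y₂ - A • Pi.single b 1 - k • Pi.single a 1)
    (gZ₂ : g Z₂ = z₂ - A • Pi.single d 1 - k • Pi.single a 1)
    (hfg : ∀ i, i ∉ [X₁, Y₁, Z₁, X₂, Y₂, Z₂] → f i = g i)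
    (hf0 : ∀ i, i ∉ [X₁, Y₁, Z₁, X₂, Y₂, Z₂] → f i a = 0 ∧ f i b = 0 ∧ f i d = 0) :
    (Matrix.of f).det = (Matrix.of g).det := by
  have hba := hab.symm
  have hda := had.symm
  have hdb := hbd.symm
  have hnd' := hnd
  simp only [List.nodup_cons, List.mem_cons, List.not_mem_nil, or_false, not_or, not_false_eq_true,
    List.nodup_nil, and_true] at hnd'
  obtain ⟨⟨xy, xz, xx2, xy2, xz2⟩, ⟨yz, yx2, yy2, yz2⟩, ⟨zx2, zy2, zz2⟩, ⟨x2y2, x2z2⟩, y2z2⟩ := hnd'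
  simp only [List.mem_cons, List.not_mem_nil, or_false, forall_eq_or_imp, forall_eq] at h0
  obtain ⟨hx0, hx2, hy0, hy2, hz0, hz2⟩ := h0
  -- the relations between the outer ends of the three pieces are the same on both sides
  set c : P → P → K := fun i =>
    if i = X₁ then Pi.single a 1 else if i = Y₁ then Pi.single b 1 else
    if i = Z₁ then Pi.single d 1 else if i = X₂ then x₂ - (α * β) • x₀ else
    if i = Y₂ then y₂ - (A * p) • y₀ - (A * q) • z₀ - k • x₀ else
    if i = Z₂ then z₂ - (A * r) • z₀ - (A * u) • y₀ - k • x₀ else f i with hc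
  have cX₁ : c X₁ = Pi.single a 1 := by simp [hc]
  have cY₁ : c Y₁ = Pi.single b 1 := by simp [hc, Ne.symm xy]
  have cZ₁ : c Z₁ = Pi.single d 1 := by simp [hc, Ne.symm xz, Ne.symm yz]
  have cX₂ : c X₂ = x₂ - (α * β) • x₀ := by simp [hc, Ne.symm xx2, Ne.symm yx2, Ne.symm zx2]
  have cY₂ : c Y₂ = y₂ - (A * p) • y₀ - (A * q) • z₀ - k • x₀ := by
    simp [hc, Ne.symm xy2, Ne.symm yy2, Ne.symm zy2, Ne.symm x2y2]
  have cZ₂ : c Z₂ = z₂ - (A * r) • z₀ - (A * u) • y₀ - k • x₀ := by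
    simp [hc, Ne.symm xz2, Ne.symm yz2, Ne.symm zz2, Ne.symm x2z2, Ne.symm y2z2]
  have hcf : ∀ i, i ∉ [X₁, Y₁, Z₁, X₂, Y₂, Z₂] → f i = c i := by
    intro i hi
    simp only [List.mem_cons, List.not_mem_nil, or_false, not_or] at hi
    simp [hc, hi]
  have hc0 : ∀ i, i ≠ X₁ → i ≠ Y₁ → i ≠ Z₁ → c i a = 0 ∧ c i b = 0 ∧ c i d = 0 := by
    intro i h1 h2 h3
    by_cases h4 : i = X₂
    · rw [h4, cX₂]; simp [hx0, hx2]
    by_cases h5 : i = Y₂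
    · rw [h5, cY₂]; simp [hx0, hy0, hy2, hz0]
    by_cases h6 : i = Z₂
    · rw [h6, cZ₂]; simp [hx0, hy0, hz2, hz0]
    have hi : i ∉ [X₁, Y₁, Z₁, X₂, Y₂, Z₂] := by simp [h1, h2, h3, h4, h5, h6]
    rw [← hcf i hi]; exact hf0 i hi
  have mem : ∀ (h : P → P → K) (c₁ c₂ c₃ : K), c₁ • h X₁ + c₂ • h Y₁ + c₃ • h Z₁ ∈
      Submodule.span K {h X₁, h Y₁, h Z₁} := by
    intro h c₁ c₂ c₃
    exact Submodule.add_mem _ (Submodule.add_mem _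
      (Submodule.smul_mem _ _ (Submodule.subset_span (by simp)))
      (Submodule.smul_mem _ _ (Submodule.subset_span (by simp))))
      (Submodule.smul_mem _ _ (Submodule.subset_span (by simp)))
  have e1 : (Matrix.of f).det = (Matrix.of c).det := by
    refine det_canonical f c hnd hab had hbd ?_ ?_ ?_ cX₁ cY₁ cZ₁ ?_ ?_ ?_ hc0 hcf
    · convert mem f β 0 0 using 1
      rw [fX₁, fX₂, cX₂]; module
    · convert mem f k p q using 1
      rw [fX₁, fY₁, fZ₁, fY₂, cY₂]
      ext i
      simp only [Pi.sub_apply, Pi.add_apply, Pi.smul_apply, smul_eq_mul]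
      linear_combination x₀ i * hα + (Pi.single a (1 : K) : P → K) i * hpq
    · convert mem f k u r using 1
      rw [fX₁, fY₁, fZ₁, fZ₂, cZ₂]
      ext i
      simp only [Pi.sub_apply, Pi.add_apply, Pi.smul_apply, smul_eq_mul]
      linear_combination x₀ i * hα + (Pi.single a (1 : K) : P → K) i * hru
    · rw [fX₁]; simp [hx0, hba, hda]
    · rw [fY₁]; simp [hy0, hba, hdb, hda]
    · rw [fZ₁]; simp [hz0, hda]
  have e2 : (Matrix.of g).det = (Matrix.of c).det := by
    refine det_canonical g c hnd hab had hbd ?_ ?_ ?_ cX₁ cY₁ cZ₁ ?_ ?_ ?_ hc0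
      (fun i hi => by rw [← hfg i hi, hcf i hi])
    · convert mem g α 0 0 using 1
      rw [gX₁, gX₂, cX₂]; module
    · convert mem g k A 0 using 1
      rw [gX₁, gY₁, gZ₁, gY₂, cY₂]
      ext i
      simp only [Pi.sub_apply, Pi.add_apply, Pi.smul_apply, smul_eq_mul]
      linear_combination x₀ i * hβ
    · convert mem g k 0 A using 1
      rw [gX₁, gY₁, gZ₁, gZ₂, cZ₂]
      ext i
      simp only [Pi.sub_apply, Pi.add_apply, Pi.smul_apply, smul_eq_mul]
      linear_combination x₀ i * hβ
    · rw [gX₁]; simp [hx0, hba, hda]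
    · rw [gY₁]; simp [hy0, hz0, hdb]
    · rw [gZ₁]; simp [hz0, hy0]
  rw [e1, e2]

/-- Simultaneous addition of multiples of rows which are not changed themselves. -/
theorem det_add_smul_rows (f g : P → P → K) (ρ : P → P) (c : P → K)
    (hf : ∀ p, f p = g p + c p • g (ρ p)) (hc : ∀ p, c p = 0 ∨ c (ρ p) = 0 ∧ ρ p ≠ p) :
    (Matrix.of f).det = (Matrix.of g).det := by
  have key : ∀ S : Finset P, (Matrix.of fun p => if p ∈ S then f p else g p).det =
      (Matrix.of g).det := by
    intro S
    induction S using Finset.induction_on with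
    | empty => simp
    | insert i S hi ih =>
      rw [← ih, ← one_mul (Matrix.of fun p => if p ∈ S then f p else g p).det]
      refine det_of_sub_mem_span _ _ i 1 (fun p hp => by simp [hp]) ?_
      rw [one_smul, if_pos (Finset.mem_insert_self i S), if_neg hi, hf i, add_sub_cancel_left]
      rcases hc i with h | ⟨h, hne⟩
      · rw [h, zero_smul]; exact Submodule.zero_mem _
      · refine Submodule.smul_mem _ _ (Submodule.subset_span ⟨ρ i, hne, ?_⟩)
        show (if ρ i ∈ S then f (ρ i) else g (ρ i)) = _
        split_ifs
        · rw [hf, h, zero_smul, add_zero]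
        · rfl
  simpa using key Finset.univ

end TriangleDeterminant

/-! ### The third move -/

section AbstractTriangle

variable {K : Type*} [CommRing K] {P : Type*}

/-- The coefficient of the edge `a` in a relation with coefficient `w` of the previous edge, solved for
the edge `b`, where `a` and `b` are the two edges at a passage, and `o` tells whether the strand
is oriented from `a` to `b`. -/
def endUnit (o : Bool) (w : Kˣ) : Kˣ := if o then w else w⁻¹

/-- The coefficient of the overpass in a relation, solved as in `endUnit`. -/
def overCoeff (o : Bool) (w : Kˣ) (u : K) : K := if o then -u else ((w⁻¹ : Kˣ) : K) * u

/-- The factor by which a relation has to be divided to solve it as in `endUnit`. -/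
def scaleUnit (o : Bool) (w : Kˣ) : Kˣ := if o then 1 else -w

theorem solve_relation [DecidableEq P] (o : Bool) (w : Kˣ) (u : K) {p p' a b : P} (v : P → K)
    (he : p = if o then b else a) (he' : p' = if o then a else b) :
    ((scaleUnit o w)⁻¹ : Kˣ) • ((Pi.single p 1 : P → K) - (w : K) • Pi.single p' 1 + u • v) =
    Pi.single b 1 - (endUnit o w : K) • Pi.single a 1 - overCoeff o w u • v := by
  rw [inv_smul_eq_iff, Units.smul_def]
  cases o
  · simp only [Bool.false_eq_true, if_false] at he he'
    subst he he'
    simp only [scaleUnit, endUnit, overCoeff, Bool.false_eq_true, if_false, smul_sub, smul_smul,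
      Units.val_neg, neg_mul, Units.mul_inv, Units.mul_inv_cancel_left]
    module
  · simp only [if_true] at he he'
    subst he he'
    simp only [scaleUnit, endUnit, overCoeff, if_true, Units.val_one, one_smul]
    module

@[simp] theorem overCoeff_zero (o : Bool) (w : Kˣ) : overCoeff o w (0 : K) = 0 := by
  cases o <;> simp [overCoeff]

/-- The relations at classical crossings hold if all generators are equal; this makes the relations at
the third crossing of a triangle compatible with those along the top strand. -/
theorem endUnit_add_overCoeff (o : Bool) (w : Kˣ) :
    (endUnit o w : K) + overCoeff o w ((w : K) - 1) = 1 := by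
  cases o <;> simp [endUnit, overCoeff, mul_sub]

/-- A piece of a strand between two consecutive passages `X₁` and `X₂`, in the order given by `o`:
the edge `a` between them, and the edges `p₀` beyond `X₁` and `p₂` beyond `X₂`. -/
theorem exists_piece (succ : Equiv.Perm P) {X₁ X₂ : P} (hne : X₁ ≠ X₂) (o : Bool)
    (h : if o then succ X₁ = X₂ else succ X₂ = X₁) :
    ∃ a p₀ p₂, (a = X₁ ∨ a = X₂) ∧ (succ a = X₁ ∨ succ a = X₂) ∧ p₀ ≠ a ∧ p₂ ≠ a ∧
      (p₀ = X₁ ∨ succ p₀ = X₁) ∧ (p₂ = X₂ ∨ succ p₂ = X₂) ∧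
      X₁ = (if o then a else p₀) ∧ succ.symm X₁ = (if o then p₀ else a) ∧
      X₂ = (if o then p₂ else a) ∧ succ.symm X₂ = (if o then a else p₂) := by
  cases o
  · simp only [Bool.false_eq_true, if_false] at h ⊢
    refine ⟨X₂, X₁, succ.symm X₂, Or.inr rfl, Or.inl h, hne, ?_, Or.inl rfl, Or.inr (by simp), rfl,
      ?_, rfl, rfl⟩
    · rw [Ne, Equiv.symm_apply_eq, h]; exact hne.symm
    · rw [Equiv.symm_apply_eq, h]
  · simp only [if_true] at h ⊢
    refine ⟨X₁, succ.symm X₁, X₂, Or.inl rfl, Or.inr h, ?_, hne.symm, Or.inr (by simp), Or.inl rfl,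
      rfl, rfl, rfl, ?_⟩
    · rw [Ne, Equiv.symm_apply_eq, h]; exact hne
    · rw [Equiv.symm_apply_eq, h]

/-- The third move for a system of relations with coefficients `w` of the previous edge and `u` of
the overpass, whose generator is read at the edge `st p` before and `st' p` after the move. Here
`τ` exchanges the two passages on each of the pieces `X`, `Y`, `Z`. On each piece
the relations are solved for the edges in the direction from the first to the second passage, whatever
the orientation; the product of the scaling factors is the same before and after the move. -/
theorem det_slide [Fintype P] [DecidableEq P] {succ τ : Equiv.Perm P} {w : P → Kˣ} {u : P → K} {st st' : P → P}
    {X₁ X₂ Y₁ Y₂ Z₁ Z₂ : P} (hnd : [X₁, Y₁, Z₁, X₂, Y₂, Z₂].Nodup) {ox oy oz : Bool}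
    {a x₀ x₂ b y₀ y₂ d z₀ z₂ : P}
    (hX : (a = X₁ ∨ a = X₂) ∧ (succ a = X₁ ∨ succ a = X₂) ∧ x₀ ≠ a ∧ x₂ ≠ a ∧
      (x₀ = X₁ ∨ succ x₀ = X₁) ∧ (x₂ = X₂ ∨ succ x₂ = X₂) ∧
      X₁ = (if ox then a else x₀) ∧ succ.symm X₁ = (if ox then x₀ else a) ∧
      X₂ = (if ox then x₂ else a) ∧ succ.symm X₂ = (if ox then a else x₂))
    (hY : (b = Y₁ ∨ b = Y₂) ∧ (succ b = Y₁ ∨ succ b = Y₂) ∧ y₀ ≠ b ∧ y₂ ≠ b ∧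
      (y₀ = Y₁ ∨ succ y₀ = Y₁) ∧ (y₂ = Y₂ ∨ succ y₂ = Y₂) ∧
      Y₁ = (if oy then b else y₀) ∧ succ.symm Y₁ = (if oy then y₀ else b) ∧
      Y₂ = (if oy then y₂ else b) ∧ succ.symm Y₂ = (if oy then b else y₂))
    (hZ : (d = Z₁ ∨ d = Z₂) ∧ (succ d = Z₁ ∨ succ d = Z₂) ∧ z₀ ≠ d ∧ z₂ ≠ d ∧
      (z₀ = Z₁ ∨ succ z₀ = Z₁) ∧ (z₂ = Z₂ ∨ succ z₂ = Z₂) ∧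
      Z₁ = (if oz then d else z₀) ∧ succ.symm Z₁ = (if oz then z₀ else d) ∧
      Z₂ = (if oz then z₂ else d) ∧ succ.symm Z₂ = (if oz then d else z₂))
    (τX₁ : τ X₁ = X₂) (τX₂ : τ X₂ = X₁) (τY₁ : τ Y₁ = Y₂) (τY₂ : τ Y₂ = Y₁)
    (τZ₁ : τ Z₁ = Z₂) (τZ₂ : τ Z₂ = Z₁) (τoff : ∀ p, p ∉ [X₁, Y₁, Z₁, X₂, Y₂, Z₂] → τ p = p)
    (uX₁ : u X₁ = 0) (uX₂ : u X₂ = 0) (sY₁ : st Y₁ = a) (sZ₁ : st Z₁ = a)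
    (sY₂ : u Y₂ = 0 ∨ st Y₂ = d) (sZ₂ : u Z₂ = 0 ∨ st Z₂ = b)
    (sY₂' : st' Y₂ = a) (sZ₂' : st' Z₂ = a)
    (sY₁' : u Y₂ = 0 ∨ st' Y₁ = z₀) (sZ₁' : u Z₂ = 0 ∨ st' Z₁ = y₀)
    (hst : ∀ p, p ∉ [X₁, Y₁, Z₁, X₂, Y₂, Z₂] → st p = st' p)
    (hst0 : ∀ p, p ∉ [X₁, Y₁, Z₁, X₂, Y₂, Z₂] → st p ≠ a ∧ st p ≠ b ∧ st p ≠ d)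
    (hA : endUnit oy (w Y₁) = endUnit oz (w Z₁))
    (hk : overCoeff oy (w Y₁) (u Y₁) = overCoeff oz (w Z₁) (u Z₁))
    (hclass : overCoeff oy (w Y₁) (u Y₁) = 0 ∨ w X₁ = 1 ∧ w X₂ = 1 ∧
      u Y₂ = w Y₂ - 1 ∧ u Z₂ = w Z₂ - 1) :
    (Matrix.of fun p => (Pi.single p 1 : P → K) - (w p : K) • Pi.single (succ.symm p) 1 +
      u p • Pi.single (st p) 1).det =
    (Matrix.of fun p => (Pi.single p 1 : P → K) - (w (τ p) : K) • Pi.single (succ.symm p) 1 +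
      u (τ p) • Pi.single (st' p) 1).det := by
  have hnd' := hnd
  simp only [List.nodup_cons, List.mem_cons, List.not_mem_nil, or_false, not_or, not_false_eq_true,
    List.nodup_nil, and_true] at hnd'
  obtain ⟨⟨xy, xz, xx2, xy2, xz2⟩, ⟨yz, yx2, yy2, yz2⟩, ⟨zx2, zy2, zz2⟩, ⟨x2y2, x2z2⟩, y2z2⟩ := hnd'
  obtain ⟨ha, hsa, hx0a, hx2a, hx0, hx2, eX₁, eX₁', eX₂, eX₂'⟩ := hX
  obtain ⟨hb, hsb, hy0b, hy2b, hy0, hy2, eY₁, eY₁', eY₂, eY₂'⟩ := hY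
  obtain ⟨hd, hsd, hz0d, hz2d, hz0, hz2, eZ₁, eZ₁', eZ₂, eZ₂'⟩ := hZ
  have hab : a ≠ b := by grind
  have had : a ≠ d := by grind
  have hbd : b ≠ d := by grind
  -- the orientations of the pieces at the six passages
  let o : P → Bool := fun p => if p = X₁ ∨ p = X₂ then ox else if p = Y₁ ∨ p = Y₂ then oy else
    if p = Z₁ ∨ p = Z₂ then oz else true
  have oX₁ : o X₁ = ox := by simp [o]
  have oX₂ : o X₂ = ox := by simp [o]
  have oY₁ : o Y₁ = oy := by simp [o, Ne.symm xy, yx2]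
  have oY₂ : o Y₂ = oy := by simp [o, Ne.symm xy2, Ne.symm x2y2]
  have oZ₁ : o Z₁ = oz := by simp [o, Ne.symm xz, zx2, Ne.symm yz, zy2]
  have oZ₂ : o Z₂ = oz := by simp [o, Ne.symm xz2, Ne.symm x2z2, Ne.symm yz2, Ne.symm y2z2]
  have ooff : ∀ p, p ∉ [X₁, Y₁, Z₁, X₂, Y₂, Z₂] → o p = true := by
    intro p hp
    simp only [List.mem_cons, List.not_mem_nil, or_false, not_or] at hp
    simp [o, hp]
  let c : P → Kˣ := fun p => scaleUnit (o p) (w p)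
  have hscale : ∀ (c : P → Kˣ) (F : P → P → K), (Matrix.of F).det =
      (∏ p, (c p : K)) * (Matrix.of fun p => (c p)⁻¹ • F p).det := by
    intro c F
    rw [← Matrix.det_mul_column]
    congr 1
    ext p q
    simp [Units.smul_def]
  refine (hscale c _).trans (Eq.trans ?_ (hscale (fun p => c (τ p)) _).symm)
  rw [Equiv.prod_comp τ (fun p => (c p : K))]
  congr 1
  have hoff : ∀ p, p ∉ [X₁, Y₁, Z₁, X₂, Y₂, Z₂] → c p = 1 := by
    intro p hp
    simp only [c, ooff p hp, scaleUnit, if_true]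
  have hvan : ∀ q, q ≠ a → q ≠ b → q ≠ d →
      (Pi.single q (1 : K) : P → K) a = 0 ∧ (Pi.single q (1 : K) : P → K) b = 0 ∧
      (Pi.single q (1 : K) : P → K) d = 0 := by
    intro q h1 h2 h3
    exact ⟨Pi.single_eq_of_ne h1.symm _, Pi.single_eq_of_ne h2.symm _, Pi.single_eq_of_ne h3.symm _⟩
  refine det_triangle (X₁ := X₁) (X₂ := X₂) (Y₁ := Y₁) (Y₂ := Y₂) (Z₁ := Z₁) (Z₂ := Z₂)
    (α := endUnit ox (w X₁)) (β := endUnit ox (w X₂)) (A := endUnit oy (w Y₁))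
    (k := overCoeff oy (w Y₁) (u Y₁)) (p := endUnit oy (w Y₂)) (q := overCoeff oy (w Y₂) (u Y₂))
    (r := endUnit oz (w Z₂)) (u := overCoeff oz (w Z₂) (u Z₂))
    (x₀ := Pi.single x₀ 1) (x₂ := Pi.single x₂ 1) (y₀ := Pi.single y₀ 1) (y₂ := Pi.single y₂ 1)
    (z₀ := Pi.single z₀ 1) (z₂ := Pi.single z₂ 1) _ _ hnd hab had hbd
    ?_ ?_ ?_ ?_ ?_ ?_ ?_ ?_ ?_ ?_ ?_ ?_ ?_ ?_ ?_ ?_ ?_ ?_ ?_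
  · rcases hclass with h | h
    · rw [h, zero_mul]
    · rw [h.1]; cases ox <;> simp [endUnit]
  · rcases hclass with h | h
    · rw [h, zero_mul]
    · rw [h.2.1]; cases ox <;> simp [endUnit]
  · rcases hclass with h | h
    · rw [h, zero_mul]
    · rw [h.2.2.1, endUnit_add_overCoeff, mul_one]
  · rcases hclass with h | h
    · rw [h, zero_mul]
    · rw [h.2.2.2, endUnit_add_overCoeff, mul_one]
  · simp only [List.mem_cons, List.not_mem_nil, or_false, forall_eq_or_imp, forall_eq]
    refine ⟨hvan _ ?_ ?_ ?_, hvan _ ?_ ?_ ?_, hvan _ ?_ ?_ ?_, hvan _ ?_ ?_ ?_, hvan _ ?_ ?_ ?_,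
      hvan _ ?_ ?_ ?_⟩ <;> grind
  · have := solve_relation ox (w X₁) (u X₁) (Pi.single (st X₁) 1) eX₁ eX₁'
    simp only [c, oX₁]; rw [this, uX₁]; simp
  · have := solve_relation ox (w X₂) (u X₂) (Pi.single (st X₂) 1) eX₂ eX₂'
    simp only [c, oX₂]; rw [this, uX₂]; simp
  · have := solve_relation oy (w Y₁) (u Y₁) (Pi.single (st Y₁) 1) eY₁ eY₁'
    simp only [c, oY₁]; rw [this, sY₁]
  · have := solve_relation oz (w Z₁) (u Z₁) (Pi.single (st Z₁) 1) eZ₁ eZ₁'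
    simp only [c, oZ₁]; rw [this, sZ₁, hA, hk]
  · have := solve_relation oy (w Y₂) (u Y₂) (Pi.single (st Y₂) 1) eY₂ eY₂'
    simp only [c, oY₂]; rw [this]
    rcases sY₂ with h | h
    · rw [h]; simp
    · rw [h]
  · have := solve_relation oz (w Z₂) (u Z₂) (Pi.single (st Z₂) 1) eZ₂ eZ₂'
    simp only [c, oZ₂]; rw [this]
    rcases sZ₂ with h | h
    · rw [h]; simp
    · rw [h]
  · have := solve_relation ox (w X₂) (u X₂) (Pi.single (st' X₁) 1) eX₁ eX₁'
    simp only [c, τX₁, oX₂]; rw [this, uX₂]; simp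
  · have := solve_relation ox (w X₁) (u X₁) (Pi.single (st' X₂) 1) eX₂ eX₂'
    simp only [c, τX₂, oX₁]; rw [this, uX₁]; simp
  · have := solve_relation oy (w Y₂) (u Y₂) (Pi.single (st' Y₁) 1) eY₁ eY₁'
    simp only [c, τY₁, oY₂]; rw [this]
    rcases sY₁' with h | h
    · rw [h]; simp
    · rw [h]
  · have := solve_relation oz (w Z₂) (u Z₂) (Pi.single (st' Z₁) 1) eZ₁ eZ₁'
    simp only [c, τZ₁, oZ₂]; rw [this]
    rcases sZ₁' with h | h
    · rw [h]; simp
    · rw [h]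
  · have := solve_relation oy (w Y₁) (u Y₁) (Pi.single (st' Y₂) 1) eY₂ eY₂'
    simp only [c, τY₂, oY₁]; rw [this, sY₂']
  · have := solve_relation oz (w Z₁) (u Z₁) (Pi.single (st' Z₂) 1) eZ₂ eZ₂'
    simp only [c, τZ₂, oZ₁]; rw [this, sZ₂', hA, hk]
  · intro p hp
    simp only [hoff p hp, τoff p hp, hst p hp]
  · intro p hp
    have h := hst0 p hp
    have hp' : p ≠ a ∧ p ≠ b ∧ p ≠ d := by
      simp only [List.mem_cons, List.not_mem_nil, or_false, not_or] at hp; grind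
    have hpp : succ.symm p ≠ a ∧ succ.symm p ≠ b ∧ succ.symm p ≠ d := by
      simp only [List.mem_cons, List.not_mem_nil, or_false, not_or] at hp
      rw [Ne, Ne, Ne, Equiv.symm_apply_eq, Equiv.symm_apply_eq, Equiv.symm_apply_eq]; grind
    have v1 := hvan p hp'.1 hp'.2.1 hp'.2.2
    have v2 := hvan _ hpp.1 hpp.2.1 hpp.2.2
    have v3 := hvan _ h.1 h.2.1 h.2.2
    simp only [hoff p hp, inv_one, one_smul, Pi.add_apply, Pi.sub_apply, Pi.smul_apply, v1, v2, v3]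
    simp

end AbstractTriangle

namespace Diagram

section Triangle

variable {K : Type*} [CommRing K] (s t : Kˣ) (D : Diagram)

/-- The coefficient of the previous edge in the relation at a passage. -/
def passUnit (p : D.Passage) : Kˣ := s ^ D.shift p * D.underUnit t p

/-- The relations of the diagram, where the generator of the overpass is read after the crossing if
`χ` is true there, and before the crossing otherwise. -/
def relationAt (χ : D.C → Bool) (p : D.Passage) : D.Passage → K :=
  Pi.single p 1 - (D.passUnit s t p : K) • Pi.single (D.succ.symm p) 1 +
    ((D.underUnit t p : K) - 1) •
      Pi.single (if χ p.1 then opp p else D.succ.symm (opp p)) 1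

/-- The relation at the overpass identifies the two edges at which its generator may be read. -/
theorem det_relationAt (χ : D.C → Bool) :
    (Matrix.of (D.relation s t)).det = (Matrix.of (D.relationAt s t χ)).det := by
  refine det_add_smul_rows _ _ opp
    (fun p => if χ p.1 then 0 else (D.underUnit t p : K) - 1) ?_ ?_
  · intro p
    by_cases hχ : χ p.1
    · simp [hχ, relationAt, relation, passUnit]
    by_cases hu : D.IsUnder p
    · have hu2 : ¬ D.IsUnder (opp p) := by
        rw [isUnder_opp (kind_ne_virtual_of_isUnder hu)]; simpa using hu
      have h2 : D.relationAt s t χ (opp p) =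
          Pi.single (opp p) 1 - Pi.single (D.succ.symm (opp p)) 1 := by
        have : D.kind (opp p).1 ≠ .virtual := kind_ne_virtual_of_isUnder (p := p) hu
        simp [relationAt, passUnit, underUnit, hu2, shift, this]
      rw [h2]
      simp only [relationAt, relation, passUnit, hχ]
      simp only [Bool.false_eq_true, if_false]
      module
    · simp [relationAt, relation, passUnit, underUnit, hu]
  · intro p
    by_cases hu : D.IsUnder p
    · right
      have hu2 : ¬ D.IsUnder (opp p) := by
        rw [isUnder_opp (kind_ne_virtual_of_isUnder hu)]; simpa using hu
      exact ⟨by simp [underUnit, hu2], opp_ne p⟩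
    · left; simp [underUnit, hu]

variable {D}

theorem not_isUnder_of_withOver {c : D.C} {b : Bool} (h : D.kind c = .withOver b) :
    ¬ D.IsUnder (c, b) := by
  unfold IsUnder; cases b <;> simp [h, CrossingKind.withOver]

theorem passUnit_withOver {c : D.C} {b : Bool} (h : D.kind c = .withOver b) :
    D.passUnit s t (c, !b) = if b then t else t⁻¹ := by
  cases b <;> simp [passUnit, shift, underUnit, IsUnder, h, CrossingKind.withOver,
    CrossingKind.sign]

theorem passUnit_virtual {c : D.C} {b : Bool} (h : D.kind c = .virtual) :
    D.passUnit s t (c, b) = if b then s else s⁻¹ := by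
  cases b <;> simp [passUnit, shift, underUnit, IsUnder, h]

theorem withOver_ne_virtual (b : Bool) : CrossingKind.withOver b ≠ .virtual := by
  cases b <;> simp [CrossingKind.withOver]


end Triangle
end Diagram

namespace Diagram

section Slide

variable {K : Type*} [CommRing K] (s t : Kˣ) {D : Diagram}

theorem underUnit_of_not_isUnder {p : D.Passage} (h : ¬ D.IsUnder p) :
    ((D.underUnit t p : Kˣ) : K) - 1 = 0 := by simp [underUnit, h]

theorem underUnit_eq_passUnit {p : D.Passage} (h : D.kind p.1 ≠ .virtual) :
    D.underUnit t p = D.passUnit s t p := by simp [passUnit, shift, h]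

theorem passUnit_over {c : D.C} {b : Bool} (h : D.kind c = .withOver b) :
    D.passUnit s t (c, b) = 1 := by
  have h1 : D.kind c ≠ .virtual := by rw [h]; exact withOver_ne_virtual b
  have h2 := not_isUnder_of_withOver h
  simp [passUnit, shift, underUnit, h1, h2]

/-- The relations after the third move, in terms of the successor function before the move. -/
theorem Triangle.det_reindexed (T : D.Triangle) (χ : D.C → Bool) (τ : Equiv.Perm D.Passage)
    (hτ : τ = Equiv.swap (T.xy, T.sxy) (T.xz, T.sxz) *
      Equiv.swap (T.xy, !T.sxy) (T.yz, T.syz) * Equiv.swap (T.xz, !T.sxz) (T.yz, !T.syz))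
    (hττ : ∀ p, τ (τ p) = p) :
    (Matrix.of (T.slide.relation s t)).det =
    (Matrix.of fun p : D.Passage => (Pi.single p 1 : D.Passage → K) -
      (D.passUnit s t (τ p) : K) • Pi.single (D.succ.symm p) 1 +
      ((D.underUnit t (τ p) : K) - 1) • Pi.single (if χ (τ p).1 then τ (opp (τ p))
        else D.succ.symm (τ (opp (τ p)))) 1).det := by
  have hsymm : ∀ p, τ.symm p = τ p := fun p => by rw [Equiv.symm_apply_eq, hττ]
  have hσ : ∀ p, (τ * D.succ * τ⁻¹).symm p = τ (D.succ.symm (τ p)) := by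
    intro p
    rw [Equiv.symm_apply_eq]
    simp only [Equiv.Perm.mul_apply, Equiv.Perm.inv_def, hsymm, hττ, Equiv.apply_symm_apply]
  rw [det_relationAt s t T.slide χ]
  obtain ⟨F, hF⟩ : ∃ F : D.Passage → D.Passage → K, F = fun p => (Pi.single p 1 : D.Passage → K) -
      (D.passUnit s t p : K) • Pi.single ((τ * D.succ * τ⁻¹).symm p) 1 +
      ((D.underUnit t p : K) - 1) • Pi.single (if χ p.1 then opp p
        else (τ * D.succ * τ⁻¹).symm (opp p)) 1 := ⟨_, rfl⟩
  have hrel : (Matrix.of (T.slide.relationAt s t χ)).det = (Matrix.of F).det := by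
    subst hτ hF; rfl
  refine hrel.trans ((Matrix.det_submatrix_equiv_self τ (Matrix.of F)).symm.trans ?_)
  congr 1
  ext p q
  have hsg : ∀ x, (Pi.single x 1 : D.Passage → K) (τ q) = (Pi.single (τ x) 1 : D.Passage → K) q := by
    intro x
    simp only [Pi.single_apply]
    refine if_congr ⟨fun h => ?_, fun h => ?_⟩ rfl rfl
    · rw [← h, hττ]
    · rw [h, hττ]
  simp only [Matrix.submatrix_apply, Matrix.of_apply, hF, Pi.add_apply, Pi.sub_apply,
    Pi.smul_apply, hsg, hσ, hττ, apply_ite τ]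

theorem det_relation_slide (T : D.Triangle) :
    (Matrix.of (D.relation s t)).det = (Matrix.of (T.slide.relation s t)).det := by
  obtain ⟨xy, xz, yz, n1, n2, n3, sxy, sxz, syz, ox, oy, oz, sX, sY, sZ, fX, fY, fZ, kinds⟩ := T
  obtain ⟨X₁, hX₁⟩ : ∃ p : D.Passage, p = (xy, sxy) := ⟨_, rfl⟩
  obtain ⟨X₂, hX₂⟩ : ∃ p : D.Passage, p = (xz, sxz) := ⟨_, rfl⟩
  obtain ⟨Y₁, hY₁⟩ : ∃ p : D.Passage, p = (xy, !sxy) := ⟨_, rfl⟩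
  obtain ⟨Y₂, hY₂⟩ : ∃ p : D.Passage, p = (yz, syz) := ⟨_, rfl⟩
  obtain ⟨Z₁, hZ₁⟩ : ∃ p : D.Passage, p = (xz, !sxz) := ⟨_, rfl⟩
  obtain ⟨Z₂, hZ₂⟩ : ∃ p : D.Passage, p = (yz, !syz) := ⟨_, rfl⟩
  have six : ∀ p : D.Passage, p ∉ [X₁, Y₁, Z₁, X₂, Y₂, Z₂] ↔
      p.1 ≠ xy ∧ p.1 ≠ xz ∧ p.1 ≠ yz := by
    rintro ⟨x, y⟩
    simp only [List.mem_cons, List.not_mem_nil, or_false, hX₁, hX₂, hY₁, hY₂, hZ₁, hZ₂,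
      Prod.mk.injEq]
    clear * -
    cases y <;> cases sxy <;> cases sxz <;> cases syz <;> simp
  have hnd : [X₁, Y₁, Z₁, X₂, Y₂, Z₂].Nodup := by
    simp only [List.nodup_cons, List.mem_cons, List.not_mem_nil, or_false,
      not_false_eq_true, List.nodup_nil, and_true, hX₁, hX₂, hY₁, hY₂, hZ₁, hZ₂, Prod.mk.injEq,
      n1, n2, n3, false_and, true_and]
    simp
  have oX₁ : opp X₁ = Y₁ := by rw [hX₁, hY₁]; rfl
  have oX₂ : opp X₂ = Z₁ := by rw [hX₂, hZ₁]; rfl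
  have oY₂ : opp Y₂ = Z₂ := by rw [hY₂, hZ₂]; rfl
  have oY₁ : opp Y₁ = X₁ := by rw [← oX₁, opp_opp]
  have oZ₁ : opp Z₁ = X₂ := by rw [← oX₂, opp_opp]
  have oZ₂ : opp Z₂ = Y₂ := by rw [← oY₂, opp_opp]
  obtain ⟨τ, hτ⟩ : ∃ τ : Equiv.Perm D.Passage, τ = Equiv.swap X₁ X₂ * Equiv.swap Y₁ Y₂ *
    Equiv.swap Z₁ Z₂ := ⟨_, rfl⟩
  have hnd' := hnd
  simp only [List.nodup_cons, List.mem_cons, List.not_mem_nil, or_false, not_or, not_false_eq_true,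
    List.nodup_nil, and_true] at hnd'
  obtain ⟨⟨x1y1, x1z1, x1x2, x1y2, x1z2⟩, ⟨y1z1, y1x2, y1y2, y1z2⟩, ⟨z1x2, z1y2, z1z2⟩,
    ⟨x2y2, x2z2⟩, y2z2⟩ := hnd'
  have τX₁ : τ X₁ = X₂ := by
    rw [hτ, Equiv.Perm.mul_apply, Equiv.Perm.mul_apply, Equiv.swap_apply_of_ne_of_ne x1z1 x1z2,
      Equiv.swap_apply_of_ne_of_ne x1y1 x1y2, Equiv.swap_apply_left]
  have τX₂ : τ X₂ = X₁ := by
    rw [hτ, Equiv.Perm.mul_apply, Equiv.Perm.mul_apply,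
      Equiv.swap_apply_of_ne_of_ne (Ne.symm z1x2) x2z2,
      Equiv.swap_apply_of_ne_of_ne (Ne.symm y1x2) x2y2, Equiv.swap_apply_right]
  have τY₁ : τ Y₁ = Y₂ := by
    rw [hτ, Equiv.Perm.mul_apply, Equiv.Perm.mul_apply, Equiv.swap_apply_of_ne_of_ne y1z1 y1z2,
      Equiv.swap_apply_left, Equiv.swap_apply_of_ne_of_ne (Ne.symm x1y2) (Ne.symm x2y2)]
  have τY₂ : τ Y₂ = Y₁ := by
    rw [hτ, Equiv.Perm.mul_apply, Equiv.Perm.mul_apply,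
      Equiv.swap_apply_of_ne_of_ne (Ne.symm z1y2) y2z2,
      Equiv.swap_apply_right, Equiv.swap_apply_of_ne_of_ne (Ne.symm x1y1) y1x2]
  have τZ₁ : τ Z₁ = Z₂ := by
    rw [hτ, Equiv.Perm.mul_apply, Equiv.Perm.mul_apply, Equiv.swap_apply_left,
      Equiv.swap_apply_of_ne_of_ne (Ne.symm y1z2) (Ne.symm y2z2),
      Equiv.swap_apply_of_ne_of_ne (Ne.symm x1z2) (Ne.symm x2z2)]
  have τZ₂ : τ Z₂ = Z₁ := by
    rw [hτ, Equiv.Perm.mul_apply, Equiv.Perm.mul_apply, Equiv.swap_apply_right,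
      Equiv.swap_apply_of_ne_of_ne (Ne.symm y1z1) z1y2,
      Equiv.swap_apply_of_ne_of_ne (Ne.symm x1z1) z1x2]
  have τoff : ∀ p : D.Passage, p ∉ [X₁, Y₁, Z₁, X₂, Y₂, Z₂] → τ p = p := by
    intro p hp
    simp only [List.mem_cons, List.not_mem_nil, or_false, not_or] at hp
    obtain ⟨h1, h2, h3, h4, h5, h6⟩ := hp
    rw [hτ, Equiv.Perm.mul_apply, Equiv.Perm.mul_apply, Equiv.swap_apply_of_ne_of_ne h3 h6,
      Equiv.swap_apply_of_ne_of_ne h2 h5, Equiv.swap_apply_of_ne_of_ne h1 h4]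
  have ττ : ∀ p, τ (τ p) = p := by
    intro p
    by_cases hp : p ∈ [X₁, Y₁, Z₁, X₂, Y₂, Z₂]
    · simp only [List.mem_cons, List.not_mem_nil, or_false] at hp
      rcases hp with h | h | h | h | h | h <;> rw [h]
      · rw [τX₁, τX₂]
      · rw [τY₁, τY₂]
      · rw [τZ₁, τZ₂]
      · rw [τX₂, τX₁]
      · rw [τY₂, τY₁]
      · rw [τZ₂, τZ₁]
    · rw [τoff p hp, τoff p hp]
  obtain ⟨a, x₀, x₂, hX⟩ := exists_piece D.succ x1x2 ox (by rw [hX₁, hX₂]; exact sX)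
  obtain ⟨b, y₀, y₂, hY⟩ := exists_piece D.succ y1y2 oy (by rw [hY₁, hY₂]; exact sY)
  obtain ⟨d, z₀, z₂, hZ⟩ := exists_piece D.succ z1z2 oz (by rw [hZ₁, hZ₂]; exact sZ)
  -- the generator of the overpass is read at an edge of the triangle before the move, and at an
  -- edge with the appropriate end after the move
  let χyz : Bool := if D.IsUnder Y₂ then !oz else !oy
  let χ : D.C → Bool := fun c => if c = xy then ox else if c = xz then !ox else
    if c = yz then χyz else true
  let χ' : D.C → Bool := fun c => if c = xy then !ox else if c = xz then ox else
    if c = yz then χyz else true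
  rw [Triangle.det_reindexed s t _ χ' τ (by rw [hτ, hX₁, hX₂, hY₁, hY₂, hZ₁, hZ₂]) ττ,
    det_relationAt s t D χ]
  have c1 : χ Y₁.1 = ox := by simp [χ, hY₁]
  have c2 : χ Z₁.1 = !ox := by simp [χ, hZ₁, n1.symm]
  have c3 : χ Y₂.1 = χyz := by simp [χ, hY₂, n2.symm, n3.symm]
  have c4 : χ Z₂.1 = χyz := by simp [χ, hZ₂, n2.symm, n3.symm]
  have c1' : χ' Y₁.1 = !ox := by simp [χ', hY₁]
  have c2' : χ' Z₁.1 = ox := by simp [χ', hZ₁, n1.symm]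
  have c3' : χ' Y₂.1 = χyz := by simp [χ', hY₂, n2.symm, n3.symm]
  have c4' : χ' Z₂.1 = χyz := by simp [χ', hZ₂, n2.symm, n3.symm]
  have coff : ∀ p : D.Passage, p ∉ [X₁, Y₁, Z₁, X₂, Y₂, Z₂] → χ p.1 = true ∧ χ' p.1 = true := by
    intro p hp
    obtain ⟨h1, h2, h3⟩ := (six p).mp hp
    simp [χ, χ', h1, h2, h3]
  have huX₁ : ¬ D.IsUnder X₁ := by
    rw [hX₁]
    rcases kinds with h | h
    · exact fun hu => kind_ne_virtual_of_isUnder hu h.1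
    · exact not_isUnder_of_withOver h.1
  have huX₂ : ¬ D.IsUnder X₂ := by
    rw [hX₂]
    rcases kinds with h | h
    · exact fun hu => kind_ne_virtual_of_isUnder hu h.2
    · exact not_isUnder_of_withOver h.2.1
  have hYZ : D.IsUnder Y₂ → ¬ D.IsUnder Z₂ := by
    intro hu
    rw [← oY₂, isUnder_opp (kind_ne_virtual_of_isUnder hu)]
    simpa using hu
  have hwY₁ : (D.kind xy = .virtual ∧ D.kind xz = .virtual) ∨
      (D.passUnit s t Y₁ = (if sxy then t else t⁻¹) ∧ D.passUnit s t Z₁ = (if sxz then t else t⁻¹)) := by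
    rcases kinds with h | h
    · exact Or.inl h
    · right; rw [hY₁, hZ₁]; exact ⟨passUnit_withOver s t h.1, passUnit_withOver s t h.2.1⟩
  have hA : endUnit oy (D.passUnit s t Y₁) = endUnit oz (D.passUnit s t Z₁) := by
    rcases hwY₁ with ⟨h1, h2⟩ | ⟨h1, h2⟩
    · rw [hY₁, hZ₁, passUnit_virtual s t h1, passUnit_virtual s t h2]
      clear * - fX
      cases oy <;> cases oz <;> cases sxy <;> cases sxz <;> simp_all [endUnit]
    · rw [h1, h2]
      clear * - fX
      cases oy <;> cases oz <;> cases sxy <;> cases sxz <;> simp_all [endUnit]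
  refine det_slide (w := D.passUnit s t) (u := fun p => (D.underUnit t p : K) - 1)
    (st := fun p => if χ p.1 then opp p else D.succ.symm (opp p)) hnd hX hY hZ τX₁ τX₂ τY₁ τY₂ τZ₁ τZ₂
    τoff (underUnit_of_not_isUnder t huX₁) (underUnit_of_not_isUnder t huX₂)
    ?_ ?_ ?_ ?_ ?_ ?_ ?_ ?_ ?_ ?_ hA ?_ ?_
  · simp only [c1, oY₁]; clear * - hX; grind
  · simp only [c2, oZ₁]; clear * - hX; grind
  · by_cases hu : D.IsUnder Y₂
    · right
      simp only [c3, oY₂, χyz, if_pos hu]; clear * - hZ; grind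
    · exact Or.inl (underUnit_of_not_isUnder t hu)
  · by_cases hu : D.IsUnder Y₂
    · exact Or.inl (underUnit_of_not_isUnder t (hYZ hu))
    · right
      simp only [c4, oZ₂, χyz, if_neg hu]; clear * - hY; grind
  · simp only [τY₂, c1', oY₁, τX₁]; clear * - hX; grind
  · simp only [τZ₂, c2', oZ₁, τX₂]; clear * - hX; grind
  · by_cases hu : D.IsUnder Y₂
    · right
      simp only [τY₁, c3', oY₂, τZ₂, χyz, if_pos hu]; clear * - hZ; grind
    · exact Or.inl (underUnit_of_not_isUnder t hu)
  · by_cases hu : D.IsUnder Y₂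
    · exact Or.inl (underUnit_of_not_isUnder t (hYZ hu))
    · right
      simp only [τZ₁, c4', oZ₂, τY₂, χyz, if_neg hu]; clear * - hY; grind
  · intro p hp
    have hop : opp p ∉ [X₁, Y₁, Z₁, X₂, Y₂, Z₂] := (six (opp p)).mpr ((six p).mp hp)
    simp only [τoff p hp, (coff p hp).1, (coff p hp).2, if_true, τoff _ hop]
  · intro p hp
    have hop : opp p ∉ [X₁, Y₁, Z₁, X₂, Y₂, Z₂] := (six (opp p)).mpr ((six p).mp hp)
    simp only [(coff p hp).1, if_true]
    simp only [List.mem_cons, List.not_mem_nil, or_false, not_or] at hop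
    clear * - hop hX hY hZ
    grind
  · rcases kinds with h | h
    · have h1 : ¬ D.IsUnder Y₁ := fun hu => kind_ne_virtual_of_isUnder hu (by rw [hY₁]; exact h.1)
      have h2 : ¬ D.IsUnder Z₁ := fun hu => kind_ne_virtual_of_isUnder hu (by rw [hZ₁]; exact h.2)
      simp only [underUnit_of_not_isUnder t h1, underUnit_of_not_isUnder t h2, overCoeff_zero]
    · have h1 : D.kind Y₁.1 ≠ .virtual := by rw [hY₁]; simp only [h.1]; exact withOver_ne_virtual _
      have h2 : D.kind Z₁.1 ≠ .virtual := by rw [hZ₁]; simp only [h.2.1]; exact withOver_ne_virtual _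
      simp only [underUnit_eq_passUnit s t h1, underUnit_eq_passUnit s t h2]
      have e1 := endUnit_add_overCoeff oy (D.passUnit s t Y₁)
      have e2 := endUnit_add_overCoeff oz (D.passUnit s t Z₁)
      rw [hA] at e1
      exact add_left_cancel (e1.trans e2.symm)
  · rcases kinds with h | h
    · left
      have h1 : ¬ D.IsUnder Y₁ := fun hu => kind_ne_virtual_of_isUnder hu (by rw [hY₁]; exact h.1)
      simp only [underUnit_of_not_isUnder t h1, overCoeff_zero]
    · right
      have h1 : D.kind Y₂.1 ≠ .virtual := by rw [hY₂]; simp only [h.2.2]; exact withOver_ne_virtual _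
      have h2 : D.kind Z₂.1 ≠ .virtual := by rw [hZ₂]; simp only [h.2.2]; exact withOver_ne_virtual _
      refine ⟨by rw [hX₁]; exact passUnit_over s t h.1, by rw [hX₂]; exact passUnit_over s t h.2.1,
        ?_, ?_⟩
      · simp only [underUnit_eq_passUnit s t h1]
      · simp only [underUnit_eq_passUnit s t h2]

theorem zeta_slide (T : D.Triangle) : T.slide.zeta s t = D.zeta s t := by
  have hc : T.slide.circles = D.circles := rfl
  unfold zeta
  rw [hc, det_relation_slide s t T]

end Slide

end Diagram

/-- A generalized Reidemeister move multiplies `zeta` by a power of `t`. -/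
theorem ReidemeisterMove.zeta_eq {K : Type*} [CommRing K] (s t : Kˣ) {D D' : VirtualDiagram}
    (h : ReidemeisterMove D D') :
    ∃ k : ℤ, D.1.zeta s t = ((t ^ k : Kˣ) : K) * D'.1.zeta s t := by
  cases h with
  | iso h => exact ⟨0, by rw [Diagram.zeta_iso s t h]; simp⟩
  | first c hc h => exact Diagram.zeta_curl s t hc h
  | second c d hcd h => exact ⟨0, by rw [Diagram.zeta_bigon s t hcd h]; simp⟩
  | third T h => exact ⟨0, by rw [h, Diagram.zeta_slide]; simp⟩

theorem VirtualLink.zeta_eq {K : Type*} [CommRing K] (s t : Kˣ) {D D' : Diagram} {h : D.IsPlanar}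
    {h' : D'.IsPlanar} (hL : VirtualLink.of D h = VirtualLink.of D' h') :
    ∃ k : ℤ, D.zeta s t = ((t ^ k : Kˣ) : K) * D'.zeta s t := by
  have key : ∀ A B : VirtualDiagram, Relation.EqvGen ReidemeisterMove A B →
      ∃ k : ℤ, A.1.zeta s t = ((t ^ k : Kˣ) : K) * B.1.zeta s t := by
    intro A B hAB
    induction hAB with
    | rel A B h => exact h.zeta_eq s t
    | refl A => exact ⟨0, by simp⟩
    | symm A B _ ih =>
      obtain ⟨k, hk⟩ := ih
      refine ⟨-k, ?_⟩
      rw [hk, ← mul_assoc, ← Units.val_mul, ← zpow_add]; simp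
    | trans A B C _ _ ih₁ ih₂ =>
      obtain ⟨k, hk⟩ := ih₁
      obtain ⟨l, hl⟩ := ih₂
      refine ⟨k + l, ?_⟩
      rw [hk, hl, ← mul_assoc, ← Units.val_mul, ← zpow_add]
  exact key ⟨D, h⟩ ⟨D', h'⟩ (Quot.eqvGen_exact hL)

namespace Diagram

/-! ### Long arcs of special diagrams -/

section LongArcs

variable (D : Diagram)

theorem underpass_injective : Function.Injective D.underpass := fun _ _ h =>
  Subtype.ext (congrArg Prod.fst h)

theorem isUnder_iff {p : D.Passage} : D.IsUnder p ↔ ∃ v, D.underpass v = p := by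
  constructor
  · intro h
    refine ⟨⟨p.1, kind_ne_virtual_of_isUnder h⟩, ?_⟩
    obtain ⟨c, b⟩ := p
    rcases h with ⟨h1, h2⟩ | ⟨h1, h2⟩
    · simp only at h1 h2; simp [underpass, h1, h2]
    · simp only at h1 h2; simp [underpass, h1, h2]
  · rintro ⟨v, rfl⟩; exact D.isUnder_underpass v

theorem overpass_eq (v : D.Classical) : D.overpass v = opp (D.underpass v) := by
  obtain ⟨c, hc⟩ := v
  cases h : D.kind c <;> simp_all [overpass, underpass, opp]

theorem not_isUnder_overpass (v : D.Classical) : ¬ D.IsUnder (D.overpass v) := by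
  rw [overpass_eq, isUnder_opp (kind_ne_virtual_of_isUnder (D.isUnder_underpass v))]
  simpa using D.isUnder_underpass v

@[simp] theorem passage_zero (v : D.Classical) : D.passage v 0 = D.underpass v := rfl

theorem passage_succ (v : D.Classical) (k : ℕ) :
    D.passage v (k + 1) = D.succ (D.passage v k) := by
  simp [passage, pow_succ', Equiv.Perm.mul_apply]

theorem length_pos (v : D.Classical) : 0 < D.length v := (Nat.find_spec (D.exists_isUnder_passage v)).1

theorem isUnder_passage_length (v : D.Classical) : D.IsUnder (D.passage v (D.length v)) :=
  (Nat.find_spec (D.exists_isUnder_passage v)).2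

theorem not_isUnder_passage {v : D.Classical} {k : ℕ} (h0 : 0 < k) (hk : k < D.length v) :
    ¬ D.IsUnder (D.passage v k) := fun h => Nat.find_min (D.exists_isUnder_passage v) hk ⟨h0, h⟩

theorem lt_length {v : D.Classical} {k : ℕ}
    (h : ∀ j, 0 < j → j ≤ k → ¬ D.IsUnder (D.passage v j)) : k < D.length v := by
  by_contra hcon
  exact h _ (D.length_pos v) (not_lt.mp hcon) (D.isUnder_passage_length v)

theorem passage_inj {v w : D.Classical} {k l : ℕ} (hk : k < D.length v) (hl : l < D.length w)
    (h : D.passage v k = D.passage w l) : v = w ∧ k = l := by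
  have key : ∀ {v w : D.Classical} {k l : ℕ}, l < D.length w → k ≤ l →
      D.passage v k = D.passage w l → v = w ∧ k = l := by
    intro v w k l hl hkl h
    obtain ⟨m, rfl⟩ := Nat.exists_eq_add_of_le hkl
    have h' : D.underpass v = D.passage w m := by
      unfold passage at h
      rw [pow_add, Equiv.Perm.mul_apply] at h
      exact (D.succ ^ k).injective h
    rcases Nat.eq_zero_or_pos m with rfl | hm
    · exact ⟨D.underpass_injective h', rfl⟩
    · exact absurd (h' ▸ D.isUnder_underpass v) (D.not_isUnder_passage hm (by omega))
  rcases le_total k l with h1 | h1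
  · exact key hl h1 h
  · obtain ⟨h2, h3⟩ := key hk h1 h.symm
    exact ⟨h2.symm, h3.symm⟩

/-- The number of increasing virtual passages among the first `k` passages of a long arc. -/
def incCount (v : D.Classical) (k : ℕ) : ℕ :=
  ((Finset.Icc 1 k).filter fun i => D.shift (D.passage v i) = 1).card

/-- The number of decreasing virtual passages among the first `k` passages of a long arc. -/
def decCount (v : D.Classical) (k : ℕ) : ℕ :=
  ((Finset.Icc 1 k).filter fun i => D.shift (D.passage v i) = -1).card

theorem incCount_mono (v : D.Classical) {k l : ℕ} (h : k ≤ l) : D.incCount v k ≤ D.incCount v l :=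
  Finset.card_le_card (Finset.filter_subset_filter _ (Finset.Icc_subset_Icc_right h))

theorem decCount_mono (v : D.Classical) {k l : ℕ} (h : k ≤ l) : D.decCount v k ≤ D.decCount v l :=
  Finset.card_le_card (Finset.filter_subset_filter _ (Finset.Icc_subset_Icc_right h))

theorem incCount_succ (v : D.Classical) (k : ℕ) : D.incCount v (k + 1) = D.incCount v k +
    if D.shift (D.passage v (k + 1)) = 1 then 1 else 0 := by
  unfold incCount
  rw [Finset.card_filter, Finset.card_filter, Finset.sum_Icc_succ_top (by omega)]

theorem decCount_succ (v : D.Classical) (k : ℕ) : D.decCount v (k + 1) = D.decCount v k +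
    if D.shift (D.passage v (k + 1)) = -1 then 1 else 0 := by
  unfold decCount
  rw [Finset.card_filter, Finset.card_filter, Finset.sum_Icc_succ_top (by omega)]

theorem shift_cases (p : D.Passage) :
    (D.kind p.1 = .virtual ∧ (D.shift p = 1 ∨ D.shift p = -1)) ∨
    (D.kind p.1 ≠ .virtual ∧ D.shift p = 0) := by
  unfold shift; split_ifs with h1 h2 <;> simp [h1]

theorem arcIndex_eq (v : D.Classical) (k : ℕ) :
    D.arcIndex v k = D.incCount v k + D.decCount v k := by
  induction k with
  | zero => simp [arcIndex, incCount, decCount]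
  | succ k ih =>
    rw [incCount_succ, decCount_succ]
    unfold arcIndex at ih ⊢
    rw [Finset.card_filter, Finset.sum_Icc_succ_top (by omega), ← Finset.card_filter, ih]
    rcases D.shift_cases (D.passage v (k + 1)) with ⟨h1, h2 | h2⟩ | ⟨h1, h2⟩ <;>
      simp [h1, h2] <;> omega

theorem degree_eq (v : D.Classical) (k : ℕ) :
    D.degree v k = (D.incCount v k : ℤ) - D.decCount v k := by
  induction k with
  | zero => simp [degree, incCount, decCount]
  | succ k ih =>
    rw [incCount_succ, decCount_succ]
    unfold degree at ih ⊢
    rw [Finset.sum_Icc_succ_top (by omega), ih]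
    rcases D.shift_cases (D.passage v (k + 1)) with ⟨h1, h2 | h2⟩ | ⟨h1, h2⟩ <;>
      simp [h2] <;> omega

theorem numIncreasing_eq (v : D.Classical) :
    D.numIncreasing v = D.incCount v (D.length v - 1) := by
  unfold numIncreasing incCount
  congr 2

/-- A local description of the long arcs of a special diagram: the edge starting at the passage `p`
is the edge number `pos p` of the long arc emanating from `own p`, it is preceded there by `inc p`
increasing and `dec p` decreasing virtual passages, and `top v` is the total number of
increasing passages on the long arc emanating from `v`. That the number of increasing passages reaches
this value before any decreasing passage means that the diagram is special. The counts are
integers, so that they can be subtracted. -/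
structure Labelling where
  own : D.Passage → D.Classical
  pos : D.Passage → ℕ
  inc : D.Passage → ℤ
  dec : D.Passage → ℤ
  top : D.Classical → ℤ
  under : ∀ v, own (D.underpass v) = v ∧ pos (D.underpass v) = 0 ∧ inc (D.underpass v) = 0 ∧
    dec (D.underpass v) = 0
  step : ∀ p, ¬ D.IsUnder (D.succ p) → own (D.succ p) = own p ∧ pos (D.succ p) = pos p + 1 ∧
    inc (D.succ p) = inc p + (if D.shift (D.succ p) = 1 then 1 else 0) ∧
    dec (D.succ p) = dec p + (if D.shift (D.succ p) = -1 then 1 else 0)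
  inc_le : ∀ p, inc p ≤ top (own p)
  exists_crit : ∀ v, ∃ p, own p = v ∧ inc p = top v ∧ dec p = 0

namespace Labelling

variable {D} (ℓ : D.Labelling)

/-- The edge starting at `p` belongs to the critical arc of the long arc emanating from `w`. -/
def Crit (w : D.Classical) (p : D.Passage) : Prop := ℓ.own p = w ∧ ℓ.inc p = ℓ.top w ∧ ℓ.dec p = 0

theorem passage_label {v : D.Classical} {k : ℕ} (hk : k < D.length v) :
    ℓ.own (D.passage v k) = v ∧ ℓ.pos (D.passage v k) = k ∧
      ℓ.inc (D.passage v k) = D.incCount v k ∧ ℓ.dec (D.passage v k) = D.decCount v k := by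
  induction k with
  | zero =>
    obtain ⟨h1, h2, h3, h4⟩ := ℓ.under v
    simp [h1, h2, h3, h4, incCount, decCount]
  | succ k ih =>
    obtain ⟨h1, h2, h3, h4⟩ := ih (by omega)
    have hu := D.not_isUnder_passage (Nat.succ_pos k) hk
    rw [Nat.succ_eq_add_one, passage_succ] at hu
    obtain ⟨g1, g2, g3, g4⟩ := ℓ.step _ hu
    rw [incCount_succ, decCount_succ, passage_succ, g1, g2, g3, g4, h1, h2, h3, h4]
    simp

theorem passage_own_pos (p : D.Passage) :
    D.passage (ℓ.own p) (ℓ.pos p) = p ∧ ℓ.pos p < D.length (ℓ.own p) := by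
  generalize hn : ℓ.pos p = n
  induction n generalizing p with
  | zero =>
    by_cases hu : D.IsUnder p
    · obtain ⟨v, rfl⟩ := D.isUnder_iff.mp hu
      rw [(ℓ.under v).1]
      exact ⟨rfl, D.length_pos v⟩
    · obtain ⟨q, rfl⟩ := D.succ.surjective p
      have := (ℓ.step q hu).2.1
      omega
  | succ n ih =>
    by_cases hu : D.IsUnder p
    · obtain ⟨v, rfl⟩ := D.isUnder_iff.mp hu
      have := (ℓ.under v).2.1
      omega
    · obtain ⟨q, rfl⟩ := D.succ.surjective p
      obtain ⟨h1, h2, -, -⟩ := ℓ.step q hu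
      obtain ⟨g1, g2⟩ := ih q (by omega)
      have e : D.passage (ℓ.own (D.succ q)) (n + 1) = D.succ q := by rw [h1, passage_succ, g1]
      refine ⟨e, D.lt_length fun j hj0 hj => ?_⟩
      rcases Nat.lt_or_ge j (n + 1) with h | h
      · rw [h1]; exact D.not_isUnder_passage hj0 (by omega)
      · rw [le_antisymm hj h, e]; exact hu

theorem exists_passage (p : D.Passage) : ∃ k < D.length (ℓ.own p), D.passage (ℓ.own p) k = p :=
  ⟨ℓ.pos p, (ℓ.passage_own_pos p).2, (ℓ.passage_own_pos p).1⟩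

theorem inc_nonneg (p : D.Passage) : 0 ≤ ℓ.inc p := by
  obtain ⟨k, hk, h⟩ := ℓ.exists_passage p
  rw [← h, (ℓ.passage_label hk).2.2.1]; positivity

theorem dec_nonneg (p : D.Passage) : 0 ≤ ℓ.dec p := by
  obtain ⟨k, hk, h⟩ := ℓ.exists_passage p
  rw [← h, (ℓ.passage_label hk).2.2.2]; positivity

theorem inc_mono {p q : D.Passage} (h : ℓ.own p = ℓ.own q) (hpq : ℓ.pos p ≤ ℓ.pos q) :
    ℓ.inc p ≤ ℓ.inc q ∧ ℓ.dec p ≤ ℓ.dec q := by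
  obtain ⟨h1, h2⟩ := ℓ.passage_own_pos p
  obtain ⟨g1, g2⟩ := ℓ.passage_own_pos q
  have e1 := (ℓ.passage_label h2).2.2
  have e2 := (ℓ.passage_label g2).2.2
  rw [h1] at e1
  rw [g1] at e2
  rw [e1.1, e1.2, e2.1, e2.2, h]
  exact ⟨by exact_mod_cast D.incCount_mono _ hpq, by exact_mod_cast D.decCount_mono _ hpq⟩

theorem numIncreasing_eq_top (v : D.Classical) : (D.numIncreasing v : ℤ) = ℓ.top v := by
  have hlen := D.length_pos v
  have hl : D.length v - 1 < D.length v := by omega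
  obtain ⟨h1, h2, h3, -⟩ := ℓ.passage_label hl
  rw [numIncreasing_eq, ← h3]
  refine le_antisymm ((ℓ.inc_le _).trans (by rw [h1])) ?_
  obtain ⟨p, hp1, hp2, -⟩ := ℓ.exists_crit v
  rw [← hp2]
  refine (ℓ.inc_mono (by rw [h1, hp1]) ?_).1
  rw [h2]
  have := (ℓ.passage_own_pos p).2
  rw [hp1] at this
  omega

/-- Behind the critical arc nothing increases, and before it nothing decreases. -/
theorem inc_eq_top_or_dec_eq_zero (p : D.Passage) : ℓ.inc p = ℓ.top (ℓ.own p) ∨ ℓ.dec p = 0 := by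
  obtain ⟨q, hq1, hq2, hq3⟩ := ℓ.exists_crit (ℓ.own p)
  rcases le_total (ℓ.pos p) (ℓ.pos q) with h | h
  · right
    exact le_antisymm (((ℓ.inc_mono hq1.symm h).2).trans hq3.le) (ℓ.dec_nonneg p)
  · left
    exact le_antisymm (ℓ.inc_le p) (hq2.symm.le.trans (ℓ.inc_mono hq1 h).1)

theorem arcIndex_eq_iff {w : D.Classical} {k : ℕ} (hk : k < D.length w) :
    D.arcIndex w k = D.numIncreasing w ↔ ℓ.Crit w (D.passage w k) := by
  obtain ⟨h1, h2, h3, h4⟩ := ℓ.passage_label hk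
  have h5 := ℓ.numIncreasing_eq_top w
  have h6 := ℓ.inc_eq_top_or_dec_eq_zero (D.passage w k)
  have h7 := ℓ.inc_le (D.passage w k)
  rw [h1] at h6 h7
  unfold Crit
  rw [arcIndex_eq]
  constructor
  · intro h; refine ⟨h1, ?_, ?_⟩ <;> omega
  · rintro ⟨-, h8, h9⟩; omega

theorem isSpecial (ℓ : D.Labelling) : D.IsSpecial := by
  intro v
  obtain ⟨p, hp⟩ := ℓ.exists_crit v
  obtain ⟨k, hk, hkp⟩ := ℓ.exists_passage p
  rw [hp.1] at hk hkp
  refine ⟨k, hk, (ℓ.arcIndex_eq_iff hk).mpr (by rw [hkp]; exact hp), ?_⟩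
  obtain ⟨h1, h2, h3, h4⟩ := ℓ.passage_label hk
  rw [degree_eq, ← h3, ← h4, hkp, hp.2.1, hp.2.2, ℓ.numIncreasing_eq_top, sub_zero]

theorem isProper (ℓ : D.Labelling) (hc : D.circles = 0) : D.IsProper := by
  refine ⟨hc, fun p => ?_⟩
  obtain ⟨k, hk, hkp⟩ := ℓ.exists_passage p
  exact ⟨ℓ.own p, (k : ℤ), by rw [zpow_natCast]; exact hkp⟩

theorem emanates_iff (v w : D.Classical) :
    D.Emanates v w (D.numIncreasing w) ↔ ℓ.Crit w (D.underpass v) := by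
  obtain ⟨h1, h2, h3, h4⟩ := ℓ.under v
  have := ℓ.numIncreasing_eq_top w
  unfold Emanates Crit
  rw [h1, h3, h4]
  constructor
  · rintro ⟨rfl, h⟩; exact ⟨rfl, by omega, rfl⟩
  · rintro ⟨rfl, h, -⟩; exact ⟨rfl, by omega⟩

theorem passesThrough_iff (v w : D.Classical) :
    D.PassesThrough v w (D.numIncreasing w) ↔ ℓ.Crit w (D.overpass v) := by
  constructor
  · rintro ⟨k, hk, h1, h2⟩
    rw [Finset.mem_Ico] at hk
    rw [← h1]; exact (ℓ.arcIndex_eq_iff hk.2).mp h2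
  · intro h
    obtain ⟨k, hk, hkp⟩ := ℓ.exists_passage (D.overpass v)
    rw [h.1] at hk hkp
    refine ⟨k, Finset.mem_Ico.mpr ⟨?_, hk⟩, hkp, (ℓ.arcIndex_eq_iff hk).mpr (by rw [hkp]; exact h)⟩
    by_contra h0
    have : k = 0 := by omega
    rw [this, passage_zero] at hkp
    exact D.not_isUnder_overpass v (hkp ▸ D.isUnder_underpass w)

theorem length_own_pred_underpass (ℓ : D.Labelling) (v : D.Classical) :
    D.length (ℓ.own (D.succ.symm (D.underpass v))) = ℓ.pos (D.succ.symm (D.underpass v)) + 1 := by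
  obtain ⟨h1, h2⟩ := ℓ.passage_own_pos (D.succ.symm (D.underpass v))
  have h3 : D.passage (ℓ.own (D.succ.symm (D.underpass v)))
      (ℓ.pos (D.succ.symm (D.underpass v)) + 1) = D.underpass v := by
    rw [passage_succ, h1, Equiv.apply_symm_apply]
  by_contra hne
  exact D.not_isUnder_passage (Nat.succ_pos _) (by omega) (h3 ▸ D.isUnder_underpass v)

theorem pos_le_pos_pred_underpass (ℓ : D.Labelling) {v : D.Classical} {p : D.Passage}
    (h : ℓ.own p = ℓ.own (D.succ.symm (D.underpass v))) :
    ℓ.pos p ≤ ℓ.pos (D.succ.symm (D.underpass v)) := by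
  have h1 := (ℓ.passage_own_pos p).2
  rw [h, length_own_pred_underpass] at h1
  omega

theorem own_pred_underpass (ℓ : D.Labelling) (v w : D.Classical) :
    ℓ.own (D.succ.symm (D.underpass v)) = w ↔ D.passage w (D.length w) = D.underpass v := by
  have hlen : ∀ w, D.succ (D.passage w (D.length w - 1)) = D.passage w (D.length w) := by
    intro w
    have := D.length_pos w
    rw [← passage_succ]; congr 1; omega
  constructor
  · rintro rfl
    rw [length_own_pred_underpass, passage_succ, (ℓ.passage_own_pos _).1, Equiv.apply_symm_apply]
  · intro h
    rw [← h, ← hlen, Equiv.symm_apply_apply]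
    have := D.length_pos w
    exact (ℓ.passage_label (by omega)).1

theorem comesInto_iff (v w : D.Classical) :
    D.ComesInto v w (D.numIncreasing w) ↔ ℓ.Crit w (D.succ.symm (D.underpass v)) := by
  have hlen := D.length_pos w
  have hl : D.length w - 1 < D.length w := by omega
  have hp : D.passage w (D.length w) = D.underpass v →
      D.succ.symm (D.underpass v) = D.passage w (D.length w - 1) := by
    intro h
    rw [← h, Equiv.symm_apply_eq, ← passage_succ]; congr 1; omega
  constructor
  · rintro ⟨h1, h2⟩
    rw [hp h1]; exact (ℓ.arcIndex_eq_iff hl).mp h2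
  · intro h
    have h1 := (ℓ.own_pred_underpass v w).mp h.1
    refine ⟨h1, (ℓ.arcIndex_eq_iff hl).mpr ?_⟩
    rw [← hp h1]; exact h

theorem incidentCritical_iff (v w : D.Classical) : D.IncidentCritical v w ↔
    ℓ.Crit w (D.underpass v) ∨ ℓ.Crit w (D.overpass v) ∨
      ℓ.Crit w (D.succ.symm (D.underpass v)) := by
  rw [IncidentCritical, ℓ.emanates_iff, ℓ.passesThrough_iff, ℓ.comesInto_iff]

open Classical in
theorem tMatrix_apply (v w : D.Classical) : D.tMatrix v w =
    (if ℓ.Crit w (D.underpass v) then 1 else 0) +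
    (if ℓ.Crit w (D.overpass v) then LaurentPolynomial.T (D.kind v.1).sign - 1 else 0) +
    (if ℓ.Crit w (D.succ.symm (D.underpass v)) then -LaurentPolynomial.T (D.kind v.1).sign
      else 0) := by
  simp only [tMatrix, Matrix.of_apply, incidenceCoeff, ℓ.emanates_iff, ℓ.passesThrough_iff,
    ℓ.comesInto_iff]

theorem edgeOfType_iff (κ : SumType) (v : D.Classical) (e : D.Passage) :
    D.EdgeOfType κ v e ↔ ℓ.own e = v ∧ match κ with
      | SumType.preCritical => ℓ.inc e < ℓ.top v
      | SumType.postCritical => 0 < ℓ.dec e := by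
  have key : ∀ k < D.length v, D.passage v k = e →
      ((match κ with
        | SumType.preCritical => D.arcIndex v k < D.numIncreasing v
        | SumType.postCritical => D.numIncreasing v < D.arcIndex v k) ↔
      match κ with
      | SumType.preCritical => ℓ.inc e < ℓ.top v
      | SumType.postCritical => 0 < ℓ.dec e) := by
    rintro k hk rfl
    obtain ⟨h1, h2, h3, h4⟩ := ℓ.passage_label hk
    have h5 := ℓ.numIncreasing_eq_top v
    have h6 := ℓ.inc_eq_top_or_dec_eq_zero (D.passage v k)
    have h7 := ℓ.inc_le (D.passage v k)
    rw [h1] at h6 h7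
    rw [arcIndex_eq]
    cases κ <;> simp only <;> omega
  constructor
  · rintro ⟨k, hk, h1, h2⟩
    exact ⟨by rw [← h1]; exact (ℓ.passage_label hk).1, (key k hk h1).mp h2⟩
  · rintro ⟨rfl, h⟩
    obtain ⟨k, hk, hkp⟩ := ℓ.exists_passage e
    exact ⟨k, hk, hkp, (key k hk hkp).mpr h⟩

/-- A crossing is cyclic if and only if the long arc emanating from it passes over it and comes back into
it, without a virtual passage. -/
theorem isCyclicCrossing_iff (v : D.Classical) : D.IsCyclicCrossing v ↔
    ℓ.own (D.overpass v) = v ∧ ℓ.own (D.succ.symm (D.underpass v)) = v ∧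
    ℓ.inc (D.succ.symm (D.underpass v)) = 0 ∧ ℓ.dec (D.succ.symm (D.underpass v)) = 0 := by
  have hlen := D.length_pos v
  have hl : D.length v - 1 < D.length v := by omega
  have hp : D.passage v (D.length v) = D.underpass v →
      D.succ.symm (D.underpass v) = D.passage v (D.length v - 1) := by
    intro h
    rw [← h, Equiv.symm_apply_eq, ← passage_succ]; congr 1; omega
  obtain ⟨h1, h2, h3, h4⟩ := ℓ.passage_label hl
  have hidx := D.arcIndex_eq v (D.length v - 1)
  constructor
  · rintro ⟨w, μ, ⟨rfl, rfl⟩, ⟨k, hk, hk1, hk2⟩, hc1, hc2⟩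
    rw [Finset.mem_Ico] at hk
    refine ⟨by rw [← hk1]; exact (ℓ.passage_label hk.2).1, ?_⟩
    rw [hp hc1]
    refine ⟨h1, ?_, ?_⟩ <;> omega
  · rintro ⟨g1, g2, g3, g4⟩
    have hc := (ℓ.own_pred_underpass v v).mp g2
    rw [hp hc] at g3 g4
    obtain ⟨k, hk, hkp⟩ := ℓ.exists_passage (D.overpass v)
    rw [g1] at hk hkp
    refine ⟨v, 0, ⟨rfl, rfl⟩, ⟨k, Finset.mem_Ico.mpr ⟨?_, hk⟩, hkp, ?_⟩, hc, by omega⟩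
    · by_contra h0
      have : k = 0 := by omega
      rw [this, passage_zero] at hkp
      exact D.not_isUnder_overpass v (hkp ▸ D.isUnder_underpass v)
    · have e1 := D.incCount_mono v (show k ≤ D.length v - 1 by omega)
      have e2 := D.decCount_mono v (show k ≤ D.length v - 1 by omega)
      rw [arcIndex_eq]; omega

end Labelling

/-- Conversely, the long arcs of a proper special diagram provide such a description. -/
theorem exists_labelling (hp : D.IsProper) (hs : D.IsSpecial) : Nonempty D.Labelling := by
  classical
  have hex : ∀ p : D.Passage, ∃ (v : D.Classical) (k : ℕ), k < D.length v ∧ D.passage v k = p := by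
    intro p
    have hex : ∃ k : ℕ, D.IsUnder ((D.succ⁻¹ ^ k) p) := by
      obtain ⟨v, hv⟩ := hp.2 p
      obtain ⟨k, hk⟩ := hv.exists_nat_pow_eq
      refine ⟨k, ?_⟩
      rw [← hk, ← Equiv.Perm.mul_apply, inv_pow, inv_mul_cancel]
      exact D.isUnder_underpass v
    obtain ⟨v, hv⟩ := D.isUnder_iff.mp (Nat.find_spec hex)
    have hpass : ∀ j ≤ Nat.find hex, D.passage v j = (D.succ⁻¹ ^ (Nat.find hex - j)) p := by
      intro j hj
      rw [passage, hv, ← Equiv.Perm.mul_apply]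
      congr 1
      obtain ⟨m, hm⟩ := Nat.exists_eq_add_of_le hj
      rw [hm, Nat.add_sub_cancel_left, inv_pow, inv_pow, pow_add, mul_inv_rev]
      rw [← mul_assoc, (Commute.pow_pow_self D.succ j m).inv_right.eq, mul_assoc, mul_inv_cancel,
        mul_one]
    refine ⟨v, Nat.find hex, D.lt_length fun j hj0 hj => ?_, by rw [hpass _ le_rfl]; simp⟩
    rw [hpass j hj]
    exact Nat.find_min hex (by omega)
  choose own pos hlt hpass using hex
  have huniq : ∀ {v k}, k < D.length v → own (D.passage v k) = v ∧ pos (D.passage v k) = k := by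
    intro v k hk
    exact D.passage_inj (hlt _) hk (hpass _)
  refine ⟨{ own := own, pos := pos, inc := fun p => D.incCount (own p) (pos p),
            dec := fun p => D.decCount (own p) (pos p), top := fun v => D.numIncreasing v,
            under := fun v => ?_, step := fun p hu => ?_, inc_le := fun p => ?_,
            exists_crit := fun v => ?_ }⟩
  · obtain ⟨h1, h2⟩ := huniq (D.length_pos v)
    rw [passage_zero] at h1 h2
    simp [h1, h2, incCount, decCount]
  · have hlt' : pos p + 1 < D.length (own p) := by
      refine D.lt_length fun j hj0 hj => ?_
      rcases Nat.lt_or_ge j (pos p + 1) with h | h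
      · exact D.not_isUnder_passage hj0 (by have := hlt p; omega)
      · rw [le_antisymm hj h, passage_succ, hpass]; exact hu
    obtain ⟨h1, h2⟩ := huniq hlt'
    have e : D.passage (own p) (pos p + 1) = D.succ p := by rw [passage_succ, hpass]
    rw [e] at h1 h2
    rw [h1, h2, incCount_succ, decCount_succ, e]
    simp
  · have := D.numIncreasing_eq (own p)
    have h2 := D.incCount_mono (own p) (show pos p ≤ D.length (own p) - 1 by have := hlt p; omega)
    omega
  · obtain ⟨k, hk, h1, h2⟩ := hs v
    obtain ⟨g1, g2⟩ := huniq hk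
    refine ⟨D.passage v k, g1, ?_, ?_⟩
    · simp only [g1, g2]
      rw [arcIndex_eq] at h1; rw [degree_eq] at h2; omega
    · simp only [g1, g2]
      rw [arcIndex_eq] at h1; rw [degree_eq] at h2; omega

end LongArcs

end Diagram

namespace LaurentPolynomial

/-- The variable of a ring of Laurent polynomials, as a unit. -/
noncomputable def unitT (R : Type*) [CommRing R] : R[T;T⁻¹]ˣ where
  val := T 1
  inv := T (-1)
  val_inv := by rw [← T_add]; simp
  inv_val := by rw [← T_add]; simp

theorem coe_unitT_zpow (R : Type*) [CommRing R] (n : ℤ) :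
    ((unitT R ^ n : R[T;T⁻¹]ˣ) : R[T;T⁻¹]) = T n := by
  induction n with
  | zero => simp
  | succ n ih => rw [zpow_add_one, Units.val_mul, ih, T_add]; rfl
  | pred n ih =>
    rw [zpow_sub_one, Units.val_mul, ih, sub_eq_add_neg, T_add]; rfl

end LaurentPolynomial

namespace Diagram

/-! ### The coefficient of the highest power of `s` -/

section Leading

variable (D : Diagram)

/-- The ring in which the degree in `s` is measured: Laurent polynomials in `s` over the Laurent
polynomials in `t`. -/
abbrev DoubleLaurent : Type := LaurentPolynomial (ℤ[T;T⁻¹])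

/-- The variable `s`. -/
noncomputable abbrev varS : DoubleLaurentˣ := LaurentPolynomial.unitT _

/-- The variable `t`. -/
noncomputable abbrev varT : DoubleLaurentˣ :=
  Units.map (LaurentPolynomial.C : ℤ[T;T⁻¹] →+* DoubleLaurent).toMonoidHom (LaurentPolynomial.unitT ℤ)

theorem coe_varT_zpow (n : ℤ) :
    ((varT ^ n : DoubleLaurentˣ) : DoubleLaurent) = LaurentPolynomial.C (LaurentPolynomial.T n) := by
  rw [← LaurentPolynomial.coe_unitT_zpow, ← map_zpow]; rfl

/-- Each virtual crossing has exactly one increasing passage. -/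
theorem card_shift_eq_one : (Finset.univ.filter fun p : D.Passage => D.shift p = 1).card =
    D.numVirtual := by
  rw [numVirtual, Fintype.card_subtype]
  symm
  refine Finset.card_bij (fun c _ => (c, true)) ?_ ?_ ?_
  · intro c hc
    rw [Finset.mem_filter] at hc ⊢
    simp [shift, hc.2]
  · intro a _ b _ h; exact congrArg Prod.fst h
  · rintro ⟨c, b⟩ h
    rw [Finset.mem_filter] at h
    have h2 := h.2
    unfold shift at h2
    split_ifs at h2 with h3 h4
    · exact ⟨c, by simpa using h3, by simpa using h4.symm⟩
    · exact absurd h2 (by norm_num)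

theorem hasTop_relation (p q : D.Passage) : ∃ r, HasTop (D.relation varS varT p q)
    (if D.shift p = 1 then 1 else 0) r := by
  have key : ∀ (n : ℤ) (r : ℤ[T;T⁻¹]) (P : Prop) [Decidable P], (P → n ≤ if D.shift p = 1 then 1 else 0) →
      ∃ r', HasTop (if P then LaurentPolynomial.C r * LaurentPolynomial.T n else 0)
      (if D.shift p = 1 then 1 else 0) r' := by
    intro n r P _ h
    by_cases hP : P
    · rw [if_pos hP]; exact ⟨_, .C_mul_T r (h hP)⟩
    · rw [if_neg hP]; exact ⟨_, .zero _⟩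
  obtain ⟨u, hu⟩ : ∃ u : ℤ[T;T⁻¹], (D.underUnit varT p : DoubleLaurent) = LaurentPolynomial.C u := by
    unfold underUnit
    split_ifs
    · exact ⟨_, coe_varT_zpow _⟩
    · exact ⟨1, by simp⟩
  obtain ⟨r1, h1⟩ := key 0 1 (q = p) (fun _ => by split_ifs <;> norm_num)
  obtain ⟨r2, h2⟩ := key (D.shift p) u (q = D.succ.symm p)
    (fun _ => by rcases D.shift_cases p with ⟨-, h | h⟩ | ⟨-, h⟩ <;> simp [h])
  obtain ⟨r3, h3⟩ := key 0 (u - 1) (q = opp p) (fun _ => by split_ifs <;> norm_num)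
  refine ⟨r1 - r2 + r3, ?_⟩
  have := (h1.sub h2).add h3
  convert this using 1
  simp only [relation, Pi.add_apply, Pi.sub_apply, Pi.smul_apply, Pi.single_apply, smul_eq_mul,
    Units.val_mul, hu, LaurentPolynomial.coe_unitT_zpow, map_sub, map_one, LaurentPolynomial.T_zero,
    mul_one, mul_ite, mul_zero, mul_comm (LaurentPolynomial.T (D.shift p))]

/-- The degree of `zeta` in `s` is at most the number of virtual crossings: each virtual crossing
contributes one row of degree `1`. -/
theorem coeff_zeta_eq_zero {k : ℤ} (hk : (D.numVirtual : ℤ) < k) :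
    (D.zeta varS varT).coeff k = 0 := by
  unfold zeta
  split_ifs
  · choose A hA using D.hasTop_relation
    have := HasTop.det (M := (Matrix.of (D.relation varS varT)).transpose)
      (d := fun p => if D.shift p = 1 then 1 else 0) (A := Matrix.of fun q p => A p q)
      (fun i j => hA j i)
    rw [Matrix.det_transpose] at this
    apply this.2
    rw [← card_shift_eq_one, Finset.card_filter] at hk
    exact_mod_cast hk
  · simp

namespace Labelling

variable {D} (ℓ : D.Labelling)

theorem top_eq_card (w : D.Classical) :
    ℓ.top w = (Finset.univ.filter fun p : D.Passage => D.shift p = 1 ∧ ℓ.own p = w).card := by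
  classical
  rw [← ℓ.numIncreasing_eq_top]
  congr 1
  unfold numIncreasing
  refine Finset.card_bij (fun i _ => D.passage w i) ?_ ?_ ?_
  · intro i hi
    simp only [Finset.mem_filter, Finset.mem_Ico] at hi
    simp [hi.2, (ℓ.passage_label hi.1.2).1]
  · intro i hi j hj h
    simp only [Finset.mem_filter, Finset.mem_Ico] at hi hj
    exact (D.passage_inj hi.1.2 hj.1.2 h).2
  · intro p hp
    simp only [Finset.mem_filter, Finset.mem_univ, true_and] at hp
    obtain ⟨k, hk, hkp⟩ := ℓ.exists_passage p
    rw [hp.2] at hk hkp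
    refine ⟨k, ?_, hkp⟩
    simp only [Finset.mem_filter, Finset.mem_Ico]
    refine ⟨⟨?_, hk⟩, by rw [hkp]; exact hp.1⟩
    by_contra h0
    have : k = 0 := by omega
    rw [this, passage_zero] at hkp
    have h1 := hp.1
    rw [← hkp] at h1
    simp [shift, underpass, w.2] at h1

theorem sum_top : ∑ w, ℓ.top w = D.numVirtual := by
  classical
  rw [← card_shift_eq_one]
  rw [Finset.card_eq_sum_card_fiberwise (f := ℓ.own) (t := Finset.univ) (by simp)]
  rw [Nat.cast_sum]
  refine Finset.sum_congr rfl fun w _ => ?_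
  rw [top_eq_card, Finset.filter_filter]

/-- For a special diagram, the coefficient of `zeta` at the largest possible power of `s` is the
determinant of the `T`-matrix: express all edges through the first edges of their long arcs; then
in the column of a long arc the maximal power of `s` stands exactly at its critical arc. -/
theorem hasTop_zeta (ℓ : D.Labelling) (hc : D.circles = 0) :
    HasTop (D.zeta varS varT) D.numVirtual D.tMatrix.det := by
  classical
  rw [zeta, if_pos hc]
  let X : D.Passage → D.Classical → DoubleLaurent := fun q w =>
    if ℓ.own q = w then ((varS ^ (ℓ.inc q - ℓ.dec q) : DoubleLaurentˣ) : DoubleLaurent) else 0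
  have hnu : ∀ p, p ∉ Set.range D.underpass → ¬ D.IsUnder p := fun p hp h =>
    hp (D.isUnder_iff.mp h)
  have hstep : ∀ p, p ∉ Set.range D.underpass → ℓ.own p = ℓ.own (D.succ.symm p) ∧
      ℓ.pos p = ℓ.pos (D.succ.symm p) + 1 ∧
      ℓ.inc p - ℓ.dec p = D.shift p + (ℓ.inc (D.succ.symm p) - ℓ.dec (D.succ.symm p)) := by
    intro p hp
    have := ℓ.step (D.succ.symm p) (by simpa using hnu p hp)
    simp only [Equiv.apply_symm_apply] at this
    refine ⟨this.1, this.2.1, ?_⟩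
    rcases D.shift_cases p with ⟨-, h | h⟩ | ⟨-, h⟩ <;> simp [h] at this ⊢ <;> omega
  rw [det_eliminate D.underpass D.underpass_injective (D.relation varS varT) D.succ.symm
    (fun p => ((varS ^ D.shift p : DoubleLaurentˣ) : DoubleLaurent)) ℓ.pos X]
  · rw [← ℓ.sum_top]
    refine HasTop.det fun v w => ?_
    have hX : ∀ q, HasTop (X q w) (ℓ.top w) (if ℓ.Crit w q then 1 else 0) := by
      intro q
      have h1 := ℓ.inc_le q
      have h2 := ℓ.dec_nonneg q
      by_cases ho : ℓ.own q = w
      · rw [ho] at h1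
        have := HasTop.C_mul_T (1 : ℤ[T;T⁻¹]) (show ℓ.inc q - ℓ.dec q ≤ ℓ.top w by omega)
        simp only [X, if_pos ho, LaurentPolynomial.coe_unitT_zpow]
        rw [map_one, one_mul] at this
        convert this using 1
        exact if_congr (by unfold Crit; constructor <;> intro h <;> [omega; exact ⟨ho, by omega⟩])
          rfl rfl
      · simp only [X, if_neg ho]
        rw [if_neg (fun h => ho h.1)]
        exact HasTop.zero _
    have hC : ∀ (r : ℤ[T;T⁻¹]) {f : DoubleLaurent} {a : ℤ[T;T⁻¹]}, HasTop f (ℓ.top w) a →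
        HasTop (LaurentPolynomial.C r * f) (ℓ.top w) (r * a) := fun r f a hf => by
      simpa using (HasTop.C_mul_T r (le_refl 0)).mul hf
    have hu : D.underUnit varT (D.underpass v) = varT ^ (D.kind v.1).sign := if_pos (D.isUnder_underpass v)
    have hsh : D.shift (D.underpass v) = 0 := by simp [shift, underpass, v.2]
    have hsum : ∑ q, D.relation varS varT (D.underpass v) q * X q w =
        X (D.underpass v) w - LaurentPolynomial.C (LaurentPolynomial.T (D.kind v.1).sign) *
          X (D.succ.symm (D.underpass v)) w +
        LaurentPolynomial.C (LaurentPolynomial.T (D.kind v.1).sign - 1) * X (D.overpass v) w := by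
      simp only [relation, Pi.add_apply, Pi.sub_apply, Pi.smul_apply, smul_eq_mul, add_mul, sub_mul,
        Finset.sum_add_distrib, Finset.sum_sub_distrib, mul_assoc, ← Finset.mul_sum,
        Pi.single_apply, ite_mul, one_mul, zero_mul, Finset.sum_ite_eq', Finset.mem_univ, if_true,
        hu, hsh, zpow_zero, one_mul, coe_varT_zpow, overpass_eq, map_sub, map_one]
    rw [Matrix.of_apply, hsum, ℓ.tMatrix_apply]
    convert ((hX _).sub (hC _ (hX _))).add (hC _ (hX _)) using 1
    split_ifs <;> ring
  · intro p hp
    simp [relation, underUnit, hnu p hp]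
  · intro p hp
    have := (hstep p hp).2.1
    omega
  · intro p hp
    obtain ⟨h1, -, h3⟩ := hstep p hp
    ext w
    simp only [X, Pi.smul_apply, smul_eq_mul, h1, h3, zpow_add, Units.val_mul, mul_ite, mul_zero]
  · intro v
    obtain ⟨h1, -, h3, h4⟩ := ℓ.under v
    ext w
    simp only [X, h1, h3, h4, Pi.single_apply, eq_comm (a := w)]
    simp

end Labelling

end Leading

end Diagram

/-- `f` is the product of a sign `u`, the power `t ^ a`, and the power `(t - 1) ^ b`. -/
def IsSignedForm (f : ℤ[T;T⁻¹]) (u : ℤˣ) (a : ℤ) (b : ℕ) : Prop :=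
  f = LaurentPolynomial.C (u : ℤ) * LaurentPolynomial.T a * (LaurentPolynomial.T 1 - 1) ^ b

namespace IsSignedForm

open LaurentPolynomial

theorem T_sub_one_ne_zero : (T 1 - 1 : ℤ[T;T⁻¹]) ≠ 0 := by
  intro h
  have := congrArg (fun f : ℤ[T;T⁻¹] => f.coeff 1) h
  have h2 := coeff_C_mul_T (1 : ℤ) 0 1
  simp at h2
  simp [h2] at this

theorem mul {f g : ℤ[T;T⁻¹]} {u v : ℤˣ} {a c : ℤ} {b d : ℕ} (hf : IsSignedForm f u a b)
    (hg : IsSignedForm g v c d) : IsSignedForm (f * g) (u * v) (a + c) (b + d) := by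
  unfold IsSignedForm at *
  rw [hf, hg, Units.val_mul, map_mul, T_add, pow_add]; ring

theorem unit (u : ℤˣ) : IsSignedForm (C (u : ℤ)) u 0 0 := by simp [IsSignedForm]

theorem units_smul {f : ℤ[T;T⁻¹]} {u : ℤˣ} {a : ℤ} {b : ℕ} (hf : IsSignedForm f u a b) (v : ℤˣ) :
    IsSignedForm (v • f) (v * u) a b := by
  have : v • f = C (v : ℤ) * f := by
    rcases Int.units_eq_one_or v with rfl | rfl <;> simp
  rw [this]
  simpa using (unit v).mul hf

theorem prod {ι : Type*} (S : Finset ι) {f : ι → ℤ[T;T⁻¹]}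
    (h : ∀ i ∈ S, ∃ u a b, IsSignedForm (f i) u a b) :
    ∃ u a b, IsSignedForm (∏ i ∈ S, f i) u a b := by
  classical
  induction S using Finset.induction_on with
  | empty => exact ⟨1, 0, 0, by simp [IsSignedForm]⟩
  | insert i S hi ih =>
    obtain ⟨u, a, b, h1⟩ := h i (by simp)
    obtain ⟨v, c, d, h2⟩ := ih fun j hj => h j (by simp [hj])
    rw [Finset.prod_insert hi]
    exact ⟨_, _, _, h1.mul h2⟩

theorem ne_zero {f : ℤ[T;T⁻¹]} {u : ℤˣ} {a : ℤ} {b : ℕ} (h : IsSignedForm f u a b) : f ≠ 0 := by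
  rw [h]
  refine mul_ne_zero (mul_ne_zero ?_ (isUnit_T a).ne_zero) (pow_ne_zero _ T_sub_one_ne_zero)
  rcases Int.units_eq_one_or u with rfl | rfl <;> simp

theorem unique {f : ℤ[T;T⁻¹]} {u v : ℤˣ} {a c : ℤ} {b d : ℕ} (hf : IsSignedForm f u a b)
    (hg : IsSignedForm f v c d) : u = v ∧ a = c ∧ b = d := by
  -- the value at `t = 1` shows that the exponents of `t - 1` agree
  have key : ∀ {u v : ℤˣ} {a c : ℤ} {b d : ℕ}, IsSignedForm f u a b → IsSignedForm f v c d →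
      d ≤ b := by
    intro u v a c b d hf hg
    by_contra hlt
    obtain ⟨m, rfl⟩ := Nat.exists_eq_add_of_lt (not_le.mp hlt)
    have h1 : C (v : ℤ) * T c * (T 1 - 1) ^ (m + 1) = C (u : ℤ) * T a := by
      refine mul_right_cancel₀ (pow_ne_zero b T_sub_one_ne_zero) ?_
      rw [← hf, hg, mul_assoc, ← pow_add]
      congr 2; omega
    have h2 := congrArg (eval₂ (RingHom.id ℤ) 1) h1
    rw [map_mul, map_pow, map_sub, eval₂_T, map_one, zpow_one, Units.val_one, sub_self,
      zero_pow (Nat.succ_ne_zero m), mul_zero, map_mul, eval₂_T, eval₂_C, one_zpow, Units.val_one,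
      mul_one] at h2
    exact u.ne_zero h2.symm
  have hbd : b = d := le_antisymm (key hg hf) (key hf hg)
  subst hbd
  rw [IsSignedForm] at hf hg
  rw [hg] at hf
  have h1 := mul_right_cancel₀ (pow_ne_zero _ T_sub_one_ne_zero) hf
  have h2 := congrArg (fun f : ℤ[T;T⁻¹] => f.coeff a) h1
  simp only [coeff_C_mul_T, if_true] at h2
  by_cases hac : c = a
  · subst hac
    rw [if_pos rfl] at h2
    exact ⟨Units.ext h2.symm, rfl, rfl⟩
  · rw [if_neg hac] at h2
    exact absurd h2.symm u.ne_zero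

end IsSignedForm

namespace Diagram

section MDiagram

variable {D : Diagram}

/-- The incidence coefficients other than `0` which do not belong to a cyclic crossing are
`1`, `± (t ^ sign - 1)`, `± t ^ sign` and `-1`. -/
theorem incidenceCoeff_isSignedForm {v w : D.Classical} (hv : ¬ D.IsCyclicCrossing v)
    (h : D.IncidentCritical v w) : ∃ u a b, IsSignedForm (D.tMatrix v w) u a b := by
  have hc : ¬ (D.Emanates v w (D.numIncreasing w) ∧ D.PassesThrough v w (D.numIncreasing w) ∧
      D.ComesInto v w (D.numIncreasing w)) := fun h => hv ⟨w, _, h⟩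
  have hT : (LaurentPolynomial.T (D.kind v.1).sign - 1 : ℤ[T;T⁻¹]) =
      LaurentPolynomial.T 1 - 1 ∨ (LaurentPolynomial.T (D.kind v.1).sign - 1 : ℤ[T;T⁻¹]) =
      - LaurentPolynomial.T (-1) * (LaurentPolynomial.T 1 - 1) := by
    cases hk : D.kind v.1
    · left; rfl
    · right
      rw [mul_sub, neg_mul, ← LaurentPolynomial.T_add]
      simp [CrossingKind.sign]; ring
    · exact absurd hk v.2
  have hP : ∃ u a b, IsSignedForm (LaurentPolynomial.T (D.kind v.1).sign - 1 : ℤ[T;T⁻¹]) u a b := by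
    rcases hT with h | h
    · exact ⟨1, 0, 1, by simp [IsSignedForm, h]⟩
    · exact ⟨-1, -1, 1, by simp [IsSignedForm, h]⟩
  simp only [tMatrix, Matrix.of_apply, incidenceCoeff]
  by_cases h1 : D.Emanates v w (D.numIncreasing w) <;>
    by_cases h2 : D.PassesThrough v w (D.numIncreasing w) <;>
    by_cases h3 : D.ComesInto v w (D.numIncreasing w)
  · exact absurd ⟨h1, h2, h3⟩ hc
  · exact ⟨1, (D.kind v.1).sign, 0, by simp [IsSignedForm, h1, h2, h3]⟩
  · obtain ⟨u, a, b, hu⟩ := hP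
    refine ⟨-1 * u, a, b, ?_⟩
    convert hu.units_smul (-1) using 1
    simp [h1, h2, h3]; ring
  · exact ⟨1, 0, 0, by simp [IsSignedForm, h1, h2, h3]⟩
  · exact ⟨-1, 0, 0, by simp [IsSignedForm, h1, h2, h3]; ring⟩
  · simpa [h1, h2, h3] using hP
  · exact ⟨-1, (D.kind v.1).sign, 0, by simp [IsSignedForm, h1, h2, h3]⟩
  · rcases h with h | h | h <;> contradiction

theorem tMatrix_eq_zero {v w : D.Classical} (h : ¬ D.IncidentCritical v w) :
    D.tMatrix v w = 0 := by
  simp only [IncidentCritical, not_or] at h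
  simp [tMatrix, incidenceCoeff, h]

/-- If there is at most one pairing, then the Leibniz formula for the `T`-matrix has a single
non-zero term. -/
theorem det_tMatrix {σ : Equiv.Perm D.Classical}
    (huniq : ∀ τ : Equiv.Perm D.Classical, (∀ v, D.IncidentCritical v (τ v)) → τ = σ) :
    D.tMatrix.det = Equiv.Perm.sign σ • ∏ v, D.tMatrix v (σ v) := by
  rw [← Matrix.det_transpose, Matrix.det_apply, Finset.sum_eq_single σ]
  · rfl
  · intro τ _ hτ
    have : ¬ ∀ v, D.IncidentCritical v (τ v) := fun h => hτ (huniq τ h)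
    push Not at this
    obtain ⟨v, hv⟩ := this
    rw [Finset.prod_eq_zero (Finset.mem_univ v), smul_zero]
    exact tMatrix_eq_zero hv
  · simp

theorem IsMDiagram.exists_isSignedForm (hD : D.IsMDiagram) :
    ∃ u a b, IsSignedForm D.tMatrix.det u a b := by
  obtain ⟨σ, hσ, huniq⟩ := hD.pairing
  obtain ⟨u, a, b, h⟩ := IsSignedForm.prod Finset.univ
    fun v _ => incidenceCoeff_isSignedForm (hD.noCyclic v) (hσ v)
  exact ⟨_, _, _, det_tMatrix huniq ▸ h.units_smul _⟩

theorem IsMDiagram.hasTop_zeta (hD : D.IsMDiagram) :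
    HasTop (D.zeta varS varT) D.numVirtual D.tMatrix.det := by
  obtain ⟨ℓ⟩ := D.exists_labelling hD.proper hD.special
  exact ℓ.hasTop_zeta hD.proper.1

theorem coeff_zeta_eq {D D' : Diagram} {h : D.IsPlanar} {h' : D'.IsPlanar}
    (hL : VirtualLink.of D h = VirtualLink.of D' h') :
    ∃ k : ℤ, ∀ n, (D.zeta varS varT).coeff n =
      LaurentPolynomial.T k * (D'.zeta varS varT).coeff n := by
  obtain ⟨k, hk⟩ := VirtualLink.zeta_eq varS varT hL
  refine ⟨k, fun n => ?_⟩
  rw [hk, coe_varT_zpow]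
  rw [← LaurentPolynomial.smul_eq_C_mul, AddMonoidAlgebra.coeff_smul]
  rfl

theorem IsMDiagram.numVirtual_le (hD : D.IsMDiagram) {D' : Diagram} {h' : D'.IsPlanar}
    (hL : VirtualLink.of D hD.planar = VirtualLink.of D' h') : D.numVirtual ≤ D'.numVirtual := by
  obtain ⟨k, hk⟩ := coeff_zeta_eq hL
  obtain ⟨u, a, b, h⟩ := hD.exists_isSignedForm
  by_contra hlt
  refine h.ne_zero ?_
  rw [← hD.hasTop_zeta.1, hk, D'.coeff_zeta_eq_zero (by exact_mod_cast not_le.mp hlt), mul_zero]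

theorem IsMDiagram.virtualCrossingNumber_eq (hD : D.IsMDiagram) :
    (VirtualLink.of D hD.planar).virtualCrossingNumber = D.numVirtual := by
  refine le_antisymm (Nat.sInf_le ⟨D, hD.planar, rfl, rfl⟩)
    (le_csInf ⟨_, D, hD.planar, rfl, rfl⟩ ?_)
  rintro _ ⟨D', h', hL, rfl⟩
  exact hD.numVirtual_le hL.symm

theorem IsMDiagram.det_eq (hD : D.IsMDiagram) {D' : Diagram} (hD' : D'.IsMDiagram)
    (hL : VirtualLink.of D hD.planar = VirtualLink.of D' hD'.planar) :
    ∃ k : ℤ, D.tMatrix.det = LaurentPolynomial.T k * D'.tMatrix.det := by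
  have hn : D.numVirtual = D'.numVirtual :=
    le_antisymm (hD.numVirtual_le hL) (hD'.numVirtual_le hL.symm)
  obtain ⟨k, hk⟩ := coeff_zeta_eq hL
  exact ⟨k, by rw [← hD.hasTop_zeta.1, hk, hn, hD'.hasTop_zeta.1]⟩

end MDiagram

end Diagram

namespace VirtualLink

/-- The pair `(ε, β)` is read off from the `T`-matrix of some `M`-diagram of the virtual link. -/
def HasInvariants (L : VirtualLink) (x : ℤˣ × ℕ) : Prop :=
  ∃ (D : Diagram) (hD : D.IsMDiagram) (a : ℤ), VirtualLink.of D hD.planar = L ∧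
    IsSignedForm D.tMatrix.det x.1 a x.2

open Classical in
/-- The invariants `ε` and `β` of a virtual link with an `M`-diagram (and `1`, `0` for the other
virtual links). -/
noncomputable def invariants (L : VirtualLink) : ℤˣ × ℕ :=
  if h : ∃ x, L.HasInvariants x then h.choose else (1, 0)

theorem invariants_eq {D : Diagram} (hD : D.IsMDiagram) {u : ℤˣ} {a : ℤ} {b : ℕ}
    (h : IsSignedForm D.tMatrix.det u a b) :
    (VirtualLink.of D hD.planar).invariants = (u, b) := by
  have hex : ∃ x, (VirtualLink.of D hD.planar).HasInvariants x := ⟨(u, b), D, hD, a, rfl, h⟩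
  rw [invariants, dif_pos hex]
  obtain ⟨D', hD', a', hL, h'⟩ := hex.choose_spec
  obtain ⟨k, hk⟩ := hD'.det_eq hD hL
  have h1 : IsSignedForm (LaurentPolynomial.T k) 1 k 0 := by simp [IsSignedForm]
  have h2 := h1.mul h
  rw [← hk] at h2
  obtain ⟨e1, -, e2⟩ := h'.unique h2
  exact Prod.ext (by simpa using e1) (by simpa using e2)

end VirtualLink

namespace Diagram

/-! ### Special sums inside a diagram -/

section Sums

variable {D : Diagram}

namespace Labelling

variable (ℓ : D.Labelling)

/-- The edge `e` is pre-critical, respectively post-critical. -/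
def HasType (κ : SumType) (e : D.Passage) : Prop :=
  match κ with
  | SumType.preCritical => ℓ.inc e < ℓ.top (ℓ.own e)
  | SumType.postCritical => 0 < ℓ.dec e

theorem edgeOfType_iff_hasType (κ : SumType) (v : D.Classical) (e : D.Passage) :
    D.EdgeOfType κ v e ↔ ℓ.own e = v ∧ ℓ.HasType κ e := by
  rw [ℓ.edgeOfType_iff]
  constructor <;> rintro ⟨rfl, h⟩ <;> exact ⟨rfl, h⟩

/-- The edge starting at `p` lies behind the edge `e` on the same long arc. -/
def Behind (e p : D.Passage) : Prop := ℓ.own p = ℓ.own e ∧ ℓ.pos e < ℓ.pos p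

instance (e p : D.Passage) : Decidable (ℓ.Behind e p) := by unfold Behind; infer_instance

theorem not_crit_of_hasType {κ : SumType} {e : D.Passage} (he : ℓ.HasType κ e) (w : D.Classical) :
    ¬ ℓ.Crit w e := by
  rintro ⟨rfl, h1, h2⟩
  cases κ <;> simp only [HasType] at he <;> omega

variable {e f : D.Passage}

/-- The values of a function on a surgered diagram: the parts behind the edges `e` and `f` of
the two long arcs are interchanged. -/
def tailSwap {α : Type*} (e f : D.Passage) (a b c : D.Passage → α) (p : D.Passage) : α :=
  if ℓ.Behind e p then a p else if ℓ.Behind f p then b p else c p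

theorem pos_inj {p q : D.Passage} (h1 : ℓ.own p = ℓ.own q) (h2 : ℓ.pos p = ℓ.pos q) : p = q := by
  rw [← (ℓ.passage_own_pos p).1, ← (ℓ.passage_own_pos q).1, h1, h2]

/-- The numbers of increasing passages on the long arcs of a surgered diagram. -/
def surgeryTop (e f : D.Passage) (v : D.Classical) : ℤ :=
  if v = ℓ.own e then ℓ.inc e + (ℓ.top (ℓ.own f) - ℓ.inc f) else
    if v = ℓ.own f then ℓ.inc f + (ℓ.top (ℓ.own e) - ℓ.inc e) else ℓ.top v

/-- The labels of a surgered diagram, whose long arcs consist of the heads and the interchanged tails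
of the old ones, satisfy the rule of succession. -/
theorem surgery_step (hne : ℓ.own e ≠ ℓ.own f) (p : D.Passage)
    (hu : ¬ D.IsUnder (D.succ (Equiv.swap e f p))) (own' : D.Passage → D.Classical)
    (pos' : D.Passage → ℕ) (inc' dec' : D.Passage → ℤ)
    (hown : own' = ℓ.tailSwap e f (fun _ => ℓ.own f) (fun _ => ℓ.own e) ℓ.own)
    (hpos : pos' = ℓ.tailSwap e f (fun p => ℓ.pos p - ℓ.pos e + ℓ.pos f)
      (fun p => ℓ.pos p - ℓ.pos f + ℓ.pos e) ℓ.pos)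
    (hinc : inc' = ℓ.tailSwap e f (fun p => ℓ.inc p - ℓ.inc e + ℓ.inc f)
      (fun p => ℓ.inc p - ℓ.inc f + ℓ.inc e) ℓ.inc)
    (hdec : dec' = ℓ.tailSwap e f (fun p => ℓ.dec p - ℓ.dec e + ℓ.dec f)
      (fun p => ℓ.dec p - ℓ.dec f + ℓ.dec e) ℓ.dec) :
    own' (D.succ (Equiv.swap e f p)) = own' p ∧
      pos' (D.succ (Equiv.swap e f p)) = pos' p + 1 ∧
      inc' (D.succ (Equiv.swap e f p)) =
        inc' p + (if D.shift (D.succ (Equiv.swap e f p)) = 1 then 1 else 0) ∧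
      dec' (D.succ (Equiv.swap e f p)) =
        dec' p + (if D.shift (D.succ (Equiv.swap e f p)) = -1 then 1 else 0) := by
  subst hown hpos hinc hdec
  have h1 := ℓ.step _ hu
  have h2 := ℓ.pos_inj (p := p) (q := e)
  have h3 := ℓ.pos_inj (p := p) (q := f)
  generalize (if D.shift (D.succ (Equiv.swap e f p)) = 1 then (1 : ℤ) else 0) = x at *
  generalize (if D.shift (D.succ (Equiv.swap e f p)) = -1 then (1 : ℤ) else 0) = y at *
  generalize D.succ (Equiv.swap e f p) = q at *
  rw [Equiv.swap_apply_def] at h1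
  simp only [tailSwap, Behind]
  split_ifs at h1 with h4 h5
  · subst h4; grind
  · subst h5; grind
  · grind

/-- The part of a long arc behind a pre-critical edge contains the critical arc, the part behind a
post-critical edge does not; in both cases the heads and the tails fit together again. -/
theorem exists_surgery {κ : SumType} (hne : ℓ.own e ≠ ℓ.own f) (he : ℓ.HasType κ e)
    (hf : ℓ.HasType κ f) : ∃ (ℓ' : (D.surgery e f).Labelling) (g : Equiv.Perm D.Classical),
      Equiv.Perm.sign g = κ.sign ∧ (∀ x p, ℓ'.Crit x p ↔ ℓ.Crit (g x) p) ∧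
      (∀ κ' p, ℓ.HasType κ' p → ℓ'.HasType κ' p) ∧
      ((∀ v, ¬ D.IsCyclicCrossing v) → ∀ v, ¬ (D.surgery e f).IsCyclicCrossing v) := by
  have hmono := fun p q => ℓ.inc_mono (p := p) (q := q)
  have hle := ℓ.inc_le
  have hcr := ℓ.inc_eq_top_or_dec_eq_zero
  let own' := ℓ.tailSwap e f (fun _ => ℓ.own f) (fun _ => ℓ.own e) ℓ.own
  let pos' := ℓ.tailSwap e f (fun p => ℓ.pos p - ℓ.pos e + ℓ.pos f)
    (fun p => ℓ.pos p - ℓ.pos f + ℓ.pos e) ℓ.pos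
  let inc' := ℓ.tailSwap e f (fun p => ℓ.inc p - ℓ.inc e + ℓ.inc f)
    (fun p => ℓ.inc p - ℓ.inc f + ℓ.inc e) ℓ.inc
  let dec' := ℓ.tailSwap e f (fun p => ℓ.dec p - ℓ.dec e + ℓ.dec f)
    (fun p => ℓ.dec p - ℓ.dec f + ℓ.dec e) ℓ.dec
  obtain ⟨g, hsign, hg⟩ : ∃ g : Equiv.Perm D.Classical, Equiv.Perm.sign g = κ.sign ∧
      ∀ x, g x = match κ with
        | .preCritical => if x = ℓ.own e then ℓ.own f else if x = ℓ.own f then ℓ.own e else x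
        | .postCritical => x := by
    cases κ
    · exact ⟨Equiv.swap (ℓ.own e) (ℓ.own f), Equiv.Perm.sign_swap hne, fun x =>
        Equiv.swap_apply_def _ _ _⟩
    · exact ⟨1, Equiv.Perm.sign_one, fun x => rfl⟩
  have hcrit : ∀ x p, (own' p = x ∧ inc' p = ℓ.surgeryTop e f x ∧ dec' p = 0) ↔
      ℓ.Crit (g x) p := by
    intro x p
    rw [hg]
    have h1 := hle p
    have h2 := hle e
    have h3 := hle f
    have h4 := hmono p e
    have h5 := hmono p f
    have h6 := hmono e p
    have h7 := hmono f p
    have h8 := hcr p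
    have h9 := hcr e
    have h10 := hcr f
    have h11 := ℓ.dec_nonneg p
    clear hmono hle hcr hg
    cases κ
    · simp only [HasType] at he hf
      simp only [own', inc', dec', tailSwap, Behind, surgeryTop, Crit]
      grind (splits := 30)
    · simp only [HasType] at he hf
      simp only [own', inc', dec', tailSwap, Behind, surgeryTop, Crit]
      grind (splits := 30)
  have htype : ∀ κ' p, ℓ.HasType κ' p → SumType.casesOn (motive := fun _ => Prop) κ'
      (inc' p < ℓ.surgeryTop e f (own' p)) (0 < dec' p) := by
    intro κ' p hp
    have h1 := hle p
    have h2 := hle e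
    have h3 := hle f
    have h4 := hmono p e
    have h5 := hmono p f
    have h6 := hmono e p
    have h7 := hmono f p
    have h8 := hcr p
    have h9 := hcr e
    have h10 := hcr f
    clear hcrit hg hmono hle hcr
    cases κ'
    · change inc' p < ℓ.surgeryTop e f (own' p)
      cases κ <;> simp only [HasType] at he hf hp <;>
      simp only [own', inc', tailSwap, Behind, surgeryTop] <;> grind (splits := 30)
    · change 0 < dec' p
      cases κ <;> simp only [HasType] at he hf hp <;>
      simp only [dec', tailSwap, Behind] <;> grind (splits := 30)
  -- A long arc which ends with its first arc cannot have been cut, since a pre-critical edge lies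
  -- before, and a post-critical one behind, a critical arc.
  have hcyc : ∀ v z, z = Equiv.swap e f (D.succ.symm (D.underpass v)) →
      own' (D.overpass v) = v → own' z = v → inc' z = 0 → dec' z = 0 →
      (own' (D.overpass v) = own' z → pos' (D.overpass v) ≤ pos' z) →
      ℓ.own (D.overpass v) = v ∧ ℓ.own (D.succ.symm (D.underpass v)) = v ∧
        ℓ.inc (D.succ.symm (D.underpass v)) = 0 ∧ ℓ.dec (D.succ.symm (D.underpass v)) = 0 := by
    intro v z hz h1 h2 h3 h4 h5
    obtain ⟨c, hc1, hc2, hc3⟩ := ℓ.exists_crit (ℓ.own (D.succ.symm (D.underpass v)))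
    have hlast := fun p => ℓ.pos_le_pos_pred_underpass (v := v) (p := p)
    rw [Equiv.swap_apply_def] at hz
    generalize D.succ.symm (D.underpass v) = q at *
    generalize D.overpass v = o at *
    have k1 := hlast c
    have k2 := hlast e
    have k3 := hlast f
    have k4 := hmono c q
    have k5 := hmono e c
    have k6 := hmono c e
    have k7 := hmono f c
    have k8 := hmono c f
    have k9 := hmono q e
    have k10 := hmono q f
    have k11 := ℓ.inc_nonneg q
    have k12 := ℓ.dec_nonneg q
    have k13 := ℓ.inc_nonneg e
    have k14 := ℓ.inc_nonneg f
    have k15 := ℓ.dec_nonneg e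
    have k16 := ℓ.dec_nonneg f
    have k17 := hmono e q
    have k18 := hmono f q
    clear hcrit hg hmono hle hcr htype hlast
    simp only [own', inc', dec', pos', tailSwap, Behind] at h1 h2 h3 h4 h5
    cases κ <;> simp only [HasType] at he hf
    · grind (splits := 40)
    · grind (splits := 40)
  let ℓ' : (D.surgery e f).Labelling :=
    { own := own', pos := pos', inc := inc', dec := dec', top := ℓ.surgeryTop e f
      under := by
        have key : ∀ v, own' (D.underpass v) = v ∧ pos' (D.underpass v) = 0 ∧
            inc' (D.underpass v) = 0 ∧ dec' (D.underpass v) = 0 := by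
          intro v
          have h : ∀ e, ¬ ℓ.Behind e (D.underpass v) := fun e h => by
            have := h.2; rw [(ℓ.under v).2.1] at this; omega
          simp only [own', pos', inc', dec', tailSwap, h, if_false]
          exact ℓ.under v
        exact key
      step := fun p hu => ℓ.surgery_step hne p hu own' pos' inc' dec' rfl rfl rfl rfl
      inc_le := by
        have key : ∀ p, inc' p ≤ ℓ.surgeryTop e f (own' p) := by
          intro p
          have h1 := hle p
          have h2 := hle e
          have h3 := hle f
          have h4 := hmono p e
          have h5 := hmono p f
          simp only [own', inc', tailSwap, Behind, surgeryTop]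
          grind
        exact key
      exists_crit := fun v => by
        obtain ⟨p, hp⟩ := ℓ.exists_crit (g v)
        exact ⟨p, (hcrit v p).mpr hp⟩ }
  refine ⟨ℓ', g, hsign, hcrit, ?_, ?_⟩
  · rintro (_ | _) p hp
    · exact htype .preCritical p hp
    · exact htype .postCritical p hp
  · intro hnc v hv
    refine hnc v ((ℓ.isCyclicCrossing_iff v).mpr ?_)
    have hv1 := (ℓ'.isCyclicCrossing_iff v).mp hv
    have hv2 := fun h => ℓ'.pos_le_pos_pred_underpass (v := v) (p := D.overpass v) h
    exact hcyc v _ rfl hv1.1 hv1.2.1 hv1.2.2.1 hv1.2.2.2 hv2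

end Labelling

/-- The edge belongs to a pre-critical, respectively post-critical, arc of some long arc. -/
def HasEdgeType (D : Diagram) (κ : SumType) (e : D.Passage) : Prop := ∃ v, D.EdgeOfType κ v e

theorem Labelling.hasEdgeType_iff (ℓ : D.Labelling) (κ : SumType) (e : D.Passage) :
    D.HasEdgeType κ e ↔ ℓ.HasType κ e := by
  simp [HasEdgeType, ℓ.edgeOfType_iff_hasType]

/-- A special sum inside one special diagram: for a pre-critical sum two columns of the `T`-matrix
are interchanged, for a post-critical sum the `T`-matrix remains the same. -/
theorem exists_surgery (hp : D.IsProper) (hs : D.IsSpecial) {κ : SumType} {e f : D.Passage}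
    (hef : D.IsSpecialPair κ e f) : (D.surgery e f).IsProper ∧ (D.surgery e f).IsSpecial ∧
      (∀ κ' p, D.HasEdgeType κ' p → (D.surgery e f).HasEdgeType κ' p) ∧
      ((∀ v, ¬ D.IsCyclicCrossing v) → ∀ v, ¬ (D.surgery e f).IsCyclicCrossing v) ∧
      ∃ g : Equiv.Perm D.Classical, Equiv.Perm.sign g = κ.sign ∧
        (∀ v w : D.Classical,
          (D.surgery e f).IncidentCritical v w ↔ D.IncidentCritical v (g w)) ∧
        ∀ v w : D.Classical, (D.surgery e f).tMatrix v w = D.tMatrix v (g w) := by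
  classical
  obtain ⟨ℓ⟩ := D.exists_labelling hp hs
  obtain ⟨v, w, hvw, he, hf⟩ := hef
  rw [ℓ.edgeOfType_iff_hasType] at he hf
  obtain ⟨rfl, he⟩ := he
  obtain ⟨rfl, hf⟩ := hf
  obtain ⟨ℓ', g, hsign, hcrit, htype, hcyc⟩ := ℓ.exists_surgery hvw he hf
  have hpred : ∀ x v, ℓ'.Crit x ((D.surgery e f).succ.symm ((D.surgery e f).underpass v)) ↔
      ℓ.Crit (g x) (D.succ.symm (D.underpass v)) := by
    intro x v
    rw [hcrit]
    change ℓ.Crit (g x) (Equiv.swap e f (D.succ.symm (D.underpass v))) ↔ _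
    generalize D.succ.symm (D.underpass v) = q
    have h1 := ℓ.not_crit_of_hasType he (g x)
    have h2 := ℓ.not_crit_of_hasType hf (g x)
    rw [Equiv.swap_apply_def]
    split_ifs with h3 h4
    · subst h3; simp [h1, h2]
    · subst h4; simp [h1, h2]
    · rfl
  refine ⟨ℓ'.isProper hp.1, ℓ'.isSpecial, fun κ' p h => (ℓ'.hasEdgeType_iff κ' p).mpr
    (htype κ' p ((ℓ.hasEdgeType_iff κ' p).mp h)), hcyc, g, hsign, fun v w => ?_, fun v w => ?_⟩
  · exact (ℓ'.incidentCritical_iff v w).trans ((or_congr (hcrit _ _) (or_congr (hcrit _ _)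
      (hpred _ _))).trans (ℓ.incidentCritical_iff v (g w)).symm)
  · refine (ℓ'.tMatrix_apply v w).trans (Eq.trans ?_ (ℓ.tMatrix_apply v (g w)).symm)
    exact congrArg₂ _ (congrArg₂ _ (if_congr (hcrit _ _) rfl rfl) (if_congr (hcrit _ _) rfl rfl))
      (if_congr (hpred _ _) rfl rfl)

theorem IsMDiagram.surgery (hD : D.IsMDiagram) {κ : SumType} {e f : D.Passage}
    (hef : D.IsSpecialPair κ e f) (hp : (D.surgery e f).IsPlanar) :
    ∃ h : (D.surgery e f).IsMDiagram, (VirtualLink.of _ h.planar).invariants =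
      (κ.sign * (VirtualLink.of D hD.planar).invariants.1,
        (VirtualLink.of D hD.planar).invariants.2) := by
  obtain ⟨h1, h2, -, h4, g, hsign, hinc, hT⟩ := exists_surgery hD.proper hD.special hef
  have h : (D.surgery e f).IsMDiagram := by
    refine ⟨hp, h1, h2, h4 hD.noCyclic, ?_⟩
    obtain ⟨σ, hσ, huniq⟩ := hD.pairing
    have hσ' : ∀ v, D.IncidentCritical v (g ((g⁻¹ * σ : Equiv.Perm D.Classical) v)) := by
      simpa using hσ
    exact ⟨(g⁻¹ * σ : Equiv.Perm D.Classical), fun v => (hinc v _).mpr (hσ' v), fun (τ : Equiv.Perm D.Classical) hτ =>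
      eq_inv_mul_iff_mul_eq.mpr (huniq (g * τ) fun v => (hinc v _).mp (hτ v))⟩
  refine ⟨h, ?_⟩
  obtain ⟨u, a, b, hu⟩ := hD.exists_isSignedForm
  have hdet : (D.surgery e f).tMatrix.det = κ.sign • D.tMatrix.det := by
    have : (D.surgery e f).tMatrix = D.tMatrix.submatrix id g := by
      ext v w : 1; exact hT v w
    rw [this]
    refine (Matrix.det_permute' g D.tMatrix).trans ?_
    rw [hsign]
    rcases Int.units_eq_one_or κ.sign with h | h <;> simp [h]
  rw [VirtualLink.invariants_eq hD hu]
  exact VirtualLink.invariants_eq h (hdet ▸ hu.units_smul κ.sign)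

end Sums

end Diagram

namespace Diagram

/-! ### Disconnected sums -/

section Union

variable {D D' : Diagram}

/-- The passages of the first summand in a disconnected sum. -/
abbrev inlP (D D' : Diagram) (p : D.Passage) : (D.disjointUnion D').Passage := (Sum.inl p.1, p.2)

/-- The passages of the second summand in a disconnected sum. -/
abbrev inrP (D D' : Diagram) (p : D'.Passage) : (D.disjointUnion D').Passage := (Sum.inr p.1, p.2)

theorem inlP_injective : Function.Injective (inlP D D') := fun p q h => by
  rw [Prod.ext_iff] at h ⊢
  exact ⟨Sum.inl_injective h.1, h.2⟩

theorem inrP_injective : Function.Injective (inrP D D') := fun p q h => by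
  rw [Prod.ext_iff] at h ⊢
  exact ⟨Sum.inr_injective h.1, h.2⟩

theorem inlP_ne_inrP (p : D.Passage) (q : D'.Passage) : inlP D D' p ≠ inrP D D' q := fun h =>
  Sum.inl_ne_inr (congrArg Prod.fst h)

theorem succ_inlP (p : D.Passage) :
    (D.disjointUnion D').succ (inlP D D' p) = inlP D D' (D.succ p) := rfl

theorem succ_inrP (p : D'.Passage) :
    (D.disjointUnion D').succ (inrP D D' p) = inrP D D' (D'.succ p) := rfl

theorem succ_symm_inlP (p : D.Passage) :
    (D.disjointUnion D').succ.symm (inlP D D' p) = inlP D D' (D.succ.symm p) := rfl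

theorem succ_symm_inrP (p : D'.Passage) :
    (D.disjointUnion D').succ.symm (inrP D D' p) = inrP D D' (D'.succ.symm p) := rfl

/-- The classical crossings of a disconnected sum. -/
def classicalSum (D D' : Diagram) : D.Classical ⊕ D'.Classical ≃ (D.disjointUnion D').Classical where
  toFun := Sum.elim (fun v => ⟨Sum.inl v.1, v.2⟩) (fun v => ⟨Sum.inr v.1, v.2⟩)
  invFun
    | ⟨Sum.inl c, h⟩ => Sum.inl ⟨c, h⟩
    | ⟨Sum.inr c, h⟩ => Sum.inr ⟨c, h⟩
  left_inv := by rintro (v | v) <;> rfl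
  right_inv := by rintro ⟨c | c, h⟩ <;> rfl

/-- The classical crossings of the first summand in a disconnected sum. -/
abbrev inlC (D D' : Diagram) (v : D.Classical) : (D.disjointUnion D').Classical :=
  classicalSum D D' (Sum.inl v)

/-- The classical crossings of the second summand in a disconnected sum. -/
abbrev inrC (D D' : Diagram) (v : D'.Classical) : (D.disjointUnion D').Classical :=
  classicalSum D D' (Sum.inr v)

theorem forall_classical {P : (D.disjointUnion D').Classical → Prop} :
    (∀ v, P v) ↔ (∀ v, P (inlC D D' v)) ∧ ∀ v, P (inrC D D' v) := by
  rw [← (classicalSum D D').forall_congr_right, Sum.forall]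

theorem forall_passage {P : (D.disjointUnion D').Passage → Prop} :
    (∀ p, P p) ↔ (∀ p, P (inlP D D' p)) ∧ ∀ p, P (inrP D D' p) :=
  ⟨fun h => ⟨fun _ => h _, fun _ => h _⟩, fun h => by
    rintro ⟨c | c, s⟩
    · exact h.1 (c, s)
    · exact h.2 (c, s)⟩

/-- The functions on the passages of a disconnected sum. -/
def elimP {α : Type*} (f : D.Passage → α) (g : D'.Passage → α) :
    (D.disjointUnion D').Passage → α
  | (Sum.inl c, s) => f (c, s)
  | (Sum.inr c, s) => g (c, s)

theorem IsPlanar.disjointUnion (h : D.IsPlanar) (h' : D'.IsPlanar) :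
    (D.disjointUnion D').IsPlanar := by
  intro f hf
  obtain ⟨l, r, h1, h2⟩ := h (fun p => f (inlP D D' p)) (fun c => hf (Sum.inl c))
  obtain ⟨l', r', h1', h2'⟩ := h' (fun p => f (inrP D D' p)) (fun c => hf (Sum.inr c))
  refine ⟨elimP l l', elimP r r', forall_passage.mpr ⟨h1, h1'⟩, ?_⟩
  rintro (c | c)
  · exact h2 c
  · exact h2' c

/-- The labels of the long arcs of a disconnected sum. -/
def Labelling.disjointUnion (ℓ : D.Labelling) (ℓ' : D'.Labelling) :
    (D.disjointUnion D').Labelling where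
  own := elimP (fun p => inlC D D' (ℓ.own p)) (fun p => inrC D D' (ℓ'.own p))
  pos := elimP ℓ.pos ℓ'.pos
  inc := elimP ℓ.inc ℓ'.inc
  dec := elimP ℓ.dec ℓ'.dec
  top v := Sum.elim ℓ.top ℓ'.top ((classicalSum D D').symm v)
  under := by
    refine forall_classical.mpr ⟨fun v => ?_, fun v => ?_⟩
    · obtain ⟨h1, h2⟩ := ℓ.under v
      exact ⟨congrArg (inlC D D') h1, h2⟩
    · obtain ⟨h1, h2⟩ := ℓ'.under v
      exact ⟨congrArg (inrC D D') h1, h2⟩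
  step := by
    refine forall_passage.mpr ⟨fun p hp => ?_, fun p hp => ?_⟩
    · obtain ⟨h1, h2⟩ := ℓ.step p hp
      exact ⟨congrArg (inlC D D') h1, h2⟩
    · obtain ⟨h1, h2⟩ := ℓ'.step p hp
      exact ⟨congrArg (inrC D D') h1, h2⟩
  inc_le := forall_passage.mpr ⟨fun p => by simpa [elimP] using ℓ.inc_le p,
    fun p => by simpa [elimP] using ℓ'.inc_le p⟩
  exists_crit := by
    refine forall_classical.mpr ⟨fun v => ?_, fun v => ?_⟩
    · obtain ⟨p, h1, h2, h3⟩ := ℓ.exists_crit v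
      exact ⟨inlP D D' p, congrArg (inlC D D') h1, by simpa [elimP] using h2, h3⟩
    · obtain ⟨p, h1, h2, h3⟩ := ℓ'.exists_crit v
      exact ⟨inrP D D' p, congrArg (inrC D D') h1, by simpa [elimP] using h2, h3⟩

namespace Labelling

variable (ℓ : D.Labelling) (ℓ' : D'.Labelling)

theorem crit_inl_inl (w : D.Classical) (p : D.Passage) :
    (ℓ.disjointUnion ℓ').Crit (inlC D D' w) (inlP D D' p) ↔ ℓ.Crit w p := by
  simp [Crit, disjointUnion, elimP]

theorem crit_inr_inr (w : D'.Classical) (p : D'.Passage) :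
    (ℓ.disjointUnion ℓ').Crit (inrC D D' w) (inrP D D' p) ↔ ℓ'.Crit w p := by
  simp [Crit, disjointUnion, elimP]

theorem crit_inl_inr (w : D.Classical) (p : D'.Passage) :
    ¬ (ℓ.disjointUnion ℓ').Crit (inlC D D' w) (inrP D D' p) := by
  simp [Crit, disjointUnion, elimP]

theorem crit_inr_inl (w : D'.Classical) (p : D.Passage) :
    ¬ (ℓ.disjointUnion ℓ').Crit (inrC D D' w) (inlP D D' p) := by
  simp [Crit, disjointUnion, elimP]

theorem hasType_inl (κ : SumType) (p : D.Passage) :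
    (ℓ.disjointUnion ℓ').HasType κ (inlP D D' p) ↔ ℓ.HasType κ p := by
  cases κ <;> simp [HasType, disjointUnion, elimP]

theorem hasType_inr (κ : SumType) (p : D'.Passage) :
    (ℓ.disjointUnion ℓ').HasType κ (inrP D D' p) ↔ ℓ'.HasType κ p := by
  cases κ <;> simp [HasType, disjointUnion, elimP]

end Labelling

theorem underpass_inlC (v : D.Classical) :
    (D.disjointUnion D').underpass (inlC D D' v) = inlP D D' (D.underpass v) := rfl

theorem underpass_inrC (v : D'.Classical) :
    (D.disjointUnion D').underpass (inrC D D' v) = inrP D D' (D'.underpass v) := rfl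

theorem overpass_inlC (v : D.Classical) :
    (D.disjointUnion D').overpass (inlC D D' v) = inlP D D' (D.overpass v) := rfl

theorem overpass_inrC (v : D'.Classical) :
    (D.disjointUnion D').overpass (inrC D D' v) = inrP D D' (D'.overpass v) := rfl

/-- The incidences of a disconnected sum: the `T`-matrix is block diagonal. -/
theorem disjointUnion_special (hp : D.IsProper) (hs : D.IsSpecial) (hp' : D'.IsProper)
    (hs' : D'.IsSpecial) : (D.disjointUnion D').IsProper ∧ (D.disjointUnion D').IsSpecial ∧
      (∀ κ p, (D.disjointUnion D').HasEdgeType κ (inlP D D' p) ↔ D.HasEdgeType κ p) ∧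
      (∀ κ p, (D.disjointUnion D').HasEdgeType κ (inrP D D' p) ↔ D'.HasEdgeType κ p) ∧
      (∀ κ e f, D.HasEdgeType κ e → D'.HasEdgeType κ f →
        (D.disjointUnion D').IsSpecialPair κ (inlP D D' e) (inrP D D' f)) ∧
      ((∀ v, ¬ D.IsCyclicCrossing v) → (∀ v, ¬ D'.IsCyclicCrossing v) →
        ∀ v, ¬ (D.disjointUnion D').IsCyclicCrossing v) ∧
      (∀ v w, (D.disjointUnion D').IncidentCritical (inlC D D' v) (inlC D D' w) ↔
        D.IncidentCritical v w) ∧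
      (∀ v w, (D.disjointUnion D').IncidentCritical (inrC D D' v) (inrC D D' w) ↔
        D'.IncidentCritical v w) ∧
      (∀ v w, ¬ (D.disjointUnion D').IncidentCritical (inlC D D' v) (inrC D D' w)) ∧
      (∀ v w, ¬ (D.disjointUnion D').IncidentCritical (inrC D D' v) (inlC D D' w)) ∧
      (D.disjointUnion D').tMatrix.submatrix (classicalSum D D') (classicalSum D D') =
        Matrix.fromBlocks D.tMatrix 0 0 D'.tMatrix := by
  classical
  obtain ⟨ℓ⟩ := D.exists_labelling hp hs
  obtain ⟨ℓ'⟩ := D'.exists_labelling hp' hs'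
  let L := ℓ.disjointUnion ℓ'
  have t1 : ∀ κ p, (D.disjointUnion D').HasEdgeType κ (inlP D D' p) ↔ D.HasEdgeType κ p := by
    intro κ p
    rw [L.hasEdgeType_iff, ℓ.hasEdgeType_iff, ℓ.hasType_inl]
  have t2 : ∀ κ p, (D.disjointUnion D').HasEdgeType κ (inrP D D' p) ↔ D'.HasEdgeType κ p := by
    intro κ p
    rw [L.hasEdgeType_iff, ℓ'.hasEdgeType_iff, ℓ.hasType_inr]
  refine ⟨L.isProper (by simp [disjointUnion, hp.1, hp'.1]), L.isSpecial, t1, t2, ?_, ?_, ?_, ?_,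
    ?_, ?_, ?_⟩
  · intro κ e f he hf
    rw [ℓ.hasEdgeType_iff, ← ℓ.hasType_inl ℓ'] at he
    rw [ℓ'.hasEdgeType_iff, ← ℓ.hasType_inr ℓ'] at hf
    refine ⟨_, _, ?_, (L.edgeOfType_iff_hasType κ _ _).mpr ⟨rfl, he⟩,
      (L.edgeOfType_iff_hasType κ _ _).mpr ⟨rfl, hf⟩⟩
    simp [L, Labelling.disjointUnion, elimP]
  · intro h h'
    refine forall_classical.mpr ⟨fun v hv => h v ?_, fun v hv => h' v ?_⟩
    · rw [L.isCyclicCrossing_iff] at hv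
      rw [ℓ.isCyclicCrossing_iff]
      simpa [L, Labelling.disjointUnion, elimP, underpass_inlC, overpass_inlC, succ_symm_inlP]
        using hv
    · rw [L.isCyclicCrossing_iff] at hv
      rw [ℓ'.isCyclicCrossing_iff]
      simpa [L, Labelling.disjointUnion, elimP, underpass_inrC, overpass_inrC, succ_symm_inrP]
        using hv
  · intro v w
    rw [L.incidentCritical_iff, ℓ.incidentCritical_iff, underpass_inlC, overpass_inlC,
      succ_symm_inlP]
    simp only [L, Labelling.crit_inl_inl]
  · intro v w
    rw [L.incidentCritical_iff, ℓ'.incidentCritical_iff, underpass_inrC, overpass_inrC,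
      succ_symm_inrP]
    simp only [L, Labelling.crit_inr_inr]
  · intro v w
    rw [L.incidentCritical_iff, underpass_inlC, overpass_inlC, succ_symm_inlP]
    simp only [L, Labelling.crit_inr_inl, or_self, not_false_eq_true]
  · intro v w
    rw [L.incidentCritical_iff, underpass_inrC, overpass_inrC, succ_symm_inrP]
    simp only [L, Labelling.crit_inl_inr, or_self, not_false_eq_true]
  · ext i j : 2
    rw [Matrix.submatrix_apply, L.tMatrix_apply]
    rcases i with v | v <;> rcases j with w | w
    · rw [Matrix.fromBlocks_apply₁₁, ℓ.tMatrix_apply, underpass_inlC, overpass_inlC,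
        succ_symm_inlP]
      simp only [L, Labelling.crit_inl_inl]; rfl
    · rw [Matrix.fromBlocks_apply₁₂, underpass_inlC, overpass_inlC, succ_symm_inlP]
      simp [L, Labelling.crit_inr_inl]
    · rw [Matrix.fromBlocks_apply₂₁, underpass_inrC, overpass_inrC, succ_symm_inrP]
      simp [L, Labelling.crit_inl_inr]
    · rw [Matrix.fromBlocks_apply₂₂, ℓ'.tMatrix_apply, underpass_inrC, overpass_inrC,
        succ_symm_inrP]
      simp only [L, Labelling.crit_inr_inr]; rfl

theorem IsMDiagram.disjointUnion (hD : D.IsMDiagram) (hD' : D'.IsMDiagram) :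
    ∃ h : (D.disjointUnion D').IsMDiagram, (VirtualLink.of _ h.planar).invariants =
      ((VirtualLink.of D hD.planar).invariants.1 * (VirtualLink.of D' hD'.planar).invariants.1,
        (VirtualLink.of D hD.planar).invariants.2 + (VirtualLink.of D' hD'.planar).invariants.2) := by
  classical
  obtain ⟨h1, h2, -, -, -, h3, i1, i2, i3, i4, hT⟩ :=
    disjointUnion_special hD.proper hD.special hD'.proper hD'.special
  have h : (D.disjointUnion D').IsMDiagram := by
    refine ⟨hD.planar.disjointUnion hD'.planar, h1, h2, h3 hD.noCyclic hD'.noCyclic, ?_⟩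
    obtain ⟨σ, hσ, huniq⟩ := hD.pairing
    obtain ⟨σ', hσ', huniq'⟩ := hD'.pairing
    refine ⟨(classicalSum D D').permCongr (Equiv.sumCongr σ σ'), ?_, ?_⟩
    · refine forall_classical.mpr ⟨fun v => ?_, fun v => ?_⟩
      · simpa [Equiv.permCongr_apply] using (i1 _ _).mpr (hσ v)
      · simpa [Equiv.permCongr_apply] using (i2 _ _).mpr (hσ' v)
    · intro τ hτ
      obtain ⟨ρ, rfl⟩ := (classicalSum D D').permCongr.surjective τ
      obtain ⟨hl, hr⟩ := forall_classical.mp hτ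
      simp only [Equiv.permCongr_apply, Equiv.symm_apply_apply] at hl hr
      have hm : Set.MapsTo ρ (Set.range Sum.inl) (Set.range Sum.inl) := by
        rintro _ ⟨v, rfl⟩
        have := hl v
        rcases hw : ρ (Sum.inl v) with w | w
        · exact ⟨w, rfl⟩
        · rw [hw] at this; exact absurd this (i3 v w)
      obtain ⟨⟨τ, τ'⟩, rfl⟩ := Equiv.Perm.mem_sumCongrHom_range_of_perm_mapsTo_inl hm
      rw [← huniq τ fun v => (i1 _ _).mp (hl v), ← huniq' τ' fun v => (i2 _ _).mp (hr v)]
      rfl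
  refine ⟨h, ?_⟩
  obtain ⟨u, a, b, hu⟩ := hD.exists_isSignedForm
  obtain ⟨u', a', b', hu'⟩ := hD'.exists_isSignedForm
  rw [VirtualLink.invariants_eq hD hu, VirtualLink.invariants_eq hD' hu']
  refine VirtualLink.invariants_eq h (a := a + a') ?_
  rw [← Matrix.det_submatrix_equiv_self (classicalSum D D'), hT, Matrix.det_fromBlocks_zero₂₁]
  exact hu.mul hu'

end Union

end Diagram

namespace Diagram

/-! ### Connected sums -/

section ConnectedSum

variable {D D' : Diagram}

theorem sum_passage {f : D.Passage → ℤ} : ∑ p, f p = ∑ c, (f (c, true) + f (c, false)) := by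
  rw [Fintype.sum_prod_type]
  exact Finset.sum_congr rfl fun c _ => Fintype.sum_bool _

/-- A flow on a connected sum has the same value on the two new edges, since the total flow into
the crossings of the first summand equals the total flow out of them. Hence it restricts to
the two summands, and the faces to the left and to the right of the cut edges are joined. -/
theorem IsPlanar.connectedSum (h : D.IsPlanar) (h' : D'.IsPlanar) (e : D.Passage)
    (f : D'.Passage) : (D.connectedSum D' e f).IsPlanar := by
  intro φ hφ
  let e' := inlP D D' e
  let f' := inrP D D' f
  replace hφ : ∀ c, φ (Equiv.swap e' f' ((D.disjointUnion D').succ.symm (c, true))) +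
    φ (Equiv.swap e' f' ((D.disjointUnion D').succ.symm (c, false))) =
      φ (c, true) + φ (c, false) := hφ
  have hval : φ e' = φ f' := by
    have h1 : ∑ p : D.Passage, φ (Equiv.swap e' f' (inlP D D' (D.succ.symm p))) =
        ∑ p : D.Passage, φ (inlP D D' p) := by
      rw [sum_passage, sum_passage]
      exact Finset.sum_congr rfl fun c _ => hφ (Sum.inl c)
    rw [Equiv.sum_comp D.succ.symm (fun p => φ (Equiv.swap e' f' (inlP D D' p)))] at h1
    rw [← Finset.add_sum_erase _ _ (Finset.mem_univ e),
      ← Finset.add_sum_erase _ (fun p => φ (inlP D D' p)) (Finset.mem_univ e)] at h1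
    have h2 : ∑ p ∈ Finset.univ.erase e, φ (Equiv.swap e' f' (inlP D D' p)) =
        ∑ p ∈ Finset.univ.erase e, φ (inlP D D' p) := by
      refine Finset.sum_congr rfl fun p hp => ?_
      rw [Equiv.swap_apply_of_ne_of_ne]
      · intro hpe
        refine Finset.ne_of_mem_erase hp ?_
        exact inlP_injective hpe
      · exact inlP_ne_inrP _ _
    rw [h2] at h1
    have h3 := add_right_cancel h1
    rw [show inlP D D' e = e' from rfl, Equiv.swap_apply_left] at h3
    exact h3.symm
  have hswap : ∀ {α : Type} (g : (D.disjointUnion D').Passage → α), g e' = g f' →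
      ∀ p, g (Equiv.swap e' f' p) = g p := by
    intro α g hg p
    rw [Equiv.swap_apply_def]
    split_ifs with h1 h2
    · rw [h1, hg]
    · rw [h2, hg]
    · rfl
  simp only [hswap φ hval] at hφ
  obtain ⟨l, r, h1, h2⟩ := h (fun p => φ (inlP D D' p)) (fun c => hφ (Sum.inl c))
  obtain ⟨l', r', h1', h2'⟩ := h' (fun p => φ (inrP D D' p)) (fun c => hφ (Sum.inr c))
  let k := l e - l' f
  have hl : elimP l (fun p => l' p + k) e' = elimP l (fun p => l' p + k) f' := by
    change l e = l' f + k; simp [k]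
  have hr : elimP r (fun p => r' p + k) e' = elimP r (fun p => r' p + k) f' := by
    change r e = r' f + k
    have g1 := h1 e
    have g2 := h1' f
    change φ e' = _ at g1
    change φ f' = _ at g2
    simp only [k]; omega
  refine ⟨elimP l (fun p => l' p + k), elimP r (fun p => r' p + k),
    forall_passage.mpr ⟨h1, fun p => ?_⟩, ?_⟩
  · refine (h1' p).trans ?_
    change l' p - r' p = (l' p + k) - (r' p + k)
    ring
  · have key : ∀ c : (D.disjointUnion D').C,
        elimP l (fun p => l' p + k) ((D.disjointUnion D').succ.symm (c, true)) =
          elimP l (fun p => l' p + k) (c, false) ∧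
        elimP l (fun p => l' p + k) (c, true) = elimP r (fun p => r' p + k) (c, false) ∧
        elimP r (fun p => r' p + k) (c, true) =
          elimP r (fun p => r' p + k) ((D.disjointUnion D').succ.symm (c, false)) ∧
        elimP r (fun p => r' p + k) ((D.disjointUnion D').succ.symm (c, true)) =
          elimP l (fun p => l' p + k) ((D.disjointUnion D').succ.symm (c, false)) := by
      rintro (c | c)
      · exact h2 c
      · obtain ⟨g1, g2, g3, g4⟩ := h2' c
        exact ⟨congrArg (· + k) g1, congrArg (· + k) g2, congrArg (· + k) g3,
          congrArg (· + k) g4⟩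
    intro c
    obtain ⟨g1, g2, g3, g4⟩ := key c
    exact ⟨(hswap _ hl _).trans g1, g2, g3.trans (hswap _ hr _).symm,
      (hswap _ hr _).trans (g4.trans (hswap _ hl _).symm)⟩

theorem isKnot_iff (hc : D.circles = 0) :
    D.IsKnot ↔ Nonempty D.Passage ∧ ∀ p q, D.succ.SameCycle p q := by
  unfold IsKnot numComponents
  rw [hc, zero_add, Nat.card_eq_one_iff_unique]
  constructor
  · rintro ⟨h1, ⟨q⟩⟩
    refine ⟨⟨q.out⟩, fun p q => ?_⟩
    exact Quotient.exact (s := Equiv.Perm.SameCycle.setoid D.succ) (h1.elim _ _)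
  · rintro ⟨⟨p⟩, h⟩
    refine ⟨⟨fun a b => ?_⟩, ⟨Quotient.mk _ p⟩⟩
    induction a using Quotient.inductionOn
    induction b using Quotient.inductionOn
    exact Quotient.sound (h _ _)

/-- Each passage of a summand is connected with the cut edge of this summand, and the two cut edges
are connected with each other. -/
theorem IsKnot.connectedSum (h : D.IsKnot) (hc : D.circles = 0) (h' : D'.IsKnot)
    (hc' : D'.circles = 0) (e : D.Passage) (f : D'.Passage) :
    (D.connectedSum D' e f).IsKnot := by
  rw [isKnot_iff hc] at h
  rw [isKnot_iff hc'] at h'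
  let π : Equiv.Perm (D.disjointUnion D').Passage :=
    (D.disjointUnion D').succ * Equiv.swap (inlP D D' e) (inrP D D' f)
  refine (isKnot_iff (by simp [Diagram.connectedSum, surgery, disjointUnion, hc, hc'])).mpr
    ⟨⟨inlP D D' e⟩, ?_⟩
  have hstep : ∀ p, π.SameCycle p (π p) := fun p => Equiv.Perm.sameCycle_apply_right.mpr (.refl _ _)
  have h1 : ∀ p, π.SameCycle (inlP D D' p) (inlP D D' e) := by
    intro p
    obtain ⟨n, hn⟩ := (h.2 p e).exists_nat_pow_eq
    induction n generalizing p with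
    | zero => rw [← hn]; exact .refl _ _
    | succ n ih =>
      by_cases hp : p = e
      · rw [hp]
      · have h3 : π (inlP D D' p) = inlP D D' (D.succ p) := by
          simp only [π, Equiv.Perm.mul_apply]
          rw [Equiv.swap_apply_of_ne_of_ne, succ_inlP]
          · exact fun hpe => hp (inlP_injective hpe)
          · exact inlP_ne_inrP _ _
        exact (hstep _).trans (by rw [h3]; exact ih _ (by rwa [pow_succ, Equiv.Perm.mul_apply] at hn))
  have h2 : ∀ p, π.SameCycle (inrP D D' p) (inrP D D' f) := by
    intro p
    obtain ⟨n, hn⟩ := (h'.2 p f).exists_nat_pow_eq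
    induction n generalizing p with
    | zero => rw [← hn]; exact .refl _ _
    | succ n ih =>
      by_cases hp : p = f
      · rw [hp]
      · have h3 : π (inrP D D' p) = inrP D D' (D'.succ p) := by
          simp only [π, Equiv.Perm.mul_apply]
          rw [Equiv.swap_apply_of_ne_of_ne, succ_inrP]
          · exact (inlP_ne_inrP _ _).symm
          · exact fun hpe => hp (inrP_injective hpe)
        exact (hstep _).trans (by rw [h3]; exact ih _ (by rwa [pow_succ, Equiv.Perm.mul_apply] at hn))
  have h3 : π.SameCycle (inlP D D' e) (inrP D D' f) := by
    have : π (inlP D D' e) = inrP D D' (D'.succ f) := by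
      simp only [π, Equiv.Perm.mul_apply, Equiv.swap_apply_left, succ_inrP]
    exact (hstep _).trans (by rw [this]; exact h2 _)
  have key : ∀ p, π.SameCycle p (inlP D D' e) := forall_passage.mpr
    ⟨h1, fun p => (h2 p).trans h3.symm⟩
  intro p q
  exact (key p).trans (key q).symm

theorem numVirtual_disjointUnion :
    (D.disjointUnion D').numVirtual = D.numVirtual + D'.numVirtual := by
  unfold numVirtual
  rw [← Fintype.card_sum]
  exact Fintype.card_congr Equiv.subtypeSum

theorem numClassical_disjointUnion :
    (D.disjointUnion D').numClassical = D.numClassical + D'.numClassical := by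
  unfold numClassical
  rw [← Fintype.card_sum]
  exact Fintype.card_congr (classicalSum D D').symm

theorem IsMDiagram.connectedSum (hD : D.IsMDiagram) (hD' : D'.IsMDiagram) {κ : SumType}
    {e : D.Passage} {f : D'.Passage} (he : D.HasEdgeType κ e) (hf : D'.HasEdgeType κ f) :
    ∃ h : (D.connectedSum D' e f).IsMDiagram, (VirtualLink.of _ h.planar).invariants =
      (κ.sign * ((VirtualLink.of D hD.planar).invariants.1 *
        (VirtualLink.of D' hD'.planar).invariants.1),
        (VirtualLink.of D hD.planar).invariants.2 + (VirtualLink.of D' hD'.planar).invariants.2) := by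
  obtain ⟨h, hu⟩ := hD.disjointUnion hD'
  have hpair := (disjointUnion_special hD.proper hD.special hD'.proper hD'.special).2.2.2.2.1
    κ e f he hf
  obtain ⟨g, hg⟩ := h.surgery hpair (hD.planar.connectedSum hD'.planar e f)
  rw [hu] at hg
  exact ⟨g, hg⟩

/-- After a connected sum, all edges have the same types as before. -/
theorem hasEdgeType_connectedSum (hD : D.IsMDiagram) (hD' : D'.IsMDiagram) {κ κ' : SumType}
    {e : D.Passage} {f : D'.Passage} (he : D.HasEdgeType κ e) (hf : D'.HasEdgeType κ f)
    {p : D'.Passage} (hp : D'.HasEdgeType κ' p) :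
    (D.connectedSum D' e f).HasEdgeType κ' (inrP D D' p) := by
  obtain ⟨h1, h2, -, h4, h5, -⟩ :=
    disjointUnion_special hD.proper hD.special hD'.proper hD'.special
  exact (exists_surgery h1 h2 (h5 κ e f he hf)).2.2.1 κ' _ ((h4 κ' p).mpr hp)

end ConnectedSum

end Diagram

namespace Diagram

/-! ### Sums along schemes -/

section Schemes

/-- A knot with an `M`-diagram which has both pre-critical and post-critical edges, so that both types
of special sums can be performed with it. -/
structure IsSummand (A : Diagram) : Prop where
  isMDiagram : A.IsMDiagram
  isKnot : A.IsKnot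
  exists_edge : ∀ κ, ∃ e, A.HasEdgeType κ e

variable {A : Diagram} (hA : A.IsSummand)

/-- The invariants of a chain, for a sequence `eps` which obeys the recursion of the alternating special
sums. The last copy keeps edges of both types, so that the chain can be continued. -/
theorem IsChain.invariants {κ : SumType} {b : ℕ} {eps : ℕ → ℤˣ}
    (hinv : (VirtualLink.of A hA.isMDiagram.planar).invariants = (eps 1, b))
    (heps : ∀ n, 1 ≤ n → eps (n + 1) =
      (if n % 2 = 1 then κ else κ.other).sign * (eps n * eps 1))
    {n : ℕ} {D : Diagram} {L : Set D.C} (hD : IsChain A κ n D L) :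
    1 ≤ n ∧ ∃ h : D.IsMDiagram, D.IsKnot ∧ D.numVirtual = n * A.numVirtual ∧
      D.numClassical = n * A.numClassical ∧
      (VirtualLink.of D h.planar).invariants = (eps n, n * b) ∧
      ∀ κ', ∃ e : D.Passage, e.1 ∈ L ∧ D.HasEdgeType κ' e := by
  induction hD with
  | one =>
    refine ⟨le_rfl, hA.isMDiagram, hA.isKnot, (one_mul _).symm, (one_mul _).symm, by simpa using hinv,
      fun κ' => ?_⟩
    obtain ⟨e, he⟩ := hA.exists_edge κ'
    exact ⟨e, Set.mem_univ _, he⟩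
  | succ n D L h v e w f he hv hw ih =>
    obtain ⟨hn, hD, hk, h1, h2, h3, -⟩ := ih
    obtain ⟨hM, hi⟩ := hD.connectedSum hA.isMDiagram ⟨v, hv⟩ ⟨w, hw⟩
    refine ⟨by omega, hM, hk.connectedSum hD.proper.1 hA.isKnot hA.isMDiagram.proper.1 e f, ?_, ?_, ?_,
      fun κ' => ?_⟩
    · exact numVirtual_disjointUnion.trans (by rw [h1]; ring)
    · exact numClassical_disjointUnion.trans (by rw [h2]; ring)
    · rw [hi, h3, hinv, heps n hn]
      simp only [Prod.mk.injEq, true_and]; ring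
    · obtain ⟨p, hp⟩ := hA.exists_edge κ'
      exact ⟨inrP D A p, ⟨p.1, rfl⟩,
        hasEdgeType_connectedSum hD hA.isMDiagram ⟨v, hv⟩ ⟨w, hw⟩ hp⟩

theorem exists_isChain {κ : SumType} {b : ℕ} {eps : ℕ → ℤˣ}
    (hinv : (VirtualLink.of A hA.isMDiagram.planar).invariants = (eps 1, b))
    (heps : ∀ n, 1 ≤ n → eps (n + 1) =
      (if n % 2 = 1 then κ else κ.other).sign * (eps n * eps 1))
    {n : ℕ} (hn : 1 ≤ n) : ∃ (D : Diagram) (L : Set D.C), IsChain A κ n D L := by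
  induction n, hn using Nat.le_induction with
  | base => exact ⟨A, Set.univ, .one⟩
  | succ n hn ih =>
    obtain ⟨D, L, h⟩ := ih
    obtain ⟨-, -, -, -, -, -, hL⟩ := h.invariants hA hinv heps
    obtain ⟨e, heL, v, he⟩ := hL (if n % 2 = 1 then κ else κ.other)
    obtain ⟨f, w, hf⟩ := hA.exists_edge (if n % 2 = 1 then κ else κ.other)
    exact ⟨_, _, .succ n D L h v e w f heL he hf⟩

theorem sign_eq_neg_one_pow_waves (κ : SumType) : κ.sign = (-1) ^ κ.waves := by
  cases κ <;> simp [SumType.sign, SumType.waves]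

section QSums

variable (hQ : knotQ.IsSummand)

theorem IsQSum.invariants {r w : ℕ} {D : Diagram} (hinv : (VirtualLink.of knotQ
    hQ.isMDiagram.planar).invariants = (1, 1)) (hv : knotQ.numVirtual = 2)
    (hc : knotQ.numClassical = 3) (hD : IsQSum r w D) : ∃ h : D.IsMDiagram,
      D.numVirtual = 2 * r ∧ D.numClassical = 3 * r ∧
      (VirtualLink.of D h.planar).invariants = ((-1) ^ w, r) := by
  induction hD with
  | single => exact ⟨hQ.isMDiagram, hv, hc, by simpa using hinv⟩
  | union r w r' w' D D' h h' ih ih' =>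
    obtain ⟨hD, h1, h2, h3⟩ := ih
    obtain ⟨hD', h1', h2', h3'⟩ := ih'
    obtain ⟨hM, hi⟩ := hD.disjointUnion hD'
    refine ⟨hM, ?_, ?_, by rw [hi, h3, h3', pow_add]⟩
    · rw [numVirtual_disjointUnion, h1, h1']; ring
    · rw [numClassical_disjointUnion, h2, h2']; ring
  | sum r w D h κ e f hef hp ih =>
    obtain ⟨hD, h1, h2, h3⟩ := ih
    obtain ⟨hM, hi⟩ := hD.surgery hef hp
    refine ⟨hM, h1, h2, ?_⟩
    rw [hi, h3, sign_eq_neg_one_pow_waves, pow_add, mul_comm]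

theorem exists_isQKnot_succ {r w : ℕ} {D : Diagram} (hinv : (VirtualLink.of knotQ
    hQ.isMDiagram.planar).invariants = (1, 1)) (hv : knotQ.numVirtual = 2)
    (hc : knotQ.numClassical = 3) (hD : IsQKnot r w D)
    (hL : ∀ κ', ∃ e : D.Passage, D.HasEdgeType κ' e) (κ : SumType) :
    ∃ D' : Diagram, IsQKnot (r + 1) (w + κ.waves) D' ∧
      ∀ κ', ∃ e : D'.Passage, D'.HasEdgeType κ' e := by
  obtain ⟨hM, -⟩ := hD.1.invariants hQ hinv hv hc
  have hM' := hQ.isMDiagram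
  obtain ⟨e, he⟩ := hL κ
  obtain ⟨f, hf⟩ := hQ.exists_edge κ
  have hpair := (disjointUnion_special hM.proper hM.special hM'.proper hM'.special).2.2.2.2.1
    κ e f he hf
  refine ⟨D.connectedSum knotQ e f, ⟨?_, hD.2.connectedSum hM.proper.1 hQ.isKnot hM'.proper.1 e f⟩,
    fun κ' => ?_⟩
  · exact .sum (r + 1) w _ (.union r w 1 0 _ _ hD.1 .single) κ _ _ hpair
      (hM.planar.connectedSum hM'.planar e f)
  · obtain ⟨p, hp⟩ := hQ.exists_edge κ'
    exact ⟨_, hasEdgeType_connectedSum hM hM' he hf hp⟩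

/-- There are `Q`-knots without pre-critical sums and with exactly one pre-critical sum. -/
theorem exists_isQKnot (hinv : (VirtualLink.of knotQ
    hQ.isMDiagram.planar).invariants = (1, 1)) (hv : knotQ.numVirtual = 2)
    (hc : knotQ.numClassical = 3) {r : ℕ} (hr : 2 ≤ r) (κ : SumType) :
    ∃ D, IsQKnot r κ.waves D ∧ ∀ κ', ∃ e : D.Passage, D.HasEdgeType κ' e := by
  induction r, hr using Nat.le_induction with
  | base =>
    obtain ⟨D, hD⟩ := exists_isQKnot_succ hQ hinv hv hc ⟨.single, hQ.isKnot⟩ hQ.exists_edge κ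
    exact ⟨D, by simpa using hD⟩
  | succ r hr ih =>
    obtain ⟨D, hD, hL⟩ := ih
    exact exists_isQKnot_succ hQ hinv hv hc hD hL .postCritical

end QSums

end Schemes

end Diagram

namespace Diagram

/-! ### Alternating closed braids -/

section Braids

theorem isPlanar_braidClosure (m : ℕ) (kind : Fin (m + 1) → CrossingKind) :
    (braidClosure (m + 1) kind).IsPlanar := by
  intro f hf
  replace hf : ∀ c : Fin (m + 1), f ((finRotate (m + 1)).symm c, false) +
    f ((finRotate (m + 1)).symm c, true) = f (c, true) + f (c, false) := hf
  -- the face to the right of the braid has the value `0`, the bigon behind the crossing `c` the value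
  -- `f (c, true)`, the face to the left the total flow, which is the same behind all crossings
  let l : Fin (m + 1) × Bool → ℤ := fun p => if p.2 then f p else f (p.1, false) + f (p.1, true)
  let r : Fin (m + 1) × Bool → ℤ := fun p => if p.2 then 0 else f (p.1, true)
  have h1 : ∀ p, f p = l p - r p := by
    rintro ⟨c, b⟩
    cases b <;> simp [l, r]
  have h2 : ∀ c, l ((finRotate (m + 1)).symm c, false) = l (c, false) ∧
      l (c, true) = r (c, false) ∧ r (c, true) = r ((finRotate (m + 1)).symm c, true) ∧
      r ((finRotate (m + 1)).symm c, false) = l ((finRotate (m + 1)).symm c, true) := by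
    intro c
    have := hf c
    refine ⟨?_, rfl, rfl, rfl⟩
    simp only [l, Bool.false_eq_true, if_false]
    omega
  exact ⟨l, r, h1, h2⟩

/-- The closed 2-braid with `2 n + 1` crossings, alternately of the kind `κ` and virtual. -/
abbrev altBraid (n : ℕ) (κ : CrossingKind) : Diagram :=
  braidClosure (2 * n + 1) fun i => if i.1 % 2 = 0 then κ else .virtual

variable {n : ℕ} {κ : CrossingKind}

theorem kind_altBraid (c : (altBraid n κ).C) :
    (altBraid n κ).kind c = if c.val % 2 = 0 then κ else .virtual := rfl

theorem succ_altBraid {p q : (altBraid n κ).Passage} (h : (altBraid n κ).succ p = q) :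
    q.1.val = (if p.1.val = 2 * n then 0 else p.1.val + 1) ∧ q.2 = !p.2 := by
  subst h
  obtain ⟨⟨i, hi⟩, b⟩ := p
  refine ⟨?_, rfl⟩
  change (finRotate (2 * n + 1) ⟨i, hi⟩ : ℕ) = _
  rw [coe_finRotate]
  simp [Fin.ext_iff]

theorem isKnot_altBraid : (altBraid n κ).IsKnot := by
  refine (isKnot_iff rfl).mpr ⟨⟨((0 : Fin (2 * n + 1)), false)⟩, ?_⟩
  let o : (altBraid n κ).Passage := ((0 : Fin (2 * n + 1)), false)
  have hpow : ∀ k, (((altBraid n κ).succ ^ k) o).1.val = k % (2 * n + 1) ∧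
      (((altBraid n κ).succ ^ k) o).2 = decide (k % 2 = 1) := by
    intro k
    induction k with
    | zero => simp [o]
    | succ k ih =>
      rw [pow_succ', Equiv.Perm.mul_apply]
      obtain ⟨h1, h2⟩ := succ_altBraid (p := ((altBraid n κ).succ ^ k) o) rfl
      rw [h1, h2, ih.1, ih.2]
      constructor
      · have := Nat.mod_lt k (show 0 < 2 * n + 1 by omega)
        split_ifs with h
        · symm
          rw [Nat.add_mod, h]
          rcases n with _ | n
          · simp
          · rw [Nat.mod_eq_of_lt (show 1 < 2 * (n + 1) + 1 by omega), Nat.mod_self]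
        · symm
          rw [Nat.add_mod, Nat.mod_eq_of_lt (show 1 < 2 * n + 1 by omega),
            Nat.mod_eq_of_lt (by omega)]
      · rcases Nat.mod_two_eq_zero_or_one k with h | h <;> simp [Nat.add_mod, h]
  -- the number of crossings is odd, so that the passage is reached in the first or second round
  have key : ∀ p, (altBraid n κ).succ.SameCycle o p := by
    rintro ⟨⟨i, hi⟩, b⟩
    replace hi : i < 2 * n + 1 := hi
    have hex : ∃ k : ℕ, k % (2 * n + 1) = i ∧ decide (k % 2 = 1) = b := by
      by_cases h : decide (i % 2 = 1) = b
      · exact ⟨i, Nat.mod_eq_of_lt hi, h⟩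
      · refine ⟨i + (2 * n + 1), by rw [Nat.add_mod_right, Nat.mod_eq_of_lt hi], ?_⟩
        cases b <;> simp only [decide_eq_false_iff_not, decide_eq_true_eq] at h ⊢ <;> omega
    obtain ⟨k, h1, h2⟩ := hex
    refine ⟨k, ?_⟩
    rw [zpow_natCast]
    exact Prod.ext (Fin.ext ((hpow k).1.trans h1)) ((hpow k).2.trans h2)
  exact fun p q => (key p).symm.trans (key q)

theorem numVirtual_add_numClassical (D : Diagram) :
    D.numVirtual + D.numClassical = Fintype.card D.C := by
  unfold numVirtual numClassical Classical
  rw [← Fintype.card_sum]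
  exact Fintype.card_congr (Equiv.sumCompl _)

/-- The classical crossings of an alternating braid are those with an even number. -/
def altClassical (n : ℕ) (hκ : κ ≠ .virtual) : Fin (n + 1) ≃ (altBraid n κ).Classical where
  toFun k := ⟨⟨2 * k.1, by omega⟩, fun h => hκ ((if_pos (Nat.mul_mod_right 2 k)).symm.trans h)⟩
  invFun v := ⟨v.1.1 / 2, by have h : v.1.1 < 2 * n + 1 := v.1.2; omega⟩
  left_inv k := by ext; simp
  right_inv v := by
    obtain ⟨⟨i, hi⟩, h⟩ := v
    have : i % 2 = 0 := by
      by_contra h0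
      exact h (if_neg h0)
    refine Subtype.ext (Fin.ext ?_)
    change 2 * (i / 2) = i
    omega

theorem numClassical_altBraid (hκ : κ ≠ .virtual) : (altBraid n κ).numClassical = n + 1 := by
  rw [numClassical, ← Fintype.card_congr (altClassical n hκ), Fintype.card_fin]

theorem numVirtual_altBraid (hκ : κ ≠ .virtual) : (altBraid n κ).numVirtual = n := by
  have h1 := (altBraid n κ).numVirtual_add_numClassical
  have h2 : Fintype.card (altBraid n κ).C = 2 * n + 1 := Fintype.card_fin _
  rw [numClassical_altBraid hκ, h2] at h1
  omega

theorem shift_altBraid (hκ : κ ≠ .virtual) (p : (altBraid n κ).Passage) :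
    (altBraid n κ).shift p = if p.1.val % 2 = 0 then 0 else if p.2 then 1 else -1 := by
  by_cases h : p.1.val % 2 = 0 <;> simp [shift, kind_altBraid, h, hκ]

theorem isUnder_altBraid (p : (altBraid n κ).Passage) :
    (altBraid n κ).IsUnder p ↔ p.1.val % 2 = 0 ∧
      ((κ = .positive ∧ p.2 = false) ∨ (κ = .negative ∧ p.2 = true)) := by
  by_cases h : p.1.val % 2 = 0 <;> simp [IsUnder, kind_altBraid, h]

/-- The classical crossing of an alternating braid with the number `i` or `i - 1`. -/
def altCrossing (hκ : κ ≠ .virtual) (i : ℕ) (hi : i < 2 * n + 1) : (altBraid n κ).Classical :=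
  altClassical n hκ ⟨i / 2, by omega⟩

theorem altCrossing_val (hκ : κ ≠ .virtual) (i : ℕ) (hi : i < 2 * n + 1) :
    (altCrossing hκ i hi).1.val = i - i % 2 := by
  change 2 * (i / 2) = _
  omega

theorem altBraid_ext {v w : (altBraid n κ).Classical} : v = w ↔ v.1.val = w.1.val := by
  rw [Subtype.ext_iff]
  exact Fin.ext_iff (n := 2 * n + 1)

theorem altBraid_even (hκ : κ ≠ .virtual) (v : (altBraid n κ).Classical) : v.1.val % 2 = 0 := by
  obtain ⟨k, rfl⟩ := (altClassical n hκ).surjective v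
  exact Nat.mul_mod_right 2 k

/-- The long arcs of a closed alternating braid with positive crossings. The arc emanating from the last
crossing runs around the braid and decreases all the time, all other long arcs go to
the next classical crossing and pass through one increasing virtual crossing. -/
def positiveLabelling (n : ℕ) : (altBraid n .positive).Labelling where
  own p := altCrossing (by simp) (if p.2 = decide (p.1.val % 2 = 0) then 2 * n else p.1.val)
    (by have : p.1.val < 2 * n + 1 := p.1.2; split_ifs <;> omega)
  pos p := if p.2 = decide (p.1.val % 2 = 0) then p.1.val + 1 else p.1.val % 2
  inc p := if p.2 = decide (p.1.val % 2 = 0) then 0 else (p.1.val % 2 : ℕ)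
  dec p := if p.2 = decide (p.1.val % 2 = 0) then ((p.1.val + 1) / 2 : ℕ) else 0
  top v := if v.1.val = 2 * n then 0 else 1
  under v := by
    have h := (altBraid n .positive).isUnder_underpass v
    have h1 : ((altBraid n .positive).underpass v).1 = v.1 := rfl
    rw [isUnder_altBraid] at h
    have h3 : ((altBraid n .positive).underpass v).2 = false := by simpa using h.2
    have h2 := altBraid_even (by simp) v
    simp only [altBraid_ext, altCrossing_val, h1, h3]
    grind
  step p hu := by
    obtain ⟨h1, h2⟩ := succ_altBraid (p := p) rfl
    have h3 := shift_altBraid (κ := .positive) (by simp) ((altBraid n .positive).succ p)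
    have h4 : p.1.val < 2 * n + 1 := p.1.2
    rw [isUnder_altBraid] at hu
    simp only [altBraid_ext, altCrossing_val, h3, h1, h2] at hu ⊢
    cases hb : p.2 <;> simp only [hb] at hu ⊢ <;> grind
  inc_le p := by
    have h4 : p.1.val < 2 * n + 1 := p.1.2
    simp only [altCrossing_val]
    grind
  exists_crit v := by
    have h1 : v.1.val < 2 * n + 1 := v.1.2
    have h2 := altBraid_even (by simp) v
    by_cases hv : v.1.val = 2 * n
    · refine ⟨(v.1, false), ?_⟩
      simp only [altBraid_ext, altCrossing_val]
      grind
    · refine ⟨((⟨v.1.val + 1, by omega⟩ : Fin (2 * n + 1)), true), ?_⟩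
      simp only [altBraid_ext, altCrossing_val]
      grind

theorem crit_positiveLabelling (w : (altBraid n .positive).Classical)
    (p : (altBraid n .positive).Passage) : (positiveLabelling n).Crit w p ↔
      (w.1.val = 2 * n ∧ ((p.1.val = 2 * n ∧ p.2 = false) ∨ (p.1.val = 0 ∧ p.2 = true))) ∨
      (w.1.val < 2 * n ∧ p.1.val = w.1.val + 1 ∧ p.2 = true) := by
  have h1 : w.1.val < 2 * n + 1 := w.1.2
  have h2 := altBraid_even (by simp) w
  have h3 : p.1.val < 2 * n + 1 := p.1.2
  simp only [positiveLabelling, Labelling.Crit, altBraid_ext, altCrossing_val]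
  cases hb : p.2 <;> grind

/-- The long arcs of a closed alternating braid with negative crossings. The arc emanating from the last
crossing runs around the braid and increases all the time, all other long arcs go to
the next classical crossing and pass through one decreasing virtual crossing. -/
def negativeLabelling (n : ℕ) : (altBraid n .negative).Labelling where
  own p := altCrossing (by simp) (if p.2 = decide (p.1.val % 2 = 1) then 2 * n else p.1.val)
    (by have : p.1.val < 2 * n + 1 := p.1.2; split_ifs <;> omega)
  pos p := if p.2 = decide (p.1.val % 2 = 1) then p.1.val + 1 else p.1.val % 2
  inc p := if p.2 = decide (p.1.val % 2 = 1) then ((p.1.val + 1) / 2 : ℕ) else 0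
  dec p := if p.2 = decide (p.1.val % 2 = 1) then 0 else (p.1.val % 2 : ℕ)
  top v := if v.1.val = 2 * n then n else 0
  under v := by
    have h := (altBraid n .negative).isUnder_underpass v
    have h1 : ((altBraid n .negative).underpass v).1 = v.1 := rfl
    rw [isUnder_altBraid] at h
    have h3 : ((altBraid n .negative).underpass v).2 = true := by simpa using h.2
    have h2 := altBraid_even (by simp) v
    simp only [altBraid_ext, altCrossing_val, h1, h3]
    grind
  step p hu := by
    obtain ⟨h1, h2⟩ := succ_altBraid (p := p) rfl
    have h3 := shift_altBraid (κ := .negative) (by simp) ((altBraid n .negative).succ p)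
    have h4 : p.1.val < 2 * n + 1 := p.1.2
    rw [isUnder_altBraid] at hu
    simp only [altBraid_ext, altCrossing_val, h3, h1, h2] at hu ⊢
    cases hb : p.2 <;> simp only [hb] at hu ⊢ <;> grind
  inc_le p := by
    have h4 : p.1.val < 2 * n + 1 := p.1.2
    simp only [altCrossing_val]
    grind
  exists_crit v := by
    have h1 : v.1.val < 2 * n + 1 := v.1.2
    have h2 := altBraid_even (by simp) v
    refine ⟨(v.1, decide (v.1.val ≠ 2 * n)), ?_⟩
    simp only [altBraid_ext, altCrossing_val]
    grind

theorem crit_negativeLabelling (hn : 1 ≤ n) (w : (altBraid n .negative).Classical)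
    (p : (altBraid n .negative).Passage) : (negativeLabelling n).Crit w p ↔
      (w.1.val = 2 * n ∧ ((p.1.val = 2 * n ∧ p.2 = false) ∨ (p.1.val + 1 = 2 * n ∧ p.2 = true))) ∨
      (w.1.val < 2 * n ∧ p.1.val = w.1.val ∧ p.2 = true) := by
  have h1 : w.1.val < 2 * n + 1 := w.1.2
  have h2 := altBraid_even (by simp) w
  have h3 : p.1.val < 2 * n + 1 := p.1.2
  simp only [negativeLabelling, Labelling.Crit, altBraid_ext, altCrossing_val]
  cases hb : p.2 <;> grind

end Braids

end Diagram

namespace Diagram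

section AlternatingBraids

variable {n : ℕ}

theorem positive_passages (v : (altBraid n .positive).Classical) :
    ((altBraid n .positive).underpass v).1.val = v.1.val ∧
    ((altBraid n .positive).underpass v).2 = false ∧
    ((altBraid n .positive).overpass v).1.val = v.1.val ∧
    ((altBraid n .positive).overpass v).2 = true ∧
    v.1.val = (if ((altBraid n .positive).succ.symm ((altBraid n .positive).underpass v)).1.val =
      2 * n then 0 else
      ((altBraid n .positive).succ.symm ((altBraid n .positive).underpass v)).1.val + 1) ∧
    ((altBraid n .positive).succ.symm ((altBraid n .positive).underpass v)).2 = true := by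
  have h := (altBraid n .positive).isUnder_underpass v
  rw [isUnder_altBraid] at h
  have h1 : ((altBraid n .positive).underpass v).2 = false := by simpa using h.2
  have h2 := succ_altBraid ((altBraid n .positive).succ.apply_symm_apply
    ((altBraid n .positive).underpass v))
  refine ⟨rfl, h1, rfl, ?_, h2.1, ?_⟩
  · rw [overpass_eq]; simp [opp, h1]
  · simpa [h1] using h2.2

theorem negative_passages (v : (altBraid n .negative).Classical) :
    ((altBraid n .negative).underpass v).1.val = v.1.val ∧
    ((altBraid n .negative).underpass v).2 = true ∧
    ((altBraid n .negative).overpass v).1.val = v.1.val ∧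
    ((altBraid n .negative).overpass v).2 = false ∧
    v.1.val = (if ((altBraid n .negative).succ.symm ((altBraid n .negative).underpass v)).1.val =
      2 * n then 0 else
      ((altBraid n .negative).succ.symm ((altBraid n .negative).underpass v)).1.val + 1) ∧
    ((altBraid n .negative).succ.symm ((altBraid n .negative).underpass v)).2 = false := by
  have h := (altBraid n .negative).isUnder_underpass v
  rw [isUnder_altBraid] at h
  have h1 : ((altBraid n .negative).underpass v).2 = true := by simpa using h.2
  have h2 := succ_altBraid ((altBraid n .negative).succ.apply_symm_apply
    ((altBraid n .negative).underpass v))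
  refine ⟨rfl, h1, rfl, ?_, h2.1, ?_⟩
  · rw [overpass_eq]; simp [opp, h1]
  · simpa [h1] using h2.2

/-- The critical arcs of a positive alternating braid, at the underpass, the overpass, and before the
underpass of a classical crossing. -/
theorem positive_crit (hn : 1 ≤ n) (v w : (altBraid n .positive).Classical) :
    ((positiveLabelling n).Crit w ((altBraid n .positive).underpass v) ↔
      v.1.val = 2 * n ∧ w.1.val = 2 * n) ∧
    ((positiveLabelling n).Crit w ((altBraid n .positive).overpass v) ↔
      v.1.val = 0 ∧ w.1.val = 2 * n) ∧
    ((positiveLabelling n).Crit w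
      ((altBraid n .positive).succ.symm ((altBraid n .positive).underpass v)) ↔
      v.1.val = w.1.val + 2) := by
  obtain ⟨h1, h2, h3, h4, h5, h6⟩ := positive_passages v
  have h7 := altBraid_even (by simp) v
  have h8 := altBraid_even (by simp) w
  have h9 : v.1.val < 2 * n + 1 := v.1.2
  have h10 : w.1.val < 2 * n + 1 := w.1.2
  rw [crit_positiveLabelling, crit_positiveLabelling, crit_positiveLabelling, h1, h2, h3, h4, h6]
  generalize ((altBraid n .positive).succ.symm ((altBraid n .positive).underpass v)).1.val = q at *
  refine ⟨?_, ?_, ?_⟩ <;> grind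

theorem negative_crit (hn : 1 ≤ n) (v w : (altBraid n .negative).Classical) :
    ((negativeLabelling n).Crit w ((altBraid n .negative).underpass v) ↔
      v.1.val = w.1.val ∧ w.1.val < 2 * n) ∧
    ((negativeLabelling n).Crit w ((altBraid n .negative).overpass v) ↔
      v.1.val = 2 * n ∧ w.1.val = 2 * n) ∧
    ((negativeLabelling n).Crit w
      ((altBraid n .negative).succ.symm ((altBraid n .negative).underpass v)) ↔
      v.1.val = 0 ∧ w.1.val = 2 * n) := by
  obtain ⟨h1, h2, h3, h4, h5, h6⟩ := negative_passages v
  have h7 := altBraid_even (by simp) v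
  have h8 := altBraid_even (by simp) w
  have h9 : v.1.val < 2 * n + 1 := v.1.2
  have h10 : w.1.val < 2 * n + 1 := w.1.2
  rw [crit_negativeLabelling hn, crit_negativeLabelling hn, crit_negativeLabelling hn, h1, h2, h3,
    h4, h6]
  generalize ((altBraid n .negative).succ.symm ((altBraid n .negative).underpass v)).1.val = q at *
  refine ⟨?_, ?_, ?_⟩ <;> grind

theorem positive_incident (hn : 1 ≤ n) (v w : (altBraid n .positive).Classical) :
    (altBraid n .positive).IncidentCritical v w ↔
      (w.1.val = 2 * n ∧ (v.1.val = 0 ∨ v.1.val = 2 * n)) ∨ v.1.val = w.1.val + 2 := by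
  obtain ⟨h1, h2, h3⟩ := positive_crit hn v w
  rw [(positiveLabelling n).incidentCritical_iff, h1, h2, h3]
  tauto

theorem negative_incident (hn : 1 ≤ n) (v w : (altBraid n .negative).Classical) :
    (altBraid n .negative).IncidentCritical v w ↔
      (v.1.val = w.1.val) ∨ (v.1.val = 0 ∧ w.1.val = 2 * n) := by
  obtain ⟨h1, h2, h3⟩ := negative_crit hn v w
  have h10 : w.1.val < 2 * n + 1 := w.1.2
  rw [(negativeLabelling n).incidentCritical_iff, h1, h2, h3]
  omega

/-- The only pairing for a positive alternating braid. -/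
def altRotate (n : ℕ) : Equiv.Perm (altBraid n .positive).Classical :=
  (altClassical n (by simp)).permCongr (finRotate (n + 1))⁻¹

theorem altRotate_spec (v : (altBraid n .positive).Classical) :
    v.1.val = if (altRotate n v).1.val = 2 * n then 0 else (altRotate n v).1.val + 2 := by
  obtain ⟨k, rfl⟩ := (altClassical n (κ := .positive) (by simp)).surjective v
  obtain ⟨j, rfl⟩ := (finRotate (n + 1)).surjective k
  have h1 : altRotate n (altClassical n (by simp) (finRotate (n + 1) j)) =
      altClassical n (by simp) j := by
    simp [altRotate, Equiv.permCongr_apply]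
  rw [h1]
  change 2 * (finRotate (n + 1) j : ℕ) = if 2 * j.val = 2 * n then 0 else 2 * j.val + 2
  rw [coe_finRotate]
  have h2 : j = Fin.last n ↔ j.val = n := by rw [Fin.ext_iff, Fin.val_last]
  by_cases h : j.val = n
  · rw [if_pos (h2.mpr h), if_pos (by omega)]
  · rw [if_neg (fun h' => h (h2.mp h')), if_neg (by omega)]; ring

theorem positive_pairing_unique (hn : 1 ≤ n) (τ : Equiv.Perm (altBraid n .positive).Classical)
    (hτ : ∀ v, (altBraid n .positive).IncidentCritical v (τ v)) : τ = altRotate n := by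
  ext1 v
  rw [altBraid_ext]
  have h1 := altRotate_spec v
  have h2 := (positive_incident hn _ _).mp (hτ v)
  let o := altClassical n (κ := .positive) (by simp) 0
  have h3 := (positive_incident hn _ _).mp (hτ o)
  have ho : o.1.val = 0 := rfl
  have h4 : τ v = τ o → v.1.val = o.1.val := fun h => by rw [τ.injective h]
  rw [altBraid_ext] at h4
  have h5 : (τ v).1.val < 2 * n + 1 := (τ v).1.2
  have h6 : (altRotate n v).1.val < 2 * n + 1 := (altRotate n v).1.2
  split_ifs at h1 <;> omega

theorem negative_pairing_unique (hn : 1 ≤ n) (τ : Equiv.Perm (altBraid n .negative).Classical)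
    (hτ : ∀ v, (altBraid n .negative).IncidentCritical v (τ v)) : τ = 1 := by
  ext1 v
  rw [altBraid_ext, Equiv.Perm.one_apply]
  have h2 := (negative_incident hn _ _).mp (hτ v)
  let o := altClassical n (κ := .negative) (by simp) (Fin.last n)
  have h3 := (negative_incident hn _ _).mp (hτ o)
  have ho : o.1.val = 2 * n := rfl
  have h4 : τ v = τ o → v.1.val = o.1.val := fun h => by rw [τ.injective h]
  rw [altBraid_ext] at h4
  omega

theorem isMDiagram_positive (hn : 1 ≤ n) : (altBraid n .positive).IsMDiagram := by
  refine ⟨isPlanar_braidClosure _ _, (positiveLabelling n).isProper rfl,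
    (positiveLabelling n).isSpecial, fun v hv => ?_, altRotate n, fun v => ?_,
    positive_pairing_unique hn⟩
  · obtain ⟨h1, h2, h3, h4, h5, h6⟩ := positive_passages v
    rw [(positiveLabelling n).isCyclicCrossing_iff] at hv
    simp only [positiveLabelling, altBraid_ext, altCrossing_val, h3, h4, h6] at hv
    generalize ((altBraid n .positive).succ.symm ((altBraid n .positive).underpass v)).1.val = q at *
    have h7 := altBraid_even (by simp) v
    have h9 : v.1.val < 2 * n + 1 := v.1.2
    grind
  · rw [positive_incident hn]
    have h1 := altRotate_spec v
    split_ifs at h1 <;> omega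

theorem isMDiagram_negative (hn : 1 ≤ n) : (altBraid n .negative).IsMDiagram := by
  refine ⟨isPlanar_braidClosure _ _, (negativeLabelling n).isProper rfl,
    (negativeLabelling n).isSpecial, fun v hv => ?_, 1, fun v => ?_,
    negative_pairing_unique hn⟩
  · obtain ⟨h1, h2, h3, h4, h5, h6⟩ := negative_passages v
    rw [(negativeLabelling n).isCyclicCrossing_iff] at hv
    simp only [negativeLabelling, altBraid_ext, altCrossing_val, h3, h4, h6] at hv
    generalize ((altBraid n .negative).succ.symm ((altBraid n .negative).underpass v)).1.val = q at *
    have h7 := altBraid_even (by simp) v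
    have h9 : v.1.val < 2 * n + 1 := v.1.2
    grind
  · rw [negative_incident hn]
    left; rfl

theorem invariants_positive (hn : 1 ≤ n) :
    (VirtualLink.of _ (isMDiagram_positive hn).planar).invariants = (1, 1) := by
  classical
  refine VirtualLink.invariants_eq (isMDiagram_positive hn) (a := n) ?_
  rw [det_tMatrix (positive_pairing_unique hn)]
  have hT : ∀ k : Fin (n + 1), (altBraid n .positive).tMatrix (altClassical n (by simp) k)
      (altRotate n (altClassical n (by simp) k)) =
      if k = 0 then LaurentPolynomial.T 1 - 1 else -LaurentPolynomial.T 1 := by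
    intro k
    set v := altClassical n (κ := .positive) (by simp) k with hv
    have hkv : v.1.val = 2 * k.val := rfl
    have hk : k = 0 ↔ v.1.val = 0 := by rw [hkv, Fin.ext_iff, Fin.val_zero]; omega
    have hkind : ((altBraid n .positive).kind v.1).sign = 1 :=
      congrArg CrossingKind.sign (if_pos (altBraid_even (by simp) v))
    obtain ⟨h1, h2, h3⟩ := positive_crit hn v (altRotate n v)
    have h4 := altRotate_spec v
    rw [(positiveLabelling n).tMatrix_apply, hkind, if_congr h1 rfl rfl, if_congr h2 rfl rfl,
      if_congr h3 rfl rfl]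
    by_cases h0 : v.1.val = 0
    · have h5 : (altRotate n v).1.val = 2 * n := by split_ifs at h4 <;> omega
      rw [if_neg (by omega), if_pos ⟨h0, h5⟩, if_neg (by omega), if_pos (hk.mpr h0)]
      ring
    · have h5 : v.1.val = (altRotate n v).1.val + 2 := by split_ifs at h4 <;> omega
      have h6 : v.1.val < 2 * n + 1 := v.1.2
      rw [if_neg (by omega), if_neg (by omega), if_pos h5, if_neg (fun h => h0 (hk.mp h))]
      ring
  rw [← (altClassical n (κ := .positive) (by simp)).prod_comp, Finset.prod_congr rfl fun k _ => hT k,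
    Fin.prod_univ_succ]
  have hsign : Equiv.Perm.sign (altRotate n) = (-1) ^ n := by
    rw [altRotate, Equiv.Perm.sign_permCongr, Equiv.Perm.sign_inv, sign_finRotate,
      Nat.add_sub_cancel]
  rw [hsign]
  simp only [Fin.succ_ne_zero, if_false, if_true, Finset.prod_const, Finset.card_univ,
    Fintype.card_fin, IsSignedForm]
  have hpow : (-LaurentPolynomial.T 1 : ℤ[T;T⁻¹]) ^ n = (-1) ^ n * LaurentPolynomial.T n := by
    rw [neg_pow, LaurentPolynomial.T_pow, mul_one]
  rw [hpow]
  rcases Nat.even_or_odd n with h' | h' <;> simp [h'.neg_one_pow]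

theorem invariants_negative (hn : 1 ≤ n) :
    (VirtualLink.of _ (isMDiagram_negative hn).planar).invariants = (-1, 1) := by
  classical
  refine VirtualLink.invariants_eq (isMDiagram_negative hn) (a := -1) ?_
  rw [det_tMatrix (negative_pairing_unique hn), Equiv.Perm.sign_one, one_smul]
  have hT : ∀ v, (altBraid n .negative).tMatrix v v =
      if v.1.val = 2 * n then LaurentPolynomial.T (-1) - 1 else 1 := by
    intro v
    have hkind : ((altBraid n .negative).kind v.1).sign = -1 :=
      congrArg CrossingKind.sign (if_pos (altBraid_even (by simp) v))
    obtain ⟨h1, h2, h3⟩ := negative_crit hn v v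
    have h6 : v.1.val < 2 * n + 1 := v.1.2
    rw [(negativeLabelling n).tMatrix_apply, hkind, if_congr h1 rfl rfl, if_congr h2 rfl rfl,
      if_congr h3 rfl rfl]
    by_cases h0 : v.1.val = 2 * n
    · rw [if_neg (by omega), if_pos ⟨h0, h0⟩, if_neg (by omega), if_pos h0]
      ring
    · rw [if_pos (by omega), if_neg (by omega), if_neg (by omega), if_neg h0]
      ring
  rw [Finset.prod_eq_single (altClassical n (κ := .negative) (by simp) (Fin.last n))]
  · rw [Equiv.Perm.one_apply, (hT _).trans (if_pos rfl), IsSignedForm, pow_one, mul_sub, mul_assoc,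
      ← LaurentPolynomial.T_add]
    simp
    ring
  · intro v _ hv
    rw [Equiv.Perm.one_apply, hT, if_neg]
    intro h
    exact hv (altBraid_ext.mpr h)
  · simp

theorem isSummand_positive (hn : 1 ≤ n) : (altBraid n .positive).IsSummand := by
  refine ⟨isMDiagram_positive hn, isKnot_altBraid, fun κ => ?_⟩
  cases κ
  · refine ⟨((⟨0, by omega⟩ : Fin (2 * n + 1)), false),
      ((positiveLabelling n).hasEdgeType_iff _ _).mpr ?_⟩
    simp only [Labelling.HasType, positiveLabelling, altCrossing_val]
    grind
  · refine ⟨((⟨1, by omega⟩ : Fin (2 * n + 1)), false),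
      ((positiveLabelling n).hasEdgeType_iff _ _).mpr ?_⟩
    simp only [Labelling.HasType, positiveLabelling]
    grind

theorem isSummand_negative (hn : 1 ≤ n) : (altBraid n .negative).IsSummand := by
  refine ⟨isMDiagram_negative hn, isKnot_altBraid, fun κ => ?_⟩
  cases κ
  · refine ⟨((⟨0, by omega⟩ : Fin (2 * n + 1)), false),
      ((negativeLabelling n).hasEdgeType_iff _ _).mpr ?_⟩
    simp only [Labelling.HasType, negativeLabelling, altCrossing_val]
    grind
  · refine ⟨((⟨1, by omega⟩ : Fin (2 * n + 1)), false),
      ((negativeLabelling n).hasEdgeType_iff _ _).mpr ?_⟩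
    simp only [Labelling.HasType, negativeLabelling]
    grind

end AlternatingBraids

end Diagram

namespace Diagram

/-! ### The diagrams `W_n` -/

section WKnot

variable {n : ℕ}

/-- The position of a passage of `W_n` in the cyclic sequence `wWord`. -/
def wPos (n : ℕ) (p : (wKnot n).Passage) : ℕ := ((wWord n).symm p).val

theorem wPos_lt (p : (wKnot n).Passage) : wPos n p < 4 * n + 4 := ((wWord n).symm p).2

theorem wPos_injective : Function.Injective (wPos n) := fun _ _ h =>
  (wWord n).symm.injective (Fin.ext h)

theorem wPos_wWord (j : Fin (4 * n + 4)) : wPos n (wWord n j) = j :=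
  congrArg Fin.val ((wWord n).symm_apply_apply j)

/-- The inverse of `wWord` in terms of numbers. -/
theorem wPos_eq (p : (wKnot n).Passage) : wPos n p =
    if p.1.val < 2 * n then (if p.2 = decide (p.1.val % 2 = 1) then p.1.val else 4 * n + 1 - p.1.val)
    else if p.1.val = 2 * n then (if p.2 then 2 * n else 4 * n + 3)
    else (if p.2 then 4 * n + 2 else 2 * n + 1) := by
  obtain ⟨⟨i, hi⟩, b⟩ := p
  change (((wWord n).invFun ((⟨i, hi⟩ : Fin (2 * n + 2)), b)) : ℕ) = _
  simp only [wWord]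
  split_ifs <;> rfl

theorem wPos_succ (p : (wKnot n).Passage) :
    wPos n ((wKnot n).succ p) = if wPos n p = 4 * n + 3 then 0 else wPos n p + 1 := by
  obtain ⟨j, rfl⟩ := (wWord n).surjective p
  have h : (wKnot n).succ (wWord n j) = wWord n (finRotate (4 * n + 4) j) := by
    exact congrArg (fun x => wWord n (finRotate (4 * n + 4) x)) ((wWord n).symm_apply_apply j)
  rw [h, wPos_wWord, wPos_wWord, coe_finRotate]
  exact if_congr (by rw [Fin.ext_iff]; rfl) rfl rfl

theorem wPos_pred (p : (wKnot n).Passage) :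
    wPos n ((wKnot n).succ.symm p) = if wPos n p = 0 then 4 * n + 3 else wPos n p - 1 := by
  have h := wPos_succ ((wKnot n).succ.symm p)
  have h1 := wPos_lt ((wKnot n).succ.symm p)
  rw [Equiv.apply_symm_apply] at h
  split_ifs at h ⊢ <;> omega

theorem kind_wKnot (c : (wKnot n).C) : (wKnot n).kind c =
    if c.val < 2 * n then (if c.val % 2 = 0 then .negative else .virtual) else .positive := rfl

theorem isKnot_wKnot : (wKnot n).IsKnot := by
  refine (isKnot_iff rfl).mpr ⟨⟨wWord n 0⟩, ?_⟩
  have key : ∀ k, ∀ p : (wKnot n).Passage, wPos n p = k → (wKnot n).succ.SameCycle (wWord n 0) p := by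
    intro k
    induction k with
    | zero =>
      intro p hp
      have : p = wWord n 0 := wPos_injective (hp.trans (wPos_wWord 0).symm)
      rw [this]; exact .refl _ _
    | succ k ih =>
      intro p hp
      have h := ih ((wKnot n).succ.symm p) (by rw [wPos_pred, hp, if_neg (by omega)]; omega)
      exact h.trans (Equiv.Perm.sameCycle_symm_apply_left.mpr (.refl _ _))
  exact fun p q => (key _ p rfl).symm.trans (key _ q rfl)

/-- The values of the 2-chain on the left of the edges of `W_n`; `g j` is the value of the flow on
the edge number `j`. The faces are the bigons of the twist region and of the clasp, two
faces along the sides of the twist region, and two triangles between the twist region and the clasp. -/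
def wLeft (n : ℕ) (g : ℕ → ℤ) (j : ℕ) : ℤ :=
  if j < 2 * n then (if j % 2 = 0 then g j else g (4 * n + 3) - g (4 * n + 1))
  else if j = 2 * n then -g (4 * n + 1)
  else if j < 4 * n + 2 then (if j % 2 = 1 then 0 else g j + (g (4 * n + 3) - g (4 * n + 1)))
  else if j = 4 * n + 2 then -g (2 * n + 1)
  else g (4 * n + 3) - g (4 * n + 1)

theorem isPlanar_wKnot (hn : 1 ≤ n) : (wKnot n).IsPlanar := by
  intro f hf
  obtain ⟨g, hg⟩ : ∃ g : ℕ → ℤ, ∀ p, f p = g (wPos n p) := by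
    exact ⟨Function.extend (wPos n) f 0, fun p => (wPos_injective.extend_apply f 0 p).symm⟩
  simp only [hg, wPos_pred] at hf
  -- the antiparallel strands of the twist region carry flows with a constant difference
  have hpos : ∀ c : (wKnot n).C,
      (c.val < 2 * n ∧ c.val % 2 = 0 ∧ wPos n (c, true) = 4 * n + 1 - c.val ∧
        wPos n (c, false) = c.val) ∨
      (c.val < 2 * n ∧ c.val % 2 = 1 ∧ wPos n (c, true) = c.val ∧
        wPos n (c, false) = 4 * n + 1 - c.val) ∨
      (c.val = 2 * n ∧ wPos n (c, true) = 2 * n ∧ wPos n (c, false) = 4 * n + 3) ∨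
      (c.val = 2 * n + 1 ∧ wPos n (c, true) = 4 * n + 2 ∧ wPos n (c, false) = 2 * n + 1) := by
    intro c
    have hc : c.val < 2 * n + 2 := c.2
    rw [wPos_eq, wPos_eq]
    grind
  have hE : ∀ j, j < 2 * n → g j - g (4 * n - j) = g (4 * n + 3) - g (4 * n + 1) := by
    intro j
    induction j with
    | zero =>
      intro hj
      have h1 := hf (⟨0, by omega⟩ : Fin (2 * n + 2))
      have h2 := hpos (⟨0, by omega⟩ : Fin (2 * n + 2))
      grind
    | succ j ih =>
      intro hj
      have h3 := ih (by omega)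
      have h1 := hf (⟨j + 1, by omega⟩ : Fin (2 * n + 2))
      have h2 := hpos (⟨j + 1, by omega⟩ : Fin (2 * n + 2))
      have h4 : 4 * n + 1 - (j + 1) = 4 * n - j := by omega
      have h5 : 4 * n - j - 1 = 4 * n - (j + 1) := by omega
      grind
  have hclasp : g (2 * n) + g (4 * n + 1) = g (2 * n + 1) + g (4 * n + 2) := by
    have h1 := hf (⟨2 * n + 1, by omega⟩ : Fin (2 * n + 2))
    have h2 := hpos (⟨2 * n + 1, by omega⟩ : Fin (2 * n + 2))
    grind
  refine ⟨fun p => wLeft n g (wPos n p), fun p => wLeft n g (wPos n p) - g (wPos n p),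
    fun p => by rw [hg]; ring, ?_⟩
  intro c
  simp only [wPos_pred]
  rcases hpos c with ⟨h1, h2, h3, h4⟩ | ⟨h1, h2, h3, h4⟩ | ⟨h1, h3, h4⟩ | ⟨h1, h3, h4⟩
  · have e1 := hE c.val h1
    have e2 := hE (c.val - 1)
    rw [h3, h4]
    generalize c.val = i at *
    obtain ⟨k, hk⟩ : ∃ k, k = 4 * n - i := ⟨_, rfl⟩
    rw [← hk] at e1
    rw [show 4 * n + 1 - i = k + 1 by omega]
    clear hE hf hpos h3 h4 hg
    rcases i with _ | i
    · unfold wLeft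
      grind
    · rw [show 4 * n - (i + 1 - 1) = k + 1 by omega, Nat.add_sub_cancel] at e2
      replace e2 := e2 (by omega)
      have hk1 : k % 2 = 0 ∧ 2 * n < k ∧ k + 2 ≤ 4 * n := by omega
      clear hk
      unfold wLeft
      grind
  · have e1 := hE c.val h1
    have e2 := hE (c.val - 1)
    rw [h3, h4]
    generalize c.val = i at *
    obtain ⟨k, hk⟩ : ∃ k, k = 4 * n - i := ⟨_, rfl⟩
    rw [← hk] at e1
    rw [show 4 * n + 1 - i = k + 1 by omega]
    clear hE hf hpos h3 h4 hg
    rcases i with _ | i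
    · omega
    · rw [show 4 * n - (i + 1 - 1) = k + 1 by omega, Nat.add_sub_cancel] at e2
      replace e2 := e2 (by omega)
      unfold wLeft
      grind
  · have e1 := hE (2 * n - 1) (by omega)
    rw [show 4 * n - (2 * n - 1) = 2 * n + 1 by omega] at e1
    rw [h3, h4]
    clear hE hf hpos h3 h4 hg
    unfold wLeft
    grind
  · rw [h3, h4]
    clear hE hf hpos h3 h4 hg
    unfold wLeft
    grind

theorem numVirtual_wKnot : (wKnot n).numVirtual = n := by
  have h : Fin n ≃ {c : (wKnot n).C // (wKnot n).kind c = .virtual} :=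
    { toFun := fun k => ⟨(⟨2 * k.1 + 1, by omega⟩ : Fin (2 * n + 2)), by
        have h : 2 * k.1 + 1 < 2 * n := by omega
        exact (if_pos h).trans (if_neg (by change ¬ (2 * k.1 + 1) % 2 = 0; omega))⟩
      invFun := fun c => ⟨c.1.val / 2, by
        have h := c.2
        rw [kind_wKnot] at h
        split_ifs at h; omega⟩
      left_inv := fun k => Fin.ext (by change (2 * k.1 + 1) / 2 = k.1; omega)
      right_inv := fun c => Subtype.ext <| Fin.ext (n := 2 * n + 2) (by
        have h := c.2
        rw [kind_wKnot] at h
        change 2 * (c.1.val / 2) + 1 = c.1.val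
        split_ifs at h; omega) }
  rw [numVirtual, ← Fintype.card_congr h, Fintype.card_fin]

theorem numClassical_wKnot : (wKnot n).numClassical = n + 2 := by
  have h1 := (wKnot n).numVirtual_add_numClassical
  have h2 : Fintype.card (wKnot n).C = 2 * n + 2 := Fintype.card_fin _
  rw [numVirtual_wKnot, h2] at h1
  omega

theorem isClassical_wKnot_iff (c : (wKnot n).C) :
    (wKnot n).kind c ≠ .virtual ↔ c.val % 2 = 0 ∨ c.val = 2 * n + 1 := by
  have h : c.val < 2 * n + 2 := c.2
  rw [kind_wKnot]
  split_ifs <;> simp <;> omega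

theorem wKnot_ext {v w : (wKnot n).Classical} : v = w ↔ v.1.val = w.1.val := by
  rw [Subtype.ext_iff]
  exact Fin.ext_iff (n := 2 * n + 2)

theorem isUnder_wKnot (p : (wKnot n).Passage) : (wKnot n).IsUnder p ↔
    wPos n p = 2 * n + 1 ∨ wPos n p = 4 * n + 3 ∨
      (wPos n p % 2 = 1 ∧ 2 * n < wPos n p) := by
  have h : p.1.val < 2 * n + 2 := p.1.2
  rw [IsUnder, kind_wKnot, wPos_eq]
  cases p.2 <;> grind

theorem shift_wKnot (p : (wKnot n).Passage) : (wKnot n).shift p =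
    if wPos n p % 2 = 1 ∧ wPos n p < 2 * n then 1
    else if wPos n p % 2 = 0 ∧ 2 * n < wPos n p ∧ wPos n p ≤ 4 * n then -1 else 0 := by
  have h : p.1.val < 2 * n + 2 := p.1.2
  rw [shift, kind_wKnot, wPos_eq]
  cases p.2 <;> grind

/-- The number of the crossing from which the long arc through the edge number `j` of `W_n`
emanates. -/
def wOwn (n j : ℕ) : ℕ :=
  if j ≤ 2 * n ∨ j = 4 * n + 3 then 2 * n
  else if j ≤ 2 * n + 2 then 2 * n + 1
  else if j % 2 = 1 then 4 * n + 1 - j else 4 * n + 2 - j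

theorem wOwn_lt (n j : ℕ) : wOwn n j < 2 * n + 2 := by
  unfold wOwn
  split_ifs <;> omega

theorem wOwn_classical (n j : ℕ) : (wKnot n).kind (⟨wOwn n j, wOwn_lt n j⟩ : Fin (2 * n + 2)) ≠
    .virtual := by
  refine (isClassical_wKnot_iff _).mpr ?_
  change wOwn n j % 2 = 0 ∨ wOwn n j = 2 * n + 1
  unfold wOwn
  split_ifs <;> omega

theorem wPos_underpass (v : (wKnot n).Classical) : wPos n ((wKnot n).underpass v) =
    if v.1.val = 2 * n then 4 * n + 3 else if v.1.val = 2 * n + 1 then 2 * n + 1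
    else 4 * n + 1 - v.1.val := by
  have h1 := (isClassical_wKnot_iff v.1).mp v.2
  have h2 : v.1.val < 2 * n + 2 := v.1.2
  rw [wPos_eq, underpass, kind_wKnot]
  grind

theorem wPos_overpass (v : (wKnot n).Classical) : wPos n ((wKnot n).overpass v) =
    if v.1.val = 2 * n + 1 then 4 * n + 2 else v.1.val := by
  have h1 := (isClassical_wKnot_iff v.1).mp v.2
  have h2 : v.1.val < 2 * n + 2 := v.1.2
  rw [wPos_eq, overpass, kind_wKnot]
  grind

/-- The long arcs of `W_n`. The long arc emanating from the crossing `2 n` of the clasp runs through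
the twist region over all classical crossings and increases all the time; every other long arc
decreases at most once. -/
def wLabelling (hn : 1 ≤ n) : (wKnot n).Labelling where
  own p := ⟨(⟨wOwn n (wPos n p), wOwn_lt n _⟩ : Fin (2 * n + 2)), wOwn_classical n _⟩
  pos p := if wPos n p = 4 * n + 3 then 0 else if wPos n p ≤ 2 * n then wPos n p + 1
    else if wPos n p % 2 = 1 then 0 else 1
  inc p := if wPos n p ≤ 2 * n then ((wPos n p + 1) / 2 : ℕ) else 0
  dec p := if wPos n p % 2 = 0 ∧ 2 * n < wPos n p ∧ wPos n p ≤ 4 * n then 1 else 0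
  top v := if v.1.val = 2 * n then n else 0
  under v := by
    have h1 := (isClassical_wKnot_iff v.1).mp v.2
    have h2 : v.1.val < 2 * n + 2 := v.1.2
    simp only [wKnot_ext, wPos_underpass]
    unfold wOwn
    grind
  step p hu := by
    have h1 := wPos_lt p
    rw [isUnder_wKnot] at hu
    simp only [wKnot_ext, shift_wKnot, wPos_succ] at hu ⊢
    generalize wPos n p = j at *
    unfold wOwn
    by_cases h2 : j = 4 * n + 3
    · grind
    · rw [if_neg h2] at hu ⊢
      clear p
      grind (splits := 30)
  inc_le p := by
    simp only
    generalize wPos n p = j at *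
    unfold wOwn
    grind
  exists_crit v := by
    have h1 := (isClassical_wKnot_iff v.1).mp v.2
    have h2 : v.1.val < 2 * n + 2 := v.1.2
    by_cases h : v.1.val = 2 * n
    · refine ⟨(wKnot n).overpass v, ?_⟩
      simp only [wKnot_ext, wPos_overpass]
      unfold wOwn
      grind
    · refine ⟨(wKnot n).underpass v, ?_⟩
      simp only [wKnot_ext, wPos_underpass]
      unfold wOwn
      grind

theorem crit_wLabelling (hn : 1 ≤ n) (w : (wKnot n).Classical) (p : (wKnot n).Passage) :
    (wLabelling hn).Crit w p ↔
      (w.1.val = 2 * n ∧ 2 * n ≤ wPos n p + 1 ∧ wPos n p ≤ 2 * n) ∨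
      (w.1.val = 2 * n + 1 ∧ wPos n p = 2 * n + 1) ∨
      (w.1.val < 2 * n ∧ wPos n p + w.1.val = 4 * n + 1) ∨
      (w.1.val = 0 ∧ wPos n p = 4 * n + 2) := by
  have h1 := (isClassical_wKnot_iff w.1).mp w.2
  have h2 : w.1.val < 2 * n + 2 := w.1.2
  have h3 := wPos_lt p
  simp only [wLabelling, Labelling.Crit, wKnot_ext]
  generalize wPos n p = j at *
  generalize w.1.val = i at *
  clear w p
  unfold wOwn
  grind (splits := 30)

/-- The critical arcs of `W_n`, at the underpass, the overpass, and before the underpass of a classical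
crossing. -/
theorem wKnot_crit (hn : 1 ≤ n) (v w : (wKnot n).Classical) :
    ((wLabelling hn).Crit w ((wKnot n).underpass v) ↔ v.1.val = w.1.val ∧ w.1.val ≠ 2 * n) ∧
    ((wLabelling hn).Crit w ((wKnot n).overpass v) ↔
      (v.1.val = 2 * n ∧ w.1.val = 2 * n) ∨ (v.1.val = 2 * n + 1 ∧ w.1.val = 0)) ∧
    ((wLabelling hn).Crit w ((wKnot n).succ.symm ((wKnot n).underpass v)) ↔
      (v.1.val = 2 * n ∧ w.1.val = 0) ∨ (v.1.val = 2 * n + 1 ∧ w.1.val = 2 * n)) := by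
  have h1 := (isClassical_wKnot_iff v.1).mp v.2
  have h2 : v.1.val < 2 * n + 2 := v.1.2
  have h3 := (isClassical_wKnot_iff w.1).mp w.2
  have h4 : w.1.val < 2 * n + 2 := w.1.2
  rw [crit_wLabelling, crit_wLabelling, crit_wLabelling, wPos_pred, wPos_underpass, wPos_overpass]
  refine ⟨?_, ?_, ?_⟩ <;> grind

theorem wKnot_incident (hn : 1 ≤ n) (v w : (wKnot n).Classical) :
    (wKnot n).IncidentCritical v w ↔ v.1.val = w.1.val ∨ (v.1.val = 2 * n ∧ w.1.val = 0) ∨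
      (v.1.val = 2 * n + 1 ∧ (w.1.val = 0 ∨ w.1.val = 2 * n)) := by
  obtain ⟨h1, h2, h3⟩ := wKnot_crit hn v w
  rw [(wLabelling hn).incidentCritical_iff, h1, h2, h3]
  omega

theorem wKnot_pairing_unique (hn : 1 ≤ n) (τ : Equiv.Perm (wKnot n).Classical)
    (hτ : ∀ v, (wKnot n).IncidentCritical v (τ v)) : τ = 1 := by
  let o : (wKnot n).Classical := ⟨(⟨0, by omega⟩ : Fin (2 * n + 2)),
    (isClassical_wKnot_iff _).mpr (Or.inl rfl)⟩
  let q : (wKnot n).Classical := ⟨(⟨2 * n, by omega⟩ : Fin (2 * n + 2)),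
    (isClassical_wKnot_iff _).mpr (Or.inl (Nat.mul_mod_right 2 n))⟩
  have ho : o.1.val = 0 := rfl
  have hq : q.1.val = 2 * n := rfl
  have h1 := (wKnot_incident hn _ _).mp (hτ o)
  have h2 := (wKnot_incident hn _ _).mp (hτ q)
  have h3 : τ q = τ o → q.1.val = o.1.val := fun h => by rw [τ.injective h]
  rw [wKnot_ext] at h3
  ext1 v
  rw [wKnot_ext, Equiv.Perm.one_apply]
  have h4 := (wKnot_incident hn _ _).mp (hτ v)
  have h5 : τ v = τ o → v.1.val = o.1.val := fun h => by rw [τ.injective h]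
  have h6 : τ v = τ q → v.1.val = q.1.val := fun h => by rw [τ.injective h]
  rw [wKnot_ext] at h5 h6
  omega

theorem isMDiagram_wKnot (hn : 1 ≤ n) : (wKnot n).IsMDiagram := by
  refine ⟨isPlanar_wKnot hn, (wLabelling hn).isProper rfl, (wLabelling hn).isSpecial,
    fun v hv => ?_, 1, fun v => (wKnot_incident hn _ _).mpr (Or.inl rfl), wKnot_pairing_unique hn⟩
  rw [(wLabelling hn).isCyclicCrossing_iff] at hv
  have h1 := (isClassical_wKnot_iff v.1).mp v.2
  have h2 : v.1.val < 2 * n + 2 := v.1.2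
  simp only [wLabelling, wKnot_ext, wPos_overpass, wPos_pred, wPos_underpass] at hv
  unfold wOwn at hv
  grind

theorem invariants_wKnot (hn : 1 ≤ n) :
    (VirtualLink.of _ (isMDiagram_wKnot hn).planar).invariants = (1, 1) := by
  classical
  refine VirtualLink.invariants_eq (isMDiagram_wKnot hn) (a := 0) ?_
  rw [det_tMatrix (wKnot_pairing_unique hn), Equiv.Perm.sign_one, one_smul]
  have hT : ∀ v, (wKnot n).tMatrix v v =
      if v.1.val = 2 * n then LaurentPolynomial.T 1 - 1 else 1 := by
    intro v
    obtain ⟨h1, h2, h3⟩ := wKnot_crit hn v v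
    rw [(wLabelling hn).tMatrix_apply, if_congr h1 rfl rfl, if_congr h2 rfl rfl,
      if_congr h3 rfl rfl]
    by_cases h0 : v.1.val = 2 * n
    · have hkind : ((wKnot n).kind v.1).sign = 1 := by
        rw [kind_wKnot, if_neg (by omega)]; rfl
      rw [if_neg (by omega), if_pos (by omega), if_neg (by omega), if_pos h0, hkind]
      ring
    · rw [if_pos (by omega), if_neg (by omega), if_neg (by omega), if_neg h0]
      ring
  rw [Finset.prod_eq_single (⟨(⟨2 * n, by omega⟩ : Fin (2 * n + 2)),
    (isClassical_wKnot_iff _).mpr (Or.inl (Nat.mul_mod_right 2 n))⟩ : (wKnot n).Classical)]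
  · rw [Equiv.Perm.one_apply, (hT _).trans (if_pos rfl), IsSignedForm]
    simp
  · intro v _ hv
    rw [Equiv.Perm.one_apply, hT, if_neg]
    intro h
    exact hv (wKnot_ext.mpr h)
  · simp

end WKnot

end Diagram

/-! ### The series of knots -/

namespace Series

open Diagram

theorem epsValue_T_succ {n : ℕ} : T.epsValue (n + 1) =
    (if n % 2 = 1 then SumType.preCritical else SumType.preCritical.other).sign *
      (T.epsValue n * T.epsValue 1) := by
  have h : n % 4 < 4 := Nat.mod_lt _ (by norm_num)
  have h2 : n % 2 = n % 4 % 2 := by omega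
  simp only [epsValue, Nat.add_mod n 1 4, h2]
  interval_cases n % 4 <;> decide

theorem epsValue_T'_succ {n : ℕ} : T'.epsValue (n + 1) =
    (if n % 2 = 1 then SumType.postCritical else SumType.postCritical.other).sign *
      (T'.epsValue n * T'.epsValue 1) := by
  have h : n % 4 < 4 := Nat.mod_lt _ (by norm_num)
  have h2 : n % 2 = n % 4 % 2 := by omega
  simp only [epsValue, Nat.add_mod n 1 4, h2]
  interval_cases n % 4 <;> decide

theorem exists_mem (S : Series) {n : ℕ} (hn : 1 ≤ n) : ∃ D, S.Mem n D := by
  cases S with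
  | Ω => exact ⟨_, rfl⟩
  | W => exact ⟨_, rfl⟩
  | T =>
    exact exists_isChain (eps := fun n => T.epsValue n) (isSummand_positive (n := 1) le_rfl)
      (invariants_positive (n := 1) le_rfl) (fun _ _ => epsValue_T_succ) hn
  | T' =>
    exact exists_isChain (eps := fun n => T'.epsValue n) (isSummand_negative (n := 1) le_rfl)
      (invariants_negative (n := 1) le_rfl) (fun _ _ => epsValue_T'_succ) hn

theorem Mem.invariants {S : Series} {n : ℕ} (hn : 1 ≤ n) {D : Diagram} (hD : S.Mem n D) :
    ∃ h : D.IsMDiagram, D.IsKnot ∧ D.numVirtual = n ∧ D.numClassical = S.classicalValue n ∧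
      (VirtualLink.of D h.planar).invariants = (S.epsValue n, S.betaValue n) := by
  cases S with
  | Ω =>
    subst hD
    exact ⟨isMDiagram_negative hn, isKnot_altBraid, numVirtual_altBraid (by simp),
      numClassical_altBraid (by simp), invariants_negative hn⟩
  | W =>
    subst hD
    exact ⟨isMDiagram_wKnot hn, isKnot_wKnot, numVirtual_wKnot, numClassical_wKnot,
      invariants_wKnot hn⟩
  | T =>
    obtain ⟨L, hD⟩ := hD
    obtain ⟨-, h, h1, h2, h3, h4, -⟩ := hD.invariants (eps := fun n => T.epsValue n)
      (isSummand_positive (n := 1) le_rfl) (invariants_positive (n := 1) le_rfl) (fun _ _ => epsValue_T_succ)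
    refine ⟨h, h1, h2.trans ?_, h3.trans ?_, h4.trans ?_⟩
    · exact (congrArg (n * ·) (numVirtual_altBraid (n := 1) (by simp))).trans (mul_one n)
    · exact (congrArg (n * ·) (numClassical_altBraid (n := 1) (by simp))).trans (mul_comm n 2)
    · exact congrArg _ (mul_one n)
  | T' =>
    obtain ⟨L, hD⟩ := hD
    obtain ⟨-, h, h1, h2, h3, h4, -⟩ := hD.invariants (eps := fun n => T'.epsValue n)
      (isSummand_negative (n := 1) le_rfl) (invariants_negative (n := 1) le_rfl) (fun _ _ => epsValue_T'_succ)
    refine ⟨h, h1, h2.trans ?_, h3.trans ?_, h4.trans ?_⟩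
    · exact (congrArg (n * ·) (numVirtual_altBraid (n := 1) (by simp))).trans (mul_one n)
    · exact (congrArg (n * ·) (numClassical_altBraid (n := 1) (by simp))).trans (mul_comm n 2)
    · exact congrArg _ (mul_one n)

/-- The invariants `ε` and `β` distinguish the series at one place `n ≥ 2`. -/
theorem eq_of_values_eq {S S' : Series} {n : ℕ} (hn : 2 ≤ n) (h1 : S.epsValue n = S'.epsValue n)
    (h2 : S.betaValue n = S'.betaValue n) : S = S' := by
  have hm : n % 4 < 4 := Nat.mod_lt _ (by norm_num)
  cases S <;> cases S' <;> simp only [epsValue, betaValue] at h1 h2 <;>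
    first | rfl | omega | (exfalso; revert h1; interval_cases n % 4 <;> decide)

end Series

namespace Diagram

theorem isSummand_knotQ : knotQ.IsSummand := isSummand_positive (n := 2) (by norm_num)

theorem invariants_knotQ :
    (VirtualLink.of knotQ isSummand_knotQ.isMDiagram.planar).invariants = (1, 1) :=
  invariants_positive (n := 2) (by norm_num)

theorem numVirtual_knotQ : knotQ.numVirtual = 2 :=
  numVirtual_altBraid (n := 2) (κ := .positive) (by simp)

theorem numClassical_knotQ : knotQ.numClassical = 3 :=
  numClassical_altBraid (n := 2) (κ := .positive) (by simp)

theorem IsQKnot.invariants {r w : ℕ} {D : Diagram} (hD : IsQKnot r w D) : ∃ h : D.IsMDiagram,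
    D.numVirtual = 2 * r ∧ D.numClassical = 3 * r ∧
      (VirtualLink.of D h.planar).invariants = ((-1) ^ w, r) :=
  hD.1.invariants isSummand_knotQ invariants_knotQ numVirtual_knotQ numClassical_knotQ

end Diagram

theorem mainTheorem4 :
    -- the exponents and the sign are well defined for each M-diagram
    (∀ D : Diagram, D.IsMDiagram → ∃! x : ℤˣ × ℤ × ℕ,
      D.tMatrix.det = LaurentPolynomial.C (x.1 : ℤ) * LaurentPolynomial.T x.2.1 *
        (LaurentPolynomial.T 1 - 1) ^ x.2.2) ∧
    -- M-diagrams are minimal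
    (∀ (D : Diagram) (h : D.IsMDiagram),
      (VirtualLink.of D h.planar).virtualCrossingNumber = D.numVirtual) ∧
    -- `ε` and `β` are invariants of virtual links
    ∃ (eps : VirtualLink → ℤˣ) (beta : VirtualLink → ℕ),
      (∀ (D : Diagram) (h : D.IsMDiagram), ∃ α : ℤ,
        D.tMatrix.det = LaurentPolynomial.C (eps (VirtualLink.of D h.planar) : ℤ) *
          LaurentPolynomial.T α *
          (LaurentPolynomial.T 1 - 1) ^ beta (VirtualLink.of D h.planar)) ∧
      -- the special connected sum of two M-diagrams
      (∀ (D₁ D₂ : Diagram) (h₁ : D₁.IsMDiagram) (h₂ : D₂.IsMDiagram) (κ : SumType)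
        (v : D₁.Classical) (e : D₁.Passage) (w : D₂.Classical) (f : D₂.Passage),
        D₁.EdgeOfType κ v e → D₂.EdgeOfType κ w f →
        ∃ h : (D₁.connectedSum D₂ e f).IsMDiagram,
          beta (VirtualLink.of _ h.planar) =
            beta (VirtualLink.of D₁ h₁.planar) + beta (VirtualLink.of D₂ h₂.planar) ∧
          eps (VirtualLink.of _ h.planar) =
            κ.sign * (eps (VirtualLink.of D₁ h₁.planar) * eps (VirtualLink.of D₂ h₂.planar))) ∧
      -- the special sum inside one M-diagram
      (∀ (D : Diagram) (hD : D.IsMDiagram) (κ : SumType) (e f : D.Passage),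
        D.IsSpecialPair κ e f → (D.surgery e f).IsPlanar →
        ∃ h : (D.surgery e f).IsMDiagram,
          beta (VirtualLink.of _ h.planar) = beta (VirtualLink.of D hD.planar) ∧
          eps (VirtualLink.of _ h.planar) = κ.sign * eps (VirtualLink.of D hD.planar)) ∧
      -- the series `Ω_n`, `W_n`, `T_n`, `T̃_n`
      (∀ (S : Series) (n : ℕ), 1 ≤ n → (∃ D, S.Mem n D) ∧
        ∀ D, S.Mem n D → ∃ h : D.IsMDiagram, D.IsKnot ∧
          D.numVirtual = n ∧ D.numClassical = S.classicalValue n ∧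
          (VirtualLink.of D h.planar).virtualCrossingNumber = n ∧
          eps (VirtualLink.of D h.planar) = S.epsValue n ∧
          beta (VirtualLink.of D h.planar) = S.betaValue n) ∧
      -- the `Q`-series
      (∀ (r w : ℕ) (D : Diagram), Diagram.IsQKnot r w D → ∃ h : D.IsMDiagram,
          D.numVirtual = 2 * r ∧ D.numClassical = 3 * r ∧
          (VirtualLink.of D h.planar).virtualCrossingNumber = 2 * r ∧
          eps (VirtualLink.of D h.planar) = (-1) ^ w ∧
          beta (VirtualLink.of D h.planar) = r) ∧
      (∀ r : ℕ, 2 ≤ r → ∃ (w w' : ℕ) (D D' : Diagram) (h : D.IsPlanar) (h' : D'.IsPlanar),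
          Diagram.IsQKnot r w D ∧ Diagram.IsQKnot r w' D' ∧
          VirtualLink.of D h ≠ VirtualLink.of D' h') ∧
      -- the knots are pairwise distinct
      (∀ (S S' : Series) (n n' : ℕ) (D D' : Diagram) (h : D.IsPlanar) (h' : D'.IsPlanar),
        2 ≤ n → 2 ≤ n' → (S, n) ≠ (S', n') → S.Mem n D → S'.Mem n' D' →
        VirtualLink.of D h ≠ VirtualLink.of D' h') ∧
      (∀ (S : Series) (r w n : ℕ) (D D' : Diagram) (h : D.IsPlanar) (h' : D'.IsPlanar),
        2 ≤ r → 2 ≤ n → Diagram.IsQKnot r w D → S.Mem n D' →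
        VirtualLink.of D h ≠ VirtualLink.of D' h') := by
  refine ⟨fun D hD => ?_, fun D h => h.virtualCrossingNumber_eq, fun L => L.invariants.1,
    fun L => L.invariants.2, fun D h => ?_, fun D₁ D₂ h₁ h₂ κ v e w f he hf => ?_,
    fun D hD κ e f hef hp => ?_, fun S n hn => ⟨S.exists_mem hn, fun D hD => ?_⟩,
    fun r w D hD => ?_, fun r hr => ?_, fun S S' n n' D D' h h' hn hn' hne hD hD' heq => ?_,
    fun S r w n D D' h h' hr hn hD hD' heq => ?_⟩
  · obtain ⟨u, a, b, h⟩ := hD.exists_isSignedForm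
    refine ⟨(u, a, b), h, ?_⟩
    rintro ⟨v, c, d⟩ h'
    obtain ⟨rfl, rfl, rfl⟩ := IsSignedForm.unique h' h
    rfl
  · obtain ⟨u, a, b, hf⟩ := h.exists_isSignedForm
    refine ⟨a, ?_⟩
    have hi := VirtualLink.invariants_eq h hf
    beta_reduce
    rw [hi]
    exact hf
  · obtain ⟨h, hi⟩ := h₁.connectedSum h₂ ⟨v, he⟩ ⟨w, hf⟩
    exact ⟨h, congrArg Prod.snd hi, congrArg Prod.fst hi⟩
  · obtain ⟨h, hi⟩ := hD.surgery hef hp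
    exact ⟨h, (congrArg Prod.snd hi :), (congrArg Prod.fst hi :)⟩
  · obtain ⟨h, h1, h2, h3, h4⟩ := hD.invariants hn
    exact ⟨h, h1, h2, h3, h.virtualCrossingNumber_eq.trans h2, congrArg Prod.fst h4,
      congrArg Prod.snd h4⟩
  · obtain ⟨h, h1, h2, h3⟩ := hD.invariants
    exact ⟨h, h1, h2, h.virtualCrossingNumber_eq.trans h1, congrArg Prod.fst h3,
      congrArg Prod.snd h3⟩
  · -- `Q`-knots with no and with one pre-critical sum have different signs `ε`
    have hex := Diagram.exists_isQKnot Diagram.isSummand_knotQ Diagram.invariants_knotQ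
      Diagram.numVirtual_knotQ Diagram.numClassical_knotQ hr
    obtain ⟨D, hD, -⟩ := hex .postCritical
    obtain ⟨D', hD', -⟩ := hex .preCritical
    obtain ⟨hM, -, -, h1⟩ := hD.invariants
    obtain ⟨hM', -, -, h2⟩ := hD'.invariants
    refine ⟨_, _, D, D', hM.planar, hM'.planar, hD, hD', fun heq => ?_⟩
    rw [heq, h2] at h1
    have h3 := congrArg Prod.fst h1
    simp [SumType.waves] at h3
  · obtain ⟨hM, -, hv, -, hi⟩ := hD.invariants (by omega)
    obtain ⟨hM', -, hv', -, hi'⟩ := hD'.invariants (by omega)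
    have h1 := hM.virtualCrossingNumber_eq.symm.trans
      ((congrArg _ heq).trans hM'.virtualCrossingNumber_eq)
    rw [hv, hv'] at h1
    subst h1
    have h2 := hi.symm.trans ((congrArg _ heq).trans hi')
    exact hne (congrArg (·, n)
      (Series.eq_of_values_eq hn (congrArg Prod.fst h2) (congrArg Prod.snd h2)))
  · -- the virtual crossing number is `n = 2 r`, while `β` is `r` for the `Q`-knot, `1` or `n` else
    obtain ⟨hM, hv, -, hi⟩ := hD.invariants
    obtain ⟨hM', -, hv', -, hi'⟩ := hD'.invariants (by omega)
    have h1 := hM.virtualCrossingNumber_eq.symm.trans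
      ((congrArg _ heq).trans hM'.virtualCrossingNumber_eq)
    rw [hv, hv'] at h1
    have h2 : r = S.betaValue n := congrArg Prod.snd (hi.symm.trans ((congrArg _ heq).trans hi'))
    cases S <;> simp only [Series.betaValue] at h2 <;> omega
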